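/- **Setting.** Let $L\ge 1$, $d_1,\dots,d_L\ge 1$, $p=\prod_k d_k$, $m_k=p/d_k$, $m_{\min}=\min_k m_k$. For $\Psi_k\in\mathbb R^{d_k\times d_k}$ the Kronecker sum is $\Psi_1\oplus\dots\oplus\Psi_L=\sum_{k=1}^L I_{d_1}\otimes\dots\otimes I_{d_{k-1}}\otimes\Psi_k\otimes I_{d_{k+1}}\otimes\dots\otimes I_{d_L}\in\mathbb R^{p\times p}$. Let $\Omega_0=\Psi_1\oplus\dots\oplus\Psi_L$ be symmetric positive definite, $\Sigma_0=\Omega_0^{-1}$, $\kappa(\Sigma_0)=\|\Omega_0\|_2\|\Omega_0^{-1}\|_2$, let $s_k$ be the number of nonzero off-diagonal entries of $\Psi_k$, and $s=\sum_k m_ks_k$. Here $\|\cdot\|_2$ is the operator norm and $\|\cdot\|_F$ the Frobenius norm. Let $X_1,\dots,X_n$ be i.i.d. random tensors in $\mathbb R^{d_1\times\dots\times d_L}$ such that $\mathrm{vec}(X_i)=\Sigma_0^{1/2}Z_i$, where $Z_i\in\mathbb R^p$ has independent coordinates with mean zero, variance one and $\|Z_{ij}\|_{\psi_2}\le K$;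 here $\|Z\|_{\psi_2}=\inf\{t>0:\mathbb E\exp(Z^2/t^2)\le 2\}$. Put $\hat S=\frac1n\sum_i \mathrm{vec}(X_i)\mathrm{vec}(X_i)^T$ (with the ordering of coordinates used in the Kronecker products). For penalty levels $\rho_{n,k}$ the TeraLasso estimator $\hat\Omega$ (BiGLasso for $L=2$) is the minimizer of $$-\log\det\Omega+\langle\hat S,\Omega\rangle+\sum_{k=1}^L m_k\rho_{n,k}\sum_{i\ne j}|B_{k,ij}|$$ over all positive definite $\Omega=B_1\oplus\dots\oplus B_L$ with $B_k\in\mathbb R^{d_k\times d_k}$. **Theorem.** For every $K>0$ there are constants $a,c>0$ depending only on $K$, and for all $b\ge a$ and $\varepsilon_0>0$ there is a constant $C>0$ depending only on $K,b,\varepsilon_0$, such that the following holds for all $L$, $d_1,\dots,d_L$, $n$, $\Psi_1,\dots,\Psi_L$ and $X_1,\dots,X_n$ as above. Assume - (A1) $m_{\min}\ge\log p$, and $\rho_{n,k}=\delta_{n,k}/\varepsilon_k$ with $\varepsilon_0\le\varepsilon_k<1$ and $a\|\Sigma_0\|_2\sqrt{\tfrac{\log p}{n m_k}}\le\delta_{n,k}\le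 b\|\Sigma_0\|_2\sqrt{\tfrac{\log p}{n m_k}}$ for all $k$; - (A2) all eigenvalues of $\Omega_0$ lie in $[\underline k_\Omega,\overline k_\Omega]$ for some $0<\underline k_\Omega\le\overline k_\Omega<\infty$ (on which $a,b,c,C$ do not depend); - (A3) $n\,m_{\min}^2\ge C^2(L+1)\kappa(\Sigma_0)^4(s\log p+Lp)$. Then, with probability at least $1-L\exp(-c\log p)$, the estimator $\hat\Omega$ exists, is unique, and satisfies $$\frac{\|\hat\Omega-\Omega_0\|_F}{\|\Omega_0\|_2}\le C\,\kappa(\Sigma_0)\sqrt{\frac{s\log p+Lp}{n\,m_{\min}}},$$ $$\frac{\|\hat\Omega-\Omega_0\|_2}{\|\Omega_0\|_2}\le C\sqrt{L+1}\,\kappa(\Sigma_0)\sqrt{\frac{s\log p+Lp}{n\,m_{\min}^2}},\qquad \frac{\|\hat\Omega-\Omega_0\|_F}{\|\Omega_0\|_F}\le C\sqrt{L+1}\,\kappa(\Sigma_0)\sqrt{\frac{s\log p+Lp}{n\,m_{\min}^2}}.$$ -/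

import Mathlib

open MeasureTheory ProbabilityTheory

noncomputable section

namespace TeraLasso

/-- Multi-indices of an order-`L` tensor with dimensions `d 0, …, d (L-1)`. A tensor is a function
`Idx d → ℝ`, which is at the same time its vectorization; `p × p` matrices are indexed by `Idx d`. -/
abbrev Idx {L : ℕ} (d : Fin L → ℕ) : Type := ∀ k, Fin (d k)

/-- `p = ∏ₖ dₖ`. -/
def totalDim {L : ℕ} (d : Fin L → ℕ) : ℕ := ∏ k, d k

/-- `mₖ = ∏_{i ≠ k} dᵢ`. -/
def coDim {L : ℕ} (d : Fin L → ℕ) (k : Fin L) : ℕ := ∏ i ∈ Finset.univ.erase k, d i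

/-- `m_min = minₖ mₖ` (used for `L ≥ 1`). -/
def minCoDim {L : ℕ} (d : Fin L → ℕ) : ℕ := ⨅ k, coDim d k

/-- The Kronecker sum `Ψ₁ ⊕ ⋯ ⊕ Ψ_L = ∑ₖ I ⊗ Ψₖ ⊗ I`, entrywise: the `(i, j)` entry of the `k`-th
summand is `Ψₖ (iₖ, jₖ)` if `i` and `j` agree outside position `k`, and `0` otherwise. -/
def kroneckerSum {L : ℕ} {d : Fin L → ℕ} (Ψ : ∀ k, Matrix (Fin (d k)) (Fin (d k)) ℝ) :
    Matrix (Idx d) (Idx d) ℝ :=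
  Matrix.of fun i j => ∑ k, Ψ k (i k) (j k) *
    ∏ l ∈ Finset.univ.erase k, (1 : Matrix (Fin (d l)) (Fin (d l)) ℝ) (i l) (j l)

/-- `|A|_{1,off} = ∑_{i ≠ j} |A i j|`. -/
def offNorm {q : ℕ} (A : Matrix (Fin q) (Fin q) ℝ) : ℝ :=
  ∑ i, ∑ j ∈ Finset.univ.erase i, |A i j|

/-- The number of nonzero off-diagonal entries. -/
def offSupport {q : ℕ} (A : Matrix (Fin q) (Fin q) ℝ) : ℕ :=
  Set.ncard {ij : Fin q × Fin q | ij.1 ≠ ij.2 ∧ A ij.1 ij.2 ≠ 0}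

/-- `s = ∑ₖ mₖ sₖ`. -/
def sparsity {L : ℕ} {d : Fin L → ℕ} (Ψ : ∀ k, Matrix (Fin (d k)) (Fin (d k)) ℝ) : ℕ :=
  ∑ k, coDim d k * offSupport (Ψ k)

/-- The operator norm with respect to the Euclidean norms. -/
def opNorm {ι : Type*} [Fintype ι] [DecidableEq ι] (A : Matrix ι ι ℝ) : ℝ :=
  ‖Matrix.toEuclideanCLM (n := ι) (𝕜 := ℝ) A‖

/-- The Frobenius norm. -/
def frobNorm {ι : Type*} [Fintype ι] (A : Matrix ι ι ℝ) : ℝ :=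
  Real.sqrt (∑ i, ∑ j, A i j ^ 2)

/-- The condition number `‖A‖₂ ‖A⁻¹‖₂` of an invertible matrix. -/
def condNumber {ι : Type*} [Fintype ι] [DecidableEq ι] (A : Matrix ι ι ℝ) : ℝ :=
  opNorm A * opNorm A⁻¹

/-- `A` is symmetric with all eigenvalues in `[lo, hi]`. -/
def SpectrumWithin {ι : Type*} [Fintype ι] [DecidableEq ι] (A : Matrix ι ι ℝ) (lo hi : ℝ) : Prop :=
  A.IsHermitian ∧ ∀ t ∈ spectrum ℝ A, lo ≤ t ∧ t ≤ hi

/-- The norm `‖Z‖_{ψ₂} = inf {t > 0 : E exp(Z² / t²) ≤ 2}`, which is `∞` if there is no such `t`. -/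
def psiTwoNorm {S : Type*} [MeasurableSpace S] (μ : Measure S) (Z : S → ℝ) : ENNReal :=
  ⨅ (t : ℝ) (_ : 0 < t) (_ : ∫⁻ ω, ENNReal.ofReal (Real.exp (Z ω ^ 2 / t ^ 2)) ∂μ ≤ 2),
    ENNReal.ofReal t

/-- `X` is a sub-gaussian random vector (tensor) with covariance `cov`: `X = cov^{1/2} Z`, where
`cov^{1/2}` is the positive semidefinite square root and `Z` has independent coordinates with mean
zero, unit variance, and `ψ₂`-norm at most `K`. -/
def IsSubGaussianTensor {S : Type*} [MeasurableSpace S] (μ : Measure S) {ι : Type*} [Fintype ι]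
    (K : ℝ) (cov : Matrix ι ι ℝ) (X : S → ι → ℝ) : Prop :=
  ∃ (R : Matrix ι ι ℝ) (Z : ι → S → ℝ),
    R.PosSemidef ∧ R * R = cov ∧
    (∀ j, Measurable (Z j)) ∧ iIndepFun Z μ ∧
    (∀ j, ∫ ω, Z j ω ∂μ = 0) ∧ (∀ j, ∫ ω, Z j ω ^ 2 ∂μ = 1) ∧
    (∀ j, psiTwoNorm μ (Z j) ≤ ENNReal.ofReal K) ∧
    ∀ ω, X ω = R.mulVec fun j => Z j ω

/-- The sample covariance `n⁻¹ ∑ᵢ xᵢ xᵢᵀ`. -/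
def sampleCov {ι : Type*} {n : ℕ} (x : Fin n → ι → ℝ) : Matrix ι ι ℝ :=
  (n : ℝ)⁻¹ • ∑ i, Matrix.vecMulVec (x i) (x i)

/-- The objective `-log |Ω| + ⟨S, Ω⟩ + ∑ₖ mₖ ρₖ |Ψₖ|_{1,off}` at `Ω = Ψ₁ ⊕ ⋯ ⊕ Ψ_L`. It depends on
`Ω` only, since the off-diagonal entries of the factors are determined by `Ω`. -/
def objective {L : ℕ} {d : Fin L → ℕ} (S : Matrix (Idx d) (Idx d) ℝ) (ρ : Fin L → ℝ)
    (Ψ : ∀ k, Matrix (Fin (d k)) (Fin (d k)) ℝ) : ℝ :=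
  -Real.log (kroneckerSum Ψ).det + (S.transpose * kroneckerSum Ψ).trace +
    ∑ k, (coDim d k : ℝ) * ρ k * offNorm (Ψ k)

/-- `Ωhat` minimizes the objective over the positive definite Kronecker sums. -/
def IsEstimator {L : ℕ} {d : Fin L → ℕ} (S : Matrix (Idx d) (Idx d) ℝ) (ρ : Fin L → ℝ)
    (Ωhat : Matrix (Idx d) (Idx d) ℝ) : Prop :=
  Ωhat.PosDef ∧ ∃ Ψ : ∀ k, Matrix (Fin (d k)) (Fin (d k)) ℝ, Ωhat = kroneckerSum Ψ ∧
    ∀ Ψ' : ∀ k, Matrix (Fin (d k)) (Fin (d k)) ℝ, (kroneckerSum Ψ').PosDef →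
      objective S ρ Ψ ≤ objective S ρ Ψ'

/-- `(s log p + L p)`. -/
def complexity {L : ℕ} {d : Fin L → ℕ} (Ψ : ∀ k, Matrix (Fin (d k)) (Fin (d k)) ℝ) : ℝ :=
  sparsity Ψ * Real.log (totalDim d) + L * totalDim d

end TeraLasso

end

open TeraLasso

/-!
The negative log-determinant is convex, with curvature of order `‖Ω₀‖⁻²` in Frobenius norm on a
ball around `Ω₀` of operator norm radius of order `‖Σ₀‖⁻¹`. So `Ωhat` exists, is unique and is
within `R` of `Ω₀` as soon as the objective is larger than its value at `Ω₀` on the Frobenius sphere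
of radius `R` around `Ω₀` among the Kronecker sums. On that sphere the curvature has to beat the
noise `⟨Ŝ - Σ₀, Δ⟩`. Its part from the off-diagonal entries of the factors is absorbed by the
penalties, up to the nonzero entries of `Ψ`. Its part from the diagonals lives in a space of
dimension at most `∑ dₖ ≤ L p / m_min` and is controlled on a net. Both bounds come from a
Hanson–Wright inequality for `vec(X)ᵀ A vec(X)`. The operator norm of a Kronecker sum is at most
`√((L + 1) / m_min)` times its Frobenius norm: this passes from the Frobenius ball to the operator
norm ball, where (A3) is needed, and yields the second and third error bounds from the first.
-/

open scoped Matrix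

namespace TeraLasso

section Norms

variable {ι : Type*} [Fintype ι]

lemma frobNorm_nonneg (A : Matrix ι ι ℝ) : 0 ≤ frobNorm A := Real.sqrt_nonneg _

lemma frobNorm_sq (A : Matrix ι ι ℝ) : frobNorm A ^ 2 = ∑ i, ∑ j, A i j ^ 2 :=
  Real.sq_sqrt (Finset.sum_nonneg fun _ _ => Finset.sum_nonneg fun _ _ => sq_nonneg _)

lemma trace_transpose_mul_eq_sum (A B : Matrix ι ι ℝ) :
    (Aᵀ * B).trace = ∑ i, ∑ j, A i j * B i j := by
  rw [Finset.sum_comm]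
  rfl

lemma trace_transpose_mul_comm (A B : Matrix ι ι ℝ) : (Aᵀ * B).trace = (Bᵀ * A).trace := by
  simp only [trace_transpose_mul_eq_sum, mul_comm]

lemma frobNorm_sq_eq_trace (A : Matrix ι ι ℝ) : frobNorm A ^ 2 = (Aᵀ * A).trace := by
  rw [frobNorm_sq, trace_transpose_mul_eq_sum]
  simp only [sq]

open scoped Matrix.Norms.Frobenius in
lemma frobNorm_eq_norm (A : Matrix ι ι ℝ) : frobNorm A = ‖A‖ := by
  simp [frobNorm, Matrix.frobenius_norm_def, Real.sqrt_eq_rpow]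

open scoped Matrix.Norms.Frobenius in
lemma frobNorm_transpose (A : Matrix ι ι ℝ) : frobNorm Aᵀ = frobNorm A := by
  simpa only [frobNorm_eq_norm] using Matrix.frobenius_norm_transpose A

open scoped Matrix.Norms.Frobenius in
lemma frobNorm_smul (t : ℝ) (A : Matrix ι ι ℝ) : frobNorm (t • A) = |t| * frobNorm A := by
  simp only [frobNorm_eq_norm, norm_smul, Real.norm_eq_abs]

open scoped Matrix.Norms.Frobenius in
lemma eq_zero_of_frobNorm_eq_zero {A : Matrix ι ι ℝ} (hA : frobNorm A = 0) : A = 0 := by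
  rwa [frobNorm_eq_norm, norm_eq_zero] at hA

lemma frobNorm_sum_sq_of_orthogonal {κ : Type*} [Fintype κ] (T : κ → Matrix ι ι ℝ)
    (hT : Pairwise fun k l => ((T k)ᵀ * T l).trace = 0) :
    frobNorm (∑ k, T k) ^ 2 = ∑ k, frobNorm (T k) ^ 2 := by
  simp only [frobNorm_sq_eq_trace, Matrix.transpose_sum, Matrix.sum_mul, Matrix.mul_sum,
    Matrix.trace_sum]
  exact Finset.sum_congr rfl fun k _ =>
    Finset.sum_eq_single k (fun l _ hl => hT hl) (by simp)

variable [DecidableEq ι]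

lemma frobNorm_diagonal_sq (v : ι → ℝ) : frobNorm (Matrix.diagonal v) ^ 2 = ∑ i, v i ^ 2 := by
  rw [frobNorm_sq]
  refine Finset.sum_congr rfl fun i _ => ?_
  rw [Finset.sum_eq_single i] <;> simp +contextual [eq_comm]

lemma trace_transpose_diagonal_mul (v : ι → ℝ) (A : Matrix ι ι ℝ) :
    ((Matrix.diagonal v)ᵀ * A).trace = ∑ i, v i * A i i := by
  simp [Matrix.trace, Matrix.diagonal_transpose, Matrix.diagonal_mul]

open scoped Matrix.Norms.L2Operator in
lemma opNorm_eq_norm (A : Matrix ι ι ℝ) : opNorm A = ‖A‖ := rfl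

lemma opNorm_nonneg (A : Matrix ι ι ℝ) : 0 ≤ opNorm A := norm_nonneg _

open scoped Matrix.Norms.L2Operator in
lemma opNorm_mul_le (A B : Matrix ι ι ℝ) : opNorm (A * B) ≤ opNorm A * opNorm B := by
  simpa only [opNorm_eq_norm] using norm_mul_le A B

open scoped Matrix.Norms.L2Operator in
lemma opNorm_add_le (A B : Matrix ι ι ℝ) : opNorm (A + B) ≤ opNorm A + opNorm B := by
  simpa only [opNorm_eq_norm] using norm_add_le A B

open scoped Matrix.Norms.L2Operator in
lemma opNorm_sum_le {κ : Type*} (s : Finset κ) (f : κ → Matrix ι ι ℝ) :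
    opNorm (∑ k ∈ s, f k) ≤ ∑ k ∈ s, opNorm (f k) := by
  simpa only [opNorm_eq_norm] using norm_sum_le s f

open scoped Matrix.Norms.L2Operator in
lemma opNorm_smul (t : ℝ) (A : Matrix ι ι ℝ) : opNorm (t • A) = |t| * opNorm A := by
  simp only [opNorm_eq_norm, norm_smul, Real.norm_eq_abs]

open scoped Matrix.Norms.L2Operator in
lemma opNorm_transpose (A : Matrix ι ι ℝ) : opNorm Aᵀ = opNorm A := by
  rw [opNorm_eq_norm, opNorm_eq_norm, ← Matrix.conjTranspose_eq_transpose_of_trivial,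
    Matrix.l2_opNorm_conjTranspose]

open scoped Matrix.Norms.L2Operator in
lemma opNorm_transpose_mul_self (A : Matrix ι ι ℝ) : opNorm (Aᵀ * A) = opNorm A ^ 2 := by
  rw [opNorm_eq_norm, opNorm_eq_norm, ← Matrix.conjTranspose_eq_transpose_of_trivial,
    Matrix.l2_opNorm_conjTranspose_mul_self, sq]

open scoped Matrix.Norms.L2Operator in
lemma opNorm_one [Nonempty ι] : opNorm (1 : Matrix ι ι ℝ) = 1 := by
  rw [opNorm_eq_norm, norm_one]

open scoped Matrix.Norms.L2Operator in
lemma opNorm_diagonal (v : ι → ℝ) : opNorm (Matrix.diagonal v) = ‖v‖ :=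
  Matrix.l2_opNorm_diagonal v

open scoped Matrix.Norms.L2Operator in
lemma sum_mulVec_sq_le (A : Matrix ι ι ℝ) (x : ι → ℝ) :
    ∑ i, (A *ᵥ x) i ^ 2 ≤ opNorm A ^ 2 * ∑ i, x i ^ 2 := by
  have hsq := pow_le_pow_left₀ (norm_nonneg _) (Matrix.l2_opNorm_mulVec A (WithLp.toLp 2 x)) 2
  rw [mul_pow, EuclideanSpace.norm_sq_eq, EuclideanSpace.norm_sq_eq] at hsq
  simpa [Real.norm_eq_abs, sq_abs, opNorm_eq_norm] using hsq

lemma opNorm_le_of_sum_mulVec_sq_le {A : Matrix ι ι ℝ} {c : ℝ} (hc : 0 ≤ c)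
    (hA : ∀ x : ι → ℝ, ∑ i, (A *ᵥ x) i ^ 2 ≤ c ^ 2 * ∑ i, x i ^ 2) : opNorm A ≤ c := by
  refine ContinuousLinearMap.opNorm_le_bound _ hc fun x => le_of_sq_le_sq ?_ (by positivity)
  rw [mul_pow, EuclideanSpace.norm_sq_eq, EuclideanSpace.norm_sq_eq]
  simpa [Real.norm_eq_abs, sq_abs] using hA x.ofLp

lemma abs_entry_le_opNorm (A : Matrix ι ι ℝ) (i j : ι) : |A i j| ≤ opNorm A := by
  refine abs_le_of_sq_le_sq ?_ (opNorm_nonneg _)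
  have hcol := sum_mulVec_sq_le A (Pi.single j 1)
  simp only [Matrix.mulVec_single_one, Matrix.col_apply, Pi.single_apply, ite_pow, one_pow,
    zero_pow two_ne_zero, Finset.sum_ite_eq', Finset.mem_univ, if_true, mul_one] at hcol
  exact (Finset.single_le_sum (f := fun i => A i j ^ 2) (fun _ _ => sq_nonneg _)
    (Finset.mem_univ i)).trans hcol

lemma frobNorm_mul_le_opNorm_mul (A B : Matrix ι ι ℝ) :
    frobNorm (A * B) ≤ opNorm A * frobNorm B := by
  refine le_of_sq_le_sq ?_ (mul_nonneg (opNorm_nonneg _) (frobNorm_nonneg _))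
  rw [mul_pow, frobNorm_sq, frobNorm_sq, Finset.sum_comm,
    Finset.sum_comm (f := fun i j => B i j ^ 2), Finset.mul_sum]
  refine Finset.sum_le_sum fun j _ => ?_
  simpa [Matrix.mulVec, dotProduct, Matrix.mul_apply] using sum_mulVec_sq_le A fun i => B i j

lemma frobNorm_mul_le_mul_opNorm (A B : Matrix ι ι ℝ) :
    frobNorm (A * B) ≤ frobNorm A * opNorm B := by
  rw [← frobNorm_transpose, Matrix.transpose_mul, ← opNorm_transpose B, ← frobNorm_transpose A,
    mul_comm (frobNorm _)]
  exact frobNorm_mul_le_opNorm_mul _ _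

lemma frobNorm_transpose_mul_mul_le (A M : Matrix ι ι ℝ) :
    frobNorm (Aᵀ * M * A) ≤ opNorm A ^ 2 * frobNorm M :=
  calc frobNorm (Aᵀ * M * A) ≤ frobNorm (Aᵀ * M) * opNorm A := frobNorm_mul_le_mul_opNorm _ _
    _ ≤ opNorm Aᵀ * frobNorm M * opNorm A := by
      gcongr
      · exact opNorm_nonneg _
      · exact frobNorm_mul_le_opNorm_mul _ _
    _ = opNorm A ^ 2 * frobNorm M := by rw [opNorm_transpose]; ring

lemma opNorm_transpose_mul_mul_le (A M : Matrix ι ι ℝ) :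
    opNorm (Aᵀ * M * A) ≤ opNorm A ^ 2 * opNorm M :=
  calc opNorm (Aᵀ * M * A) ≤ opNorm (Aᵀ * M) * opNorm A := opNorm_mul_le _ _
    _ ≤ opNorm Aᵀ * opNorm M * opNorm A := by
      gcongr
      · exact opNorm_nonneg _
      · exact opNorm_mul_le _ _
    _ = opNorm A ^ 2 * opNorm M := by rw [opNorm_transpose]; ring

end Norms

section OffDiagonal

variable {ι : Type*} [DecidableEq ι]

/-- The off-diagonal part of a matrix. -/
def offPart (A : Matrix ι ι ℝ) : Matrix ι ι ℝ :=
  A - Matrix.diagonal A.diag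

lemma offPart_apply_self (A : Matrix ι ι ℝ) (a : ι) : offPart A a a = 0 := by simp [offPart]

lemma offPart_apply_ne (A : Matrix ι ι ℝ) {a b : ι} (h : a ≠ b) : offPart A a b = A a b := by
  simp [offPart, h]

lemma offPart_add (A B : Matrix ι ι ℝ) : offPart (A + B) = offPart A + offPart B := by
  rw [offPart, offPart, offPart, Matrix.diag_add, sub_add_sub_comm, Matrix.diagonal_add]
  rfl

end OffDiagonal

section LogDet

variable {ι : Type*} [Fintype ι] [DecidableEq ι]

/-- `P` diagonalizes the quadratic forms of `A` and `D` simultaneously: `A` becomes the identity and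
`D` becomes `diagonal h`. The `h i` are the eigenvalues of `A⁻¹ * D`. -/
structure IsCongruenceDiagonalization (A D P : Matrix ι ι ℝ) (h : ι → ℝ) : Prop where
  isUnit : IsUnit P
  eq_transpose_mul_self : A = Pᵀ * P
  eq_transpose_mul_diagonal_mul : D = Pᵀ * Matrix.diagonal h * P

lemma isHermitian_exists_diagonalization {H : Matrix ι ι ℝ} (hH : H.IsHermitian) :
    ∃ (U : Matrix ι ι ℝ) (h : ι → ℝ), Uᵀ * U = 1 ∧ H = Uᵀ * Matrix.diagonal h * U := by
  refine ⟨(hH.eigenvectorUnitary : Matrix ι ι ℝ)ᵀ, hH.eigenvalues, ?_, ?_⟩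
  · simpa [Matrix.star_eq_conjTranspose, Matrix.conjTranspose_eq_transpose_of_trivial] using
      Unitary.coe_mul_star_self hH.eigenvectorUnitary
  · conv_lhs => rw [hH.spectral_theorem, Unitary.conjStarAlgAut_apply]
    rw [Matrix.star_eq_conjTranspose, Matrix.conjTranspose_eq_transpose_of_trivial,
      Matrix.transpose_transpose]
    rfl

open scoped MatrixOrder in
lemma exists_isCongruenceDiagonalization {A D : Matrix ι ι ℝ} (hA : A.PosDef)
    (hD : D.IsHermitian) : ∃ P h, IsCongruenceDiagonalization A D P h := by
  obtain ⟨B, hB, hAB⟩ :=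
    CStarAlgebra.isStrictlyPositive_iff_eq_star_mul_self.1 hA.isStrictlyPositive
  rw [Matrix.star_eq_conjTranspose, Matrix.conjTranspose_eq_transpose_of_trivial] at hAB
  have hBinv : B⁻¹ * B = 1 := Matrix.nonsing_inv_mul _ ((Matrix.isUnit_iff_isUnit_det B).1 hB)
  have hBinv_transpose : Bᵀ * B⁻¹ᵀ = 1 := by
    rw [← Matrix.transpose_mul, hBinv, Matrix.transpose_one]
  obtain ⟨U, h, hU, hdiag⟩ := isHermitian_exists_diagonalization
    (H := B⁻¹ᵀ * D * B⁻¹) (by simpa using Matrix.isHermitian_conjTranspose_mul_mul B⁻¹ hD)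
  refine ⟨U * B, h, (IsUnit.of_mul_eq_one_right _ hU).mul hB, ?_, ?_⟩
  · calc A = Bᵀ * (Uᵀ * U) * B := by rw [hU, Matrix.mul_one, hAB]
      _ = (U * B)ᵀ * (U * B) := by simp only [Matrix.transpose_mul, Matrix.mul_assoc]
  · calc D = (Bᵀ * B⁻¹ᵀ) * D * (B⁻¹ * B) := by
          rw [hBinv_transpose, hBinv, Matrix.one_mul, Matrix.mul_one]
      _ = Bᵀ * (B⁻¹ᵀ * D * B⁻¹) * B := by simp only [Matrix.mul_assoc]
      _ = (U * B)ᵀ * Matrix.diagonal h * (U * B) := by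
          rw [hdiag]; simp only [Matrix.transpose_mul, Matrix.mul_assoc]

namespace IsCongruenceDiagonalization

variable {A D P : Matrix ι ι ℝ} {h : ι → ℝ}

lemma add_smul (hP : IsCongruenceDiagonalization A D P h) (t : ℝ) :
    A + t • D = Pᵀ * Matrix.diagonal (fun i => 1 + t * h i) * P := by
  have hdiag : Matrix.diagonal (fun i => 1 + t * h i) = 1 + t • Matrix.diagonal h := by
    rw [← Matrix.diagonal_one, ← Matrix.diagonal_smul, Matrix.diagonal_add]
    rfl
  rw [hdiag, hP.eq_transpose_mul_self, hP.eq_transpose_mul_diagonal_mul]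
  simp only [Matrix.mul_add, Matrix.add_mul, Matrix.mul_one, Matrix.mul_smul, Matrix.smul_mul]

lemma posDef_add_smul_iff (hP : IsCongruenceDiagonalization A D P h) (t : ℝ) :
    (A + t • D).PosDef ↔ ∀ i, 0 < 1 + t * h i := by
  rw [hP.add_smul, ← Matrix.conjTranspose_eq_transpose_of_trivial, ← Matrix.star_eq_conjTranspose,
    Matrix.IsUnit.posDef_star_left_conjugate_iff hP.isUnit, Matrix.posDef_diagonal_iff]

lemma log_det_add_smul (hP : IsCongruenceDiagonalization A D P h) (hA : A.PosDef) {t : ℝ}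
    (ht : ∀ i, 0 < 1 + t * h i) :
    Real.log (A + t • D).det = Real.log A.det + ∑ i, Real.log (1 + t * h i) := by
  have hdet : (A + t • D).det = A.det * ∏ i, (1 + t * h i) := by
    rw [hP.add_smul, hP.eq_transpose_mul_self, Matrix.det_mul, Matrix.det_mul, Matrix.det_mul,
      Matrix.det_diagonal]
    ring
  rw [hdet, Real.log_mul hA.det_pos.ne' (Finset.prod_ne_zero_iff.2 fun i _ => (ht i).ne'),
    Real.log_prod fun i _ => (ht i).ne']

lemma mul_inv_eq_one (hP : IsCongruenceDiagonalization A D P h) : P * P⁻¹ = 1 :=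
  Matrix.mul_nonsing_inv _ ((Matrix.isUnit_iff_isUnit_det P).1 hP.isUnit)

lemma inv_eq (hP : IsCongruenceDiagonalization A D P h) : A⁻¹ = P⁻¹ * P⁻¹ᵀ := by
  rw [hP.eq_transpose_mul_self, Matrix.mul_inv_rev, Matrix.transpose_nonsing_inv]

lemma diagonal_eq (hP : IsCongruenceDiagonalization A D P h) :
    Matrix.diagonal h = P⁻¹ᵀ * D * P⁻¹ := by
  have hPinv_transpose : P⁻¹ᵀ * Pᵀ = 1 := by
    rw [← Matrix.transpose_mul, hP.mul_inv_eq_one, Matrix.transpose_one]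
  calc Matrix.diagonal h = (P⁻¹ᵀ * Pᵀ) * Matrix.diagonal h * (P * P⁻¹) := by
        rw [hPinv_transpose, hP.mul_inv_eq_one, Matrix.one_mul, Matrix.mul_one]
    _ = P⁻¹ᵀ * D * P⁻¹ := by
        rw [hP.eq_transpose_mul_diagonal_mul]; simp only [Matrix.mul_assoc]

lemma trace_inv_mul (hP : IsCongruenceDiagonalization A D P h) :
    (A⁻¹ * D).trace = ∑ i, h i := by
  rw [hP.inv_eq, Matrix.mul_assoc, Matrix.trace_mul_comm, ← hP.diagonal_eq, Matrix.trace_diagonal]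

lemma abs_le (hP : IsCongruenceDiagonalization A D P h) (i : ι) :
    |h i| ≤ opNorm A⁻¹ * opNorm D := by
  have hAinv : opNorm A⁻¹ = opNorm P⁻¹ ^ 2 := by
    rw [hP.inv_eq, ← opNorm_transpose P⁻¹, ← opNorm_transpose_mul_self, Matrix.transpose_transpose]
  calc |h i| ≤ ‖h‖ := norm_le_pi_norm h i
    _ = opNorm (P⁻¹ᵀ * D * P⁻¹) := by rw [← opNorm_diagonal, hP.diagonal_eq]
    _ ≤ opNorm A⁻¹ * opNorm D := hAinv ▸ opNorm_transpose_mul_mul_le _ _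

lemma frobNorm_sq_le (hP : IsCongruenceDiagonalization A D P h) :
    frobNorm D ^ 2 ≤ opNorm A ^ 2 * ∑ i, h i ^ 2 := by
  have hD : frobNorm D ≤ opNorm A * frobNorm (Matrix.diagonal h) := by
    rw [hP.eq_transpose_mul_self, opNorm_transpose_mul_self]
    conv_lhs => rw [hP.eq_transpose_mul_diagonal_mul]
    exact frobNorm_transpose_mul_mul_le _ _
  rw [← frobNorm_diagonal_sq, ← mul_pow]
  exact pow_le_pow_left₀ (frobNorm_nonneg _) hD 2

end IsCongruenceDiagonalization

lemma log_one_add_le_sub_sq {h : ℝ} (hh : |h| ≤ 1 / 5) : Real.log (1 + h) ≤ h - h ^ 2 / 4 := by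
  have htaylor := (abs_le.1 <|
    Real.abs_log_sub_add_sum_range_le (x := -h) (by rw [abs_neg]; linarith) 2).2
  simp only [Finset.sum_range_succ, Finset.sum_range_zero, abs_neg, sub_neg_eq_add] at htaylor
  have hremainder : |h| ^ (2 + 1) / (1 - |h|) ≤ h ^ 2 / 4 := by
    rw [div_le_iff₀ (by linarith), ← sq_abs h]
    nlinarith [sq_nonneg |h|, abs_nonneg h]
  norm_num at htaylor hremainder
  linarith

theorem posDef_add_and_frobNorm_sq_le_neg_log_det {A D : Matrix ι ι ℝ} (hA : A.PosDef)
    (hD : D.IsHermitian) (hsmall : opNorm A⁻¹ * opNorm D ≤ 1 / 5) :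
    (A + D).PosDef ∧ frobNorm D ^ 2 ≤
      4 * opNorm A ^ 2 * (-Real.log (A + D).det + Real.log A.det + (A⁻¹ * D).trace) := by
  obtain ⟨P, h, hP⟩ := exists_isCongruenceDiagonalization hA hD
  have hle : ∀ i, |h i| ≤ 1 / 5 := fun i => (hP.abs_le i).trans hsmall
  have hpos : ∀ i, 0 < 1 + 1 * h i := fun i => by linarith [(abs_le.1 (hle i)).1]
  have hlog : ∑ i, Real.log (1 + 1 * h i) ≤ ∑ i, h i - (∑ i, h i ^ 2) / 4 := by
    rw [Finset.sum_div, ← Finset.sum_sub_distrib]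
    exact Finset.sum_le_sum fun i _ => by simpa using log_one_add_le_sub_sq (hle i)
  have hposDef := (hP.posDef_add_smul_iff 1).2 hpos
  have hlogdet := hP.log_det_add_smul hA hpos
  rw [one_smul] at hposDef hlogdet
  refine ⟨hposDef, hP.frobNorm_sq_le.trans ?_⟩
  rw [hlogdet, hP.trace_inv_mul]
  nlinarith [sq_nonneg (opNorm A)]

omit [Fintype ι] [DecidableEq ι] in
lemma convex_posDef : Convex ℝ {A : Matrix ι ι ℝ | A.PosDef} :=
  convex_iff_forall_pos.2 fun _ hA _ hB _ _ ha hb _ => (hA.smul ha).add (hB.smul hb)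

lemma mul_log_one_add_lt {t h : ℝ} (ht0 : 0 < t) (ht1 : t < 1) (hh : 0 < 1 + h) (hne : h ≠ 0) :
    t * Real.log (1 + h) < Real.log (1 + t * h) := by
  have hconc := strictConcaveOn_log_Ioi.2 (Set.mem_Ioi.2 one_pos) (Set.mem_Ioi.2 hh)
    (by simpa using hne) (sub_pos.2 ht1) ht0 (sub_add_cancel 1 t)
  simp only [smul_eq_mul, Real.log_one, mul_zero, zero_add] at hconc
  rwa [show (1 - t) * 1 + t * (1 + h) = 1 + t * h by ring] at hconc

theorem strictConcaveOn_log_det :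
    StrictConcaveOn ℝ {A : Matrix ι ι ℝ | A.PosDef} fun A => Real.log A.det := by
  refine ⟨convex_posDef, fun A hA B hB hAB s t hs ht hst => ?_⟩
  obtain ⟨P, h, hP⟩ := exists_isCongruenceDiagonalization hA (hB.isHermitian.sub hA.isHermitian)
  have hB_eq : A + (1 : ℝ) • (B - A) = B := by simp
  have hcomb : A + t • (B - A) = s • A + t • B := by
    rw [smul_sub, show s = 1 - t by linarith, sub_smul, one_smul]; abel
  have hpos : ∀ i, 0 < 1 + 1 * h i := (hP.posDef_add_smul_iff 1).1 (by rwa [hB_eq])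
  have hpos_t : ∀ i, 0 < 1 + t * h i := fun i => by nlinarith [hpos i]
  have hlogB := hP.log_det_add_smul hA hpos
  have hlog_t := hP.log_det_add_smul hA hpos_t
  simp only [hB_eq, hcomb, one_mul] at hpos hlogB hlog_t
  have hlt : ∀ i, h i ≠ 0 → t * Real.log (1 + h i) < Real.log (1 + t * h i) := fun i =>
    mul_log_one_add_lt ht (by linarith) (hpos i)
  have hle : ∀ i, t * Real.log (1 + h i) ≤ Real.log (1 + t * h i) := fun i => by
    obtain hi | hi := eq_or_ne (h i) 0
    · simp [hi]
    · exact (hlt i hi).le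
  obtain ⟨i, hi⟩ : ∃ i, h i ≠ 0 := by
    by_contra! hzero
    have hF := hP.frobNorm_sq_le
    simp only [hzero, zero_pow two_ne_zero, Finset.sum_const_zero, mul_zero] at hF
    refine hAB (sub_eq_zero.1 (eq_zero_of_frobNorm_eq_zero ?_)).symm
    exact pow_eq_zero_iff two_ne_zero |>.1 (le_antisymm hF (sq_nonneg _))
  have hsum := Finset.sum_lt_sum (fun i _ => hle i) ⟨i, Finset.mem_univ _, hlt i hi⟩
  rw [← Finset.mul_sum] at hsum
  simp only [smul_eq_mul]
  rw [hlogB, hlog_t, show s = 1 - t by linarith]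
  linarith

end LogDet

section Dimensions

variable {L : ℕ} {d : Fin L → ℕ}

lemma totalDim_eq_mul_coDim (k : Fin L) : totalDim d = d k * coDim d k :=
  (Finset.mul_prod_erase _ _ (Finset.mem_univ k)).symm

lemma card_idx : Fintype.card (Idx d) = totalDim d := by
  simp only [Fintype.card_pi, Fintype.card_fin, totalDim]

lemma totalDim_pos (hd : ∀ k, 0 < d k) : 0 < totalDim d := Finset.prod_pos fun k _ => hd k

lemma coDim_pos (hd : ∀ k, 0 < d k) (k : Fin L) : 0 < coDim d k := Finset.prod_pos fun k _ => hd k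

lemma minCoDim_le (k : Fin L) : minCoDim d ≤ coDim d k := ciInf_le (OrderBot.bddBelow _) k

lemma exists_coDim_eq_minCoDim (hL : 1 ≤ L) : ∃ k, coDim d k = minCoDim d := by
  have : Nonempty (Fin L) := ⟨⟨0, hL⟩⟩
  exact ciInf_mem (coDim d)

lemma minCoDim_pos (hL : 1 ≤ L) (hd : ∀ k, 0 < d k) : 0 < minCoDim d := by
  obtain ⟨k, hk⟩ := exists_coDim_eq_minCoDim (d := d) hL
  exact hk ▸ coDim_pos hd k

lemma dim_mul_minCoDim_le (k : Fin L) : d k * minCoDim d ≤ totalDim d := by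
  rw [totalDim_eq_mul_coDim k]
  exact Nat.mul_le_mul_left _ (minCoDim_le k)

lemma minCoDim_le_totalDim (hL : 1 ≤ L) (hd : ∀ k, 0 < d k) : minCoDim d ≤ totalDim d :=
  (Nat.le_mul_of_pos_left _ (hd ⟨0, hL⟩)).trans (dim_mul_minCoDim_le _)

lemma sum_dim_mul_minCoDim_le : (∑ k, d k) * minCoDim d ≤ L * totalDim d := by
  rw [Finset.sum_mul]
  refine (Finset.sum_le_sum fun k _ => dim_mul_minCoDim_le k).trans_eq ?_
  rw [Finset.sum_const, Finset.card_univ, Fintype.card_fin, smul_eq_mul]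

end Dimensions

section Modes

variable {L : ℕ} {d : Fin L → ℕ}

/-- The matrix `I ⊗ ⋯ ⊗ B ⊗ ⋯ ⊗ I` with `B` in position `k`, as a linear function of `B`; the
Kronecker sum is the sum of these over all positions. -/
noncomputable def modeEmbed (d : Fin L → ℕ) (k : Fin L) :
    Matrix (Fin (d k)) (Fin (d k)) ℝ →ₗ[ℝ] Matrix (Idx d) (Idx d) ℝ where
  toFun B := Matrix.of fun i j => B (i k) (j k) *
    ∏ l ∈ Finset.univ.erase k, (1 : Matrix (Fin (d l)) (Fin (d l)) ℝ) (i l) (j l)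
  map_add' _ _ := Matrix.ext fun _ _ => add_mul _ _ _
  map_smul' _ _ := Matrix.ext fun _ _ => mul_assoc _ _ _

lemma modeEmbed_apply (k : Fin L) (B : Matrix (Fin (d k)) (Fin (d k)) ℝ) (i j : Idx d) :
    modeEmbed d k B i j = B (i k) (j k) *
      ∏ l ∈ Finset.univ.erase k, (1 : Matrix (Fin (d l)) (Fin (d l)) ℝ) (i l) (j l) := rfl

lemma modeEmbed_apply_update (k : Fin L) (B : Matrix (Fin (d k)) (Fin (d k)) ℝ) (i : Idx d)
    (b : Fin (d k)) : modeEmbed d k B i (Function.update i k b) = B (i k) b := by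
  rw [modeEmbed_apply, Function.update_self, Finset.prod_eq_one, mul_one]
  intro l hl
  rw [Function.update_of_ne (Finset.ne_of_mem_erase hl), Matrix.one_apply_eq]

lemma modeEmbed_apply_self (k : Fin L) (B : Matrix (Fin (d k)) (Fin (d k)) ℝ) (i : Idx d) :
    modeEmbed d k B i i = B (i k) (i k) := by
  simpa only [Function.update_eq_self] using modeEmbed_apply_update k B i (i k)

lemma modeEmbed_apply_eq_zero (k : Fin L) (B : Matrix (Fin (d k)) (Fin (d k)) ℝ) {i j : Idx d}
    {l : Fin L} (hl : l ≠ k) (hij : i l ≠ j l) : modeEmbed d k B i j = 0 :=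
  mul_eq_zero_of_right _ <|
    Finset.prod_eq_zero (Finset.mem_erase.2 ⟨hl, Finset.mem_univ _⟩) (Matrix.one_apply_ne hij)

lemma modeEmbed_diagonal (k : Fin L) (f : Fin (d k) → ℝ) :
    modeEmbed d k (Matrix.diagonal f) = Matrix.diagonal fun i => f (i k) := by
  ext i j
  obtain rfl | hij := eq_or_ne i j
  · rw [modeEmbed_apply_self, Matrix.diagonal_apply_eq, Matrix.diagonal_apply_eq]
  · rw [Matrix.diagonal_apply_ne _ hij]
    by_cases hk : i k = j k
    · obtain ⟨l, hl⟩ := Function.ne_iff.1 hij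
      exact modeEmbed_apply_eq_zero _ _ (by rintro rfl; exact hl hk) hl
    · rw [modeEmbed_apply, Matrix.diagonal_apply_ne _ hk, zero_mul]

lemma sum_modeEmbed_row (k : Fin L) (B : Matrix (Fin (d k)) (Fin (d k)) ℝ) (i : Idx d)
    (G : Idx d → ℝ → ℝ) (hG : ∀ j, G j 0 = 0) :
    ∑ j, G j (modeEmbed d k B i j) = ∑ b, G (Function.update i k b) (B (i k) b) := by
  rw [← Finset.sum_subset (Finset.subset_univ (Finset.univ.image (Function.update i k))),
    Finset.sum_image (Function.update_injective i k).injOn]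
  · simp only [modeEmbed_apply_update]
  · intro j _ hj
    obtain ⟨l, hlk, hij⟩ : ∃ l ≠ k, i l ≠ j l := by
      by_contra! hagree
      refine hj (Finset.mem_image.2 ⟨j k, Finset.mem_univ _, ?_⟩)
      exact Function.update_eq_iff.2 ⟨rfl, hagree⟩
    rw [modeEmbed_apply_eq_zero k B hlk hij, hG]

lemma sum_sum_update_swap (k : Fin L) (F : Idx d → Fin (d k) → ℝ) :
    ∑ i, ∑ a, F i a = ∑ i : Idx d, ∑ a, F (Function.update i k a) (i k) := by
  rw [← Fintype.sum_prod_type', ← Fintype.sum_prod_type' (f := fun i a =>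
    F (Function.update i k a) (i k))]
  refine Finset.sum_nbij' (fun x => (Function.update x.1 k x.2, x.1 k))
    (fun x => (Function.update x.1 k x.2, x.1 k)) ?_ ?_ ?_ ?_ ?_ <;> simp

lemma sum_coord (k : Fin L) (c : Fin (d k) → ℝ) :
    ∑ i : Idx d, c (i k) = coDim d k * ∑ a, c a := by
  obtain hk | hk := Nat.eq_zero_or_pos (d k)
  · have : IsEmpty (Fin (d k)) := hk ▸ Fin.isEmpty
    have : IsEmpty (Idx d) := ⟨fun i => IsEmpty.false (i k)⟩
    simp
  have hswap := sum_sum_update_swap k fun (i : Idx d) _ => c (i k)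
  simp only [Function.update_self, Finset.sum_const, Finset.card_univ, Fintype.card_fin,
    nsmul_eq_mul, card_idx] at hswap
  rw [← Finset.mul_sum, totalDim_eq_mul_coDim k, Nat.cast_mul, mul_assoc] at hswap
  exact mul_left_cancel₀ (Nat.cast_ne_zero.2 hk.ne') hswap

lemma sum_eq_zero_of_sum_update_eq_zero (k : Fin L) (F : Idx d → ℝ)
    (hF : ∀ i, ∑ a, F (Function.update i k a) = 0) : ∑ i, F i = 0 := by
  obtain hempty | ⟨⟨i⟩⟩ := isEmpty_or_nonempty (Idx d)
  · exact Fintype.sum_empty F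
  have hswap := sum_sum_update_swap k fun (i : Idx d) _ => F i
  simp only [hF, Finset.sum_const_zero, Finset.sum_const, Finset.card_univ, Fintype.card_fin,
    nsmul_eq_mul] at hswap
  rw [← Finset.mul_sum] at hswap
  exact (mul_eq_zero.1 hswap).resolve_left (Nat.cast_ne_zero.2 (i k).pos.ne')

lemma frobNorm_modeEmbed_sq (k : Fin L) (B : Matrix (Fin (d k)) (Fin (d k)) ℝ) :
    frobNorm (modeEmbed d k B) ^ 2 = coDim d k * frobNorm B ^ 2 := by
  rw [frobNorm_sq, frobNorm_sq, ← sum_coord k fun a => ∑ b, B a b ^ 2]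
  exact Finset.sum_congr rfl fun i _ =>
    sum_modeEmbed_row k B i (fun _ x => x ^ 2) fun _ => zero_pow two_ne_zero

lemma opNorm_modeEmbed_le (k : Fin L) (B : Matrix (Fin (d k)) (Fin (d k)) ℝ) :
    opNorm (modeEmbed d k B) ≤ frobNorm B := by
  refine opNorm_le_of_sum_mulVec_sq_le (frobNorm_nonneg _) fun x => ?_
  have hrow : ∀ i, (modeEmbed d k B *ᵥ x) i = ∑ b, B (i k) b * x (Function.update i k b) :=
    fun i => sum_modeEmbed_row k B i (fun j y => y * x j) fun _ => zero_mul _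
  calc ∑ i, (modeEmbed d k B *ᵥ x) i ^ 2
      ≤ ∑ i : Idx d, (∑ b, B (i k) b ^ 2) * ∑ a, x (Function.update i k a) ^ 2 :=
        Finset.sum_le_sum fun i _ => hrow i ▸ Finset.sum_mul_sq_le_sq_mul_sq _ _ _
    _ = ∑ i : Idx d, ∑ a, (∑ b, B a b ^ 2) * x i ^ 2 := by
        simp only [Finset.mul_sum (s := Finset.univ) (f := fun _ => x _ ^ 2)]
        rw [sum_sum_update_swap k]
        simp only [Function.update_self, Function.update_idem, Function.update_eq_self]
    _ = frobNorm B ^ 2 * ∑ i, x i ^ 2 := by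
        rw [frobNorm_sq, Finset.mul_sum]
        simp only [← Finset.sum_mul]

lemma trace_modeEmbed_transpose_mul_modeEmbed {k l : Fin L} (hkl : k ≠ l)
    (B : Matrix (Fin (d k)) (Fin (d k)) ℝ) (C : Matrix (Fin (d l)) (Fin (d l)) ℝ) :
    ((modeEmbed d k B)ᵀ * modeEmbed d l C).trace = ∑ i : Idx d, B (i k) (i k) * C (i l) (i l) := by
  rw [trace_transpose_mul_eq_sum]
  refine Finset.sum_congr rfl fun i _ => ?_
  rw [sum_modeEmbed_row k B i (fun j x => x * modeEmbed d l C i j) fun _ => zero_mul _,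
    Finset.sum_eq_single (i k), Function.update_eq_self, modeEmbed_apply_self]
  · intro b _ hb
    rw [modeEmbed_apply_eq_zero (l := k) _ _ hkl (by simpa using hb.symm), mul_zero]
  · exact fun h => absurd (Finset.mem_univ _) h

lemma trace_modeEmbed_transpose_mul_modeEmbed_eq_zero {k l : Fin L} (hkl : k ≠ l)
    {B : Matrix (Fin (d k)) (Fin (d k)) ℝ} (hB : B.trace = 0)
    (C : Matrix (Fin (d l)) (Fin (d l)) ℝ) :
    ((modeEmbed d k B)ᵀ * modeEmbed d l C).trace = 0 := by
  rw [trace_modeEmbed_transpose_mul_modeEmbed hkl]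
  refine sum_eq_zero_of_sum_update_eq_zero k _ fun i => ?_
  simp only [Function.update_self, Function.update_of_ne hkl.symm]
  rw [← Finset.sum_mul]
  exact mul_eq_zero_of_left hB _

theorem frobNorm_diagonal_add_sum_modeEmbed_sq (v : Idx d → ℝ)
    {B : ∀ k, Matrix (Fin (d k)) (Fin (d k)) ℝ} (hB : ∀ k, (B k).trace = 0)
    (hv : ∀ k, ∑ i, v i * B k (i k) (i k) = 0) :
    frobNorm (Matrix.diagonal v + ∑ k, modeEmbed d k (B k)) ^ 2 =
      frobNorm (Matrix.diagonal v) ^ 2 + ∑ k, coDim d k * frobNorm (B k) ^ 2 := by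
  let T : Option (Fin L) → Matrix (Idx d) (Idx d) ℝ := fun o =>
    o.elim (Matrix.diagonal v) fun k => modeEmbed d k (B k)
  have hdiag : ∀ k, ((Matrix.diagonal v)ᵀ * modeEmbed d k (B k)).trace = 0 := fun k => by
    simpa only [trace_transpose_diagonal_mul, modeEmbed_apply_self] using hv k
  have horth : Pairwise fun o o' => ((T o)ᵀ * T o').trace = 0 := by
    rintro (_ | k) (_ | l) hne
    · exact absurd rfl hne
    · exact hdiag l
    · exact (trace_transpose_mul_comm _ _).trans (hdiag k)
    · have hkl : k ≠ l := fun h => hne (congrArg some h)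
      exact trace_modeEmbed_transpose_mul_modeEmbed_eq_zero hkl (hB k) _
  simpa only [Fintype.sum_option, T, Option.elim_none, Option.elim_some, frobNorm_modeEmbed_sq]
    using frobNorm_sum_sq_of_orthogonal T horth

end Modes

section KroneckerSum

variable {L : ℕ} {d : Fin L → ℕ}

lemma kroneckerSum_eq_sum_modeEmbed (A : ∀ k, Matrix (Fin (d k)) (Fin (d k)) ℝ) :
    kroneckerSum A = ∑ k, modeEmbed d k (A k) := by
  ext i j
  simp only [kroneckerSum, Matrix.of_apply, Matrix.sum_apply, modeEmbed_apply]

/-- The Kronecker sum as a linear function of its factors. -/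
noncomputable def kroneckerSumLinear (d : Fin L → ℕ) :
    (∀ k, Matrix (Fin (d k)) (Fin (d k)) ℝ) →ₗ[ℝ] Matrix (Idx d) (Idx d) ℝ where
  toFun := kroneckerSum
  map_add' A B := by
    simp only [kroneckerSum_eq_sum_modeEmbed, Pi.add_apply, map_add, Finset.sum_add_distrib]
  map_smul' c A := by
    simp only [kroneckerSum_eq_sum_modeEmbed, Pi.smul_apply, map_smul, Finset.smul_sum,
      RingHom.id_apply]

lemma kroneckerSum_add (A B : ∀ k, Matrix (Fin (d k)) (Fin (d k)) ℝ) :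
    kroneckerSum (A + B) = kroneckerSum A + kroneckerSum B :=
  map_add (kroneckerSumLinear d) A B

lemma kroneckerSum_sub (A B : ∀ k, Matrix (Fin (d k)) (Fin (d k)) ℝ) :
    kroneckerSum (A - B) = kroneckerSum A - kroneckerSum B :=
  map_sub (kroneckerSumLinear d) A B

lemma kroneckerSum_diagonal (f : ∀ k, Fin (d k) → ℝ) :
    kroneckerSum (fun k => Matrix.diagonal (f k)) = Matrix.diagonal fun i => ∑ k, f k (i k) := by
  simp only [kroneckerSum_eq_sum_modeEmbed, modeEmbed_diagonal]
  ext i j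
  simp only [Matrix.sum_apply, Matrix.diagonal_apply]
  split_ifs <;> simp

lemma kroneckerSum_apply_update (A : ∀ k, Matrix (Fin (d k)) (Fin (d k)) ℝ) (k : Fin L)
    {i : Idx d} {b : Fin (d k)} (hb : b ≠ i k) :
    kroneckerSum A i (Function.update i k b) = A k (i k) b := by
  rw [kroneckerSum_eq_sum_modeEmbed, Matrix.sum_apply, Finset.sum_eq_single k,
    modeEmbed_apply_update]
  · exact fun l _ hl => modeEmbed_apply_eq_zero _ _ hl.symm (by simpa using hb.symm)
  · exact fun h => absurd (Finset.mem_univ _) h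

/-- The component `A - (tr A / q) I` of a `q × q` matrix orthogonal to the identity. -/
noncomputable def tracelessPart {q : ℕ} (A : Matrix (Fin q) (Fin q) ℝ) : Matrix (Fin q) (Fin q) ℝ :=
  A - Matrix.diagonal fun _ => A.trace / q

lemma trace_tracelessPart {q : ℕ} (A : Matrix (Fin q) (Fin q) ℝ) : (tracelessPart A).trace = 0 := by
  obtain rfl | hq := Nat.eq_zero_or_pos q
  · exact Fintype.sum_empty _
  rw [tracelessPart, Matrix.trace_sub, Matrix.trace_diagonal, Finset.sum_const, Finset.card_univ,
    Fintype.card_fin, nsmul_eq_mul, mul_div_cancel₀ _ (Nat.cast_ne_zero.2 hq.ne'), sub_self]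

lemma kroneckerSum_eq_diagonal_add_sum_tracelessPart
    (A : ∀ k, Matrix (Fin (d k)) (Fin (d k)) ℝ) :
    kroneckerSum A = Matrix.diagonal (fun _ => ∑ k, (A k).trace / d k) +
      ∑ k, modeEmbed d k (tracelessPart (A k)) := by
  rw [← kroneckerSum_diagonal fun k _ => (A k).trace / d k, ← kroneckerSum_eq_sum_modeEmbed,
    ← kroneckerSum_add]
  exact congrArg kroneckerSum (funext fun k => (add_sub_cancel _ _).symm)

lemma opNorm_sq_le_of_const_add_sum_modeEmbed (t : ℝ) (B : ∀ k, Matrix (Fin (d k)) (Fin (d k)) ℝ) :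
    opNorm (Matrix.diagonal (fun _ => t) + ∑ k, modeEmbed d k (B k)) ^ 2 ≤
      (L + 1) * (t ^ 2 + ∑ k, frobNorm (B k) ^ 2) := by
  have hconst : opNorm (Matrix.diagonal fun _ : Idx d => t) ≤ |t| := by
    simpa only [opNorm_diagonal, Real.norm_eq_abs] using pi_norm_const_le t
  have hcauchy := sq_sum_le_card_mul_sum_sq (s := Finset.univ)
    (f := fun o : Option (Fin L) => o.elim |t| fun k => frobNorm (B k))
  simp only [Fintype.sum_option, Option.elim_none, Option.elim_some, Finset.card_univ,
    Fintype.card_option, Fintype.card_fin, sq_abs, Nat.cast_add, Nat.cast_one] at hcauchy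
  refine (pow_le_pow_left₀ (opNorm_nonneg _) ?_ 2).trans hcauchy
  exact (opNorm_add_le _ _).trans <| add_le_add hconst <|
    (opNorm_sum_le _ _).trans <| Finset.sum_le_sum fun k _ => opNorm_modeEmbed_le k (B k)

theorem opNorm_kroneckerSum_le (hL : 1 ≤ L) (hd : ∀ k, 0 < d k)
    (A : ∀ k, Matrix (Fin (d k)) (Fin (d k)) ℝ) :
    opNorm (kroneckerSum A) ≤ √((L + 1) / minCoDim d) * frobNorm (kroneckerSum A) := by
  have hm : (0 : ℝ) < minCoDim d := Nat.cast_pos.2 (minCoDim_pos hL hd)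
  have hmp : (minCoDim d : ℝ) ≤ totalDim d := Nat.cast_le.2 (minCoDim_le_totalDim hL hd)
  set t := ∑ k, (A k).trace / d k
  have hpythagoras := frobNorm_diagonal_add_sum_modeEmbed_sq (fun _ : Idx d => t)
    (fun k => trace_tracelessPart (A k)) fun k => by
      rw [← Finset.mul_sum, sum_coord k fun a => tracelessPart (A k) a a]
      exact mul_eq_zero_of_right _ (mul_eq_zero_of_right _ (trace_tracelessPart _))
  rw [← kroneckerSum_eq_diagonal_add_sum_tracelessPart, frobNorm_diagonal_sq, Finset.sum_const,
    Finset.card_univ, card_idx, nsmul_eq_mul] at hpythagoras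
  have hfrob : minCoDim d * (t ^ 2 + ∑ k, frobNorm (tracelessPart (A k)) ^ 2) ≤
      frobNorm (kroneckerSum A) ^ 2 := by
    rw [hpythagoras, mul_add, Finset.mul_sum]
    gcongr with k
    exact minCoDim_le k
  refine le_of_sq_le_sq ?_ (mul_nonneg (Real.sqrt_nonneg _) (frobNorm_nonneg _))
  rw [mul_pow, Real.sq_sqrt (by positivity), div_mul_eq_mul_div, le_div_iff₀ hm]
  have hop := opNorm_sq_le_of_const_add_sum_modeEmbed t fun k => tracelessPart (A k)
  rw [← kroneckerSum_eq_diagonal_add_sum_tracelessPart] at hop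
  calc opNorm (kroneckerSum A) ^ 2 * minCoDim d
      ≤ (L + 1) * (t ^ 2 + ∑ k, frobNorm (tracelessPart (A k)) ^ 2) * minCoDim d := by gcongr
    _ = (L + 1) * (minCoDim d * (t ^ 2 + ∑ k, frobNorm (tracelessPart (A k)) ^ 2)) := by ring
    _ ≤ (L + 1) * frobNorm (kroneckerSum A) ^ 2 := by gcongr

lemma kroneckerSum_eq_diagonal_add_sum_offPart (A : ∀ k, Matrix (Fin (d k)) (Fin (d k)) ℝ) :
    kroneckerSum A = kroneckerSum (fun k => Matrix.diagonal (A k).diag) +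
      ∑ k, modeEmbed d k (offPart (A k)) := by
  rw [← kroneckerSum_eq_sum_modeEmbed, ← kroneckerSum_add]
  exact congrArg kroneckerSum (funext fun k => (add_sub_cancel _ _).symm)

lemma frobNorm_kroneckerSum_sq (A : ∀ k, Matrix (Fin (d k)) (Fin (d k)) ℝ) :
    frobNorm (kroneckerSum A) ^ 2 =
      frobNorm (kroneckerSum fun k => Matrix.diagonal (A k).diag) ^ 2 +
        ∑ k, coDim d k * frobNorm (offPart (A k)) ^ 2 := by
  rw [kroneckerSum_eq_diagonal_add_sum_offPart, kroneckerSum_diagonal]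
  refine frobNorm_diagonal_add_sum_modeEmbed_sq _ (fun k => ?_) fun k => ?_
  · exact Finset.sum_eq_zero fun a _ => offPart_apply_self _ a
  · exact Finset.sum_eq_zero fun i _ => mul_eq_zero_of_right _ (offPart_apply_self _ _)

/-- The objective as a function of the matrix `Ω` alone: for a Kronecker sum `Ω`, the entry of the
`k`-th factor at `(a, b)` with `a ≠ b` is `Ω i (Function.update i k b)` whenever `i k = a`. -/
noncomputable def matrixObjective (S : Matrix (Idx d) (Idx d) ℝ) (ρ : Fin L → ℝ)
    (Ω : Matrix (Idx d) (Idx d) ℝ) : ℝ :=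
  -Real.log Ω.det + (Sᵀ * Ω).trace +
    ∑ k, ρ k * ∑ i, ∑ b ∈ Finset.univ.erase (i k), |Ω i (Function.update i k b)|

lemma objective_eq_matrixObjective (S : Matrix (Idx d) (Idx d) ℝ) (ρ : Fin L → ℝ)
    (A : ∀ k, Matrix (Fin (d k)) (Fin (d k)) ℝ) :
    objective S ρ A = matrixObjective S ρ (kroneckerSum A) := by
  unfold objective matrixObjective
  congr 1
  refine Finset.sum_congr rfl fun k _ => ?_
  have hentry : ∀ i : Idx d, ∑ b ∈ Finset.univ.erase (i k),
      |kroneckerSum A i (Function.update i k b)| = ∑ b ∈ Finset.univ.erase (i k), |A k (i k) b| :=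
    fun i => Finset.sum_congr rfl fun b hb => by
      rw [kroneckerSum_apply_update _ _ (Finset.ne_of_mem_erase hb)]
  simp only [hentry]
  rw [sum_coord k fun a => ∑ b ∈ Finset.univ.erase a, |A k a b|, offNorm]
  ring

end KroneckerSum

section Penalty

variable {L : ℕ} {d : Fin L → ℕ} {q : ℕ}

lemma offNorm_eq_sum (A : Matrix (Fin q) (Fin q) ℝ) :
    offNorm A = ∑ x : Fin q × Fin q, |offPart A x.1 x.2| := by
  rw [offNorm, Fintype.sum_prod_type]
  refine Finset.sum_congr rfl fun a _ => ?_
  rw [← Finset.add_sum_erase _ _ (Finset.mem_univ a), offPart_apply_self, abs_zero, zero_add]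
  exact Finset.sum_congr rfl fun b hb => by rw [offPart_apply_ne A (Finset.ne_of_mem_erase hb).symm]

lemma offSupport_eq_card (A : Matrix (Fin q) (Fin q) ℝ) :
    offSupport A = (Finset.univ.filter fun x : Fin q × Fin q => offPart A x.1 x.2 ≠ 0).card := by
  rw [offSupport, ← Set.ncard_coe_finset]
  congr 1
  ext ⟨a, b⟩
  obtain rfl | hab := eq_or_ne a b
  · simp [offPart_apply_self]
  · simp [offPart_apply_ne A hab, hab]

/-- The `ℓ₁`-norm of the off-diagonal entries of `A` on the support of `Ψ`. -/
noncomputable def supportNorm (Ψ A : Matrix (Fin q) (Fin q) ℝ) : ℝ :=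
  ∑ x : Fin q × Fin q with offPart Ψ x.1 x.2 ≠ 0, |offPart A x.1 x.2|

lemma supportNorm_nonneg (Ψ A : Matrix (Fin q) (Fin q) ℝ) : 0 ≤ supportNorm Ψ A :=
  Finset.sum_nonneg fun _ _ => abs_nonneg _

lemma supportNorm_le (Ψ A : Matrix (Fin q) (Fin q) ℝ) :
    supportNorm Ψ A ≤ √(offSupport Ψ) * frobNorm (offPart A) := by
  refine le_of_sq_le_sq ?_ (mul_nonneg (Real.sqrt_nonneg _) (frobNorm_nonneg _))
  rw [mul_pow, Real.sq_sqrt (Nat.cast_nonneg _), frobNorm_sq, offSupport_eq_card]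
  refine sq_sum_le_card_mul_sum_sq.trans ?_
  gcongr
  rw [← Fintype.sum_prod_type' (f := fun a b => offPart A a b ^ 2)]
  simp only [sq_abs]
  exact Finset.sum_le_sum_of_subset_of_nonneg (Finset.filter_subset _ _) fun _ _ _ => sq_nonneg _

lemma penalty_increment_ge (Ψ A : Matrix (Fin q) (Fin q) ℝ) {δ ρ : ℝ} (hδρ : δ ≤ ρ) (hρ : 0 ≤ ρ) :
    -(2 * ρ * supportNorm Ψ A) ≤ ρ * (offNorm (Ψ + A) - offNorm Ψ) - δ * offNorm A := by
  rw [offNorm_eq_sum, offNorm_eq_sum, offNorm_eq_sum, supportNorm, Finset.sum_filter,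
    ← Finset.sum_sub_distrib, Finset.mul_sum, Finset.mul_sum, Finset.mul_sum,
    ← Finset.sum_sub_distrib, ← Finset.sum_neg_distrib]
  refine Finset.sum_le_sum fun x _ => ?_
  rw [offPart_add, Matrix.add_apply]
  set y := offPart Ψ x.1 x.2
  set z := offPart A x.1 x.2
  have hδz : δ * |z| ≤ ρ * |z| := mul_le_mul_of_nonneg_right hδρ (abs_nonneg z)
  obtain hy | hy := eq_or_ne y 0
  · simpa [hy] using hδz
  · have hyz : |y| ≤ |y + z| + |z| := by
      simpa only [add_neg_cancel_right, abs_neg] using abs_add_le (y + z) (-z)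
    rw [if_pos hy]
    linarith [mul_le_mul_of_nonneg_left hyz hρ]

lemma sum_coDim_mul_supportNorm_le (Ψ A : ∀ k, Matrix (Fin (d k)) (Fin (d k)) ℝ) :
    ∑ k, coDim d k * supportNorm (Ψ k) (A k) ≤ √(sparsity Ψ) * frobNorm (kroneckerSum A) := by
  have hterm : ∀ k, coDim d k * supportNorm (Ψ k) (A k) ≤
      √(coDim d k * offSupport (Ψ k)) * (√(coDim d k) * frobNorm (offPart (A k))) := fun k => by
    rw [Real.sqrt_mul (Nat.cast_nonneg _), mul_mul_mul_comm, Real.mul_self_sqrt (Nat.cast_nonneg _)]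
    exact mul_le_mul_of_nonneg_left (supportNorm_le _ _) (Nat.cast_nonneg _)
  have hsparsity : ∑ k, √((coDim d k : ℝ) * offSupport (Ψ k)) ^ 2 = sparsity Ψ := by
    rw [sparsity, Nat.cast_sum]
    exact Finset.sum_congr rfl fun k _ => by
      rw [Real.sq_sqrt (by positivity), Nat.cast_mul]
  have hfrob : ∑ k, (√(coDim d k : ℝ) * frobNorm (offPart (A k))) ^ 2 ≤
      frobNorm (kroneckerSum A) ^ 2 := by
    rw [frobNorm_kroneckerSum_sq]
    refine le_add_of_nonneg_of_le (sq_nonneg _) (Finset.sum_congr rfl fun k _ => ?_).le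
    rw [mul_pow, Real.sq_sqrt (Nat.cast_nonneg _)]
  refine le_of_sq_le_sq ?_ (mul_nonneg (Real.sqrt_nonneg _) (frobNorm_nonneg _))
  calc (∑ k, coDim d k * supportNorm (Ψ k) (A k)) ^ 2
      ≤ (∑ k, √(coDim d k * offSupport (Ψ k)) * (√(coDim d k) * frobNorm (offPart (A k)))) ^ 2 :=
        pow_le_pow_left₀ (Finset.sum_nonneg fun k _ =>
          mul_nonneg (Nat.cast_nonneg _) (supportNorm_nonneg _ _))
          (Finset.sum_le_sum fun k _ => hterm k) 2
    _ ≤ sparsity Ψ * ∑ k, (√(coDim d k : ℝ) * frobNorm (offPart (A k))) ^ 2 :=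
        hsparsity ▸ Finset.sum_mul_sq_le_sq_mul_sq _ _ _
    _ ≤ (√(sparsity Ψ) * frobNorm (kroneckerSum A)) ^ 2 := by
        rw [mul_pow, Real.sq_sqrt (Nat.cast_nonneg _)]
        gcongr

end Penalty

section Noise

variable {L : ℕ} {d : Fin L → ℕ}

/-- Bounds on the linear functional `M ↦ ⟨W, M⟩` in the directions that matter for Kronecker sums:
the elementary matrices in each mode, for which `√mₖ` is the Frobenius norm, and the diagonal
Kronecker sums. In the application `W` is the error of the sample covariance. -/
structure IsNoiseBound (W : Matrix (Idx d) (Idx d) ℝ) (δ : Fin L → ℝ) (τ : ℝ) : Prop where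
  abs_trace_mul_single_le : ∀ k a b,
    |(Wᵀ * modeEmbed d k (Matrix.single a b 1)).trace| ≤ coDim d k * δ k
  abs_trace_mul_diagonal_le : ∀ f : ∀ k, Fin (d k) → ℝ,
    |(Wᵀ * kroneckerSum fun k => Matrix.diagonal (f k)).trace| ≤
      τ * frobNorm (kroneckerSum fun k => Matrix.diagonal (f k))

namespace IsNoiseBound

variable {W : Matrix (Idx d) (Idx d) ℝ} {δ : Fin L → ℝ} {τ : ℝ}

lemma abs_trace_mul_offPart_le (hW : IsNoiseBound W δ τ) (k : Fin L)
    (B : Matrix (Fin (d k)) (Fin (d k)) ℝ) :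
    |(Wᵀ * modeEmbed d k (offPart B)).trace| ≤ coDim d k * (δ k * offNorm B) := by
  have hentries : modeEmbed d k (offPart B) =
      ∑ x : Fin (d k) × Fin (d k), offPart B x.1 x.2 • modeEmbed d k (Matrix.single x.1 x.2 1) := by
    conv_lhs => rw [Matrix.matrix_eq_sum_single (offPart B)]
    rw [Fintype.sum_prod_type]
    simp only [map_sum, ← map_smul, Matrix.smul_single, smul_eq_mul, mul_one]
  rw [hentries, Matrix.mul_sum, Matrix.trace_sum, offNorm_eq_sum, ← mul_assoc, Finset.mul_sum]
  refine (Finset.abs_sum_le_sum_abs _ _).trans (Finset.sum_le_sum fun x _ => ?_)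
  rw [Matrix.mul_smul, Matrix.trace_smul, smul_eq_mul, abs_mul, mul_comm]
  exact mul_le_mul_of_nonneg_right (hW.abs_trace_mul_single_le k x.1 x.2) (abs_nonneg _)

lemma abs_trace_mul_diag_le (hW : IsNoiseBound W δ τ) (hτ : 0 ≤ τ)
    (A : ∀ k, Matrix (Fin (d k)) (Fin (d k)) ℝ) :
    |(Wᵀ * kroneckerSum fun k => Matrix.diagonal (A k).diag).trace| ≤
      τ * frobNorm (kroneckerSum A) := by
  refine (hW.abs_trace_mul_diagonal_le _).trans (mul_le_mul_of_nonneg_left ?_ hτ)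
  refine le_of_sq_le_sq ?_ (frobNorm_nonneg _)
  rw [frobNorm_kroneckerSum_sq A]
  exact le_add_of_nonneg_right (Finset.sum_nonneg fun k _ => by positivity)

lemma trace_mul_offPart_add_penalty_ge (hW : IsNoiseBound W δ τ) (k : Fin L) {ρ ρ' : ℝ}
    (hδρ : δ k ≤ ρ) (hρ : 0 ≤ ρ) (hρ' : ρ ≤ ρ') (Ψ B : Matrix (Fin (d k)) (Fin (d k)) ℝ) :
    -(2 * ρ' * (coDim d k * supportNorm Ψ B)) ≤
      (Wᵀ * modeEmbed d k (offPart B)).trace +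
        coDim d k * ρ * (offNorm (Ψ + B) - offNorm Ψ) := by
  have htrace := (abs_le.1 (hW.abs_trace_mul_offPart_le k B)).1
  have hpenalty := mul_le_mul_of_nonneg_left (penalty_increment_ge Ψ B hδρ hρ)
    (Nat.cast_nonneg (α := ℝ) (coDim d k))
  have hmono := mul_le_mul_of_nonneg_left hρ'
    (mul_nonneg (Nat.cast_nonneg (α := ℝ) (coDim d k)) (supportNorm_nonneg Ψ B))
  linarith

theorem trace_add_penalty_ge (hW : IsNoiseBound W δ τ) (hτ : 0 ≤ τ) {ρ : Fin L → ℝ} {ρ' : ℝ}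
    (hδρ : ∀ k, δ k ≤ ρ k) (hρ : ∀ k, 0 ≤ ρ k) (hρ' : ∀ k, ρ k ≤ ρ') (hρ'0 : 0 ≤ ρ')
    (Ψ A : ∀ k, Matrix (Fin (d k)) (Fin (d k)) ℝ) :
    -((2 * ρ' * √(sparsity Ψ) + τ) * frobNorm (kroneckerSum A)) ≤
      (Wᵀ * kroneckerSum A).trace +
        ∑ k, (coDim d k : ℝ) * ρ k * (offNorm (Ψ k + A k) - offNorm (Ψ k)) := by
  have hoff : -(2 * ρ' * ∑ k, coDim d k * supportNorm (Ψ k) (A k)) ≤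
      ∑ k, (Wᵀ * modeEmbed d k (offPart (A k))).trace +
        ∑ k, (coDim d k : ℝ) * ρ k * (offNorm (Ψ k + A k) - offNorm (Ψ k)) := by
    rw [← Finset.sum_add_distrib, Finset.mul_sum, ← Finset.sum_neg_distrib]
    exact Finset.sum_le_sum fun k _ =>
      hW.trace_mul_offPart_add_penalty_ge k (hδρ k) (hρ k) (hρ' k) _ _
  have hdiag := (abs_le.1 (hW.abs_trace_mul_diag_le hτ A)).1
  have hsupport := mul_le_mul_of_nonneg_left (sum_coDim_mul_supportNorm_le Ψ A)
    (mul_nonneg zero_le_two hρ'0)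
  have htrace := congrArg (fun M => (Wᵀ * M).trace) (kroneckerSum_eq_diagonal_add_sum_offPart A)
  simp only [Matrix.mul_add, Matrix.trace_add, Matrix.mul_sum, Matrix.trace_sum] at htrace
  rw [htrace]
  linarith

end IsNoiseBound

end Noise

section ConvexMinimization

lemma convexOn_finset_sum {E ι : Type*} [AddCommGroup E] [Module ℝ E] {s : Set E}
    (t : Finset ι) {g : ι → E → ℝ} (hs : Convex ℝ s) (hg : ∀ i ∈ t, ConvexOn ℝ s (g i)) :
    ConvexOn ℝ s fun x => ∑ i ∈ t, g i x := by
  induction t using Finset.cons_induction with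
  | empty => simpa using convexOn_const 0 hs
  | cons i t hi ih =>
    simp only [Finset.sum_cons]
    exact (hg i (Finset.mem_cons_self i t)).add
      (ih fun j hj => hg j (Finset.mem_cons_of_mem hj))

variable {E : Type*} [NormedAddCommGroup E] [NormedSpace ℝ E] {f : E → ℝ} {s : Set E} {x₀ : E}
  {R : ℝ}

lemma lt_of_convexOn_of_lt_on_sphere (hf : ConvexOn ℝ s f) (hx₀ : x₀ ∈ s) (hR : 0 < R)
    (hsphere : ∀ x ∈ s, dist x x₀ = R → f x₀ < f x) {x : E} (hx : x ∈ s) (hRx : R ≤ dist x x₀) :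
    f x₀ < f x := by
  have hdist : 0 < dist x x₀ := hR.trans_le hRx
  set t := R / dist x x₀
  have ht : 0 < t := div_pos hR hdist
  have ht' : 0 ≤ 1 - t := sub_nonneg.2 (div_le_one_of_le₀ hRx hdist.le)
  have hmem : (1 - t) • x₀ + t • x ∈ s := hf.1 hx₀ hx ht' ht.le (by ring)
  have hmem_sphere : dist ((1 - t) • x₀ + t • x) x₀ = R := by
    have hsub : (1 - t) • x₀ + t • x - x₀ = t • (x - x₀) := by module
    rw [dist_eq_norm, hsub, norm_smul, Real.norm_of_nonneg ht.le, ← dist_eq_norm,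
      div_mul_cancel₀ _ hdist.ne']
  have hconv := (hsphere _ hmem hmem_sphere).trans_le (hf.2 hx₀ hx ht' ht.le (by ring))
  simp only [smul_eq_mul] at hconv
  nlinarith

lemma existsUnique_isMinOn_of_lt_on_sphere (hf : StrictConvexOn ℝ s f) (hx₀ : x₀ ∈ s) (hR : 0 < R)
    (hsphere : ∀ x ∈ s, dist x x₀ = R → f x₀ < f x)
    (hcompact : IsCompact (s ∩ Metric.closedBall x₀ R))
    (hcont : ContinuousOn f (s ∩ Metric.closedBall x₀ R)) :
    (∃! x, x ∈ s ∧ IsMinOn f s x) ∧ ∀ x, x ∈ s ∧ IsMinOn f s x → dist x x₀ ≤ R := by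
  have hfar : ∀ x ∈ s, ¬dist x x₀ ≤ R → f x₀ < f x := fun x hx hRx =>
    lt_of_convexOn_of_lt_on_sphere hf.convexOn hx₀ hR hsphere hx (not_le.1 hRx).le
  have hx₀_ball : x₀ ∈ s ∩ Metric.closedBall x₀ R := ⟨hx₀, Metric.mem_closedBall_self hR.le⟩
  obtain ⟨y, hy, hy_min⟩ := hcompact.exists_isMinOn ⟨x₀, hx₀_ball⟩ hcont
  have hy_isMinOn : IsMinOn f s y := fun x hx => by
    by_cases hxR : dist x x₀ ≤ R
    · exact hy_min ⟨hx, hxR⟩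
    · exact (hy_min hx₀_ball).trans (hfar x hx hxR).le
  refine ⟨⟨y, ⟨hy.1, hy_isMinOn⟩, fun x hx => hf.eq_of_isMinOn hx.2 hy_isMinOn hx.1 hy.1⟩,
    fun x hx => ?_⟩
  by_contra hxR
  exact (hfar x hx.1 hxR).not_ge (hx.2 hx₀)

end ConvexMinimization

section Optimization

variable {L : ℕ} {d : Fin L → ℕ}

variable (d) in
/-- The feasible set of the estimator: the positive definite Kronecker sums. -/
def posDefKroneckerSums : Set (Matrix (Idx d) (Idx d) ℝ) :=
  {Ω | Ω.PosDef} ∩ Set.range kroneckerSum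

lemma kroneckerSum_mem_posDefKroneckerSums {Ψ : ∀ k, Matrix (Fin (d k)) (Fin (d k)) ℝ}
    (hΨ : (kroneckerSum Ψ).PosDef) : kroneckerSum Ψ ∈ posDefKroneckerSums d :=
  ⟨hΨ, Ψ, rfl⟩

lemma convex_posDefKroneckerSums : Convex ℝ (posDefKroneckerSums d) :=
  convex_posDef.inter (LinearMap.range (kroneckerSumLinear d)).convex

lemma isEstimator_iff_isMinOn {S : Matrix (Idx d) (Idx d) ℝ} {ρ : Fin L → ℝ}
    {Ω : Matrix (Idx d) (Idx d) ℝ} :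
    IsEstimator S ρ Ω ↔
      Ω ∈ posDefKroneckerSums d ∧ IsMinOn (matrixObjective S ρ) (posDefKroneckerSums d) Ω := by
  simp only [IsEstimator, objective_eq_matrixObjective]
  constructor
  · rintro ⟨hΩ, Ψ, rfl, hmin⟩
    refine ⟨⟨hΩ, Ψ, rfl⟩, ?_⟩
    rintro _ ⟨hΩ', Ψ', rfl⟩
    exact hmin Ψ' hΩ'
  · rintro ⟨⟨hΩ, Ψ, rfl⟩, hmin⟩
    exact ⟨hΩ, Ψ, rfl, fun Ψ' hΨ' => hmin (kroneckerSum_mem_posDefKroneckerSums hΨ')⟩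

lemma strictConvexOn_matrixObjective (S : Matrix (Idx d) (Idx d) ℝ) {ρ : Fin L → ℝ}
    (hρ : ∀ k, 0 ≤ ρ k) : StrictConvexOn ℝ {Ω | Ω.PosDef} (matrixObjective S ρ) := by
  have hentry (i j : Idx d) :
      ConvexOn ℝ Set.univ fun Ω : Matrix (Idx d) (Idx d) ℝ => |Ω i j| :=
    convexOn_univ_norm.comp_linearMap (Matrix.entryLinearMap ℝ ℝ i j)
  have hpenalty := convexOn_finset_sum (E := Matrix (Idx d) (Idx d) ℝ) Finset.univ convex_univ
    fun k _ => (convexOn_finset_sum Finset.univ convex_univ fun i _ =>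
      convexOn_finset_sum (Finset.univ.erase (i k)) convex_univ fun b _ =>
        hentry i (Function.update i k b)).smul (hρ k)
  have htrace := ((Matrix.traceLinearMap (Idx d) ℝ ℝ).comp
    (LinearMap.mulLeft ℝ Sᵀ)).convexOn (convex_posDef (ι := Idx d))
  exact (strictConcaveOn_log_det.neg.add_convexOn htrace).add_convexOn
    (hpenalty.subset (Set.subset_univ _) convex_posDef)

lemma continuousOn_matrixObjective (S : Matrix (Idx d) (Idx d) ℝ) (ρ : Fin L → ℝ) :
    ContinuousOn (matrixObjective S ρ) {Ω | Ω.PosDef} := by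
  refine .add (.add (.neg (.log continuous_id.matrix_det.continuousOn fun Ω hΩ => ?_)) ?_) ?_
  · exact hΩ.det_pos.ne'
  · exact (continuous_const.matrix_mul continuous_id).matrix_trace.continuousOn
  · have _ (i j : Idx d) : Continuous fun Ω : Matrix (Idx d) (Idx d) ℝ => Ω i j :=
      continuous_id.matrix_elem i j
    exact Continuous.continuousOn (by fun_prop)

open scoped Matrix.Norms.Frobenius in
lemma dist_eq_frobNorm {ι : Type*} [Fintype ι] (A B : Matrix ι ι ℝ) :
    dist A B = frobNorm (A - B) := by
  rw [frobNorm_eq_norm, dist_eq_norm]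

open scoped Matrix.Norms.Frobenius in
lemma isCompact_posDefKroneckerSums_inter_closedBall {Ω₀ : Matrix (Idx d) (Idx d) ℝ} {R : ℝ}
    (hball : ∀ Ω ∈ Set.range kroneckerSum, Ω.IsHermitian →
      frobNorm (Ω - Ω₀) ≤ R → Ω.PosDef) :
    IsCompact (posDefKroneckerSums d ∩ Metric.closedBall Ω₀ R) := by
  have hset : posDefKroneckerSums d ∩ Metric.closedBall Ω₀ R =
      Metric.closedBall Ω₀ R ∩ ({Ω | Ω.IsHermitian} ∩ Set.range kroneckerSum) := by
    ext Ω
    simp only [posDefKroneckerSums, Set.mem_inter_iff, Set.mem_ofPred_eq, Metric.mem_closedBall,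
      dist_eq_frobNorm]
    exact ⟨fun ⟨⟨hΩ, hmem⟩, hle⟩ => ⟨hle, hΩ.isHermitian, hmem⟩,
      fun ⟨hle, hherm, hmem⟩ => ⟨⟨hball Ω hmem hherm hle, hmem⟩, hle⟩⟩
  rw [hset]
  exact (isCompact_closedBall Ω₀ R).inter_right
    ((isClosed_eq continuous_id.matrix_conjTranspose continuous_id).inter
      (LinearMap.range (kroneckerSumLinear d)).closed_of_finiteDimensional)

open scoped Matrix.Norms.Frobenius in
lemma existsUnique_isEstimator_of_lt_on_sphere (S : Matrix (Idx d) (Idx d) ℝ) {ρ : Fin L → ℝ}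
    (hρ : ∀ k, 0 ≤ ρ k) {Ω₀ : Matrix (Idx d) (Idx d) ℝ} (hΩ₀ : Ω₀ ∈ posDefKroneckerSums d)
    {R : ℝ} (hR : 0 < R)
    (hball : ∀ Ω ∈ Set.range kroneckerSum, Ω.IsHermitian →
      frobNorm (Ω - Ω₀) ≤ R → Ω.PosDef)
    (hsphere : ∀ Ω ∈ posDefKroneckerSums d, frobNorm (Ω - Ω₀) = R →
      matrixObjective S ρ Ω₀ < matrixObjective S ρ Ω) :
    (∃! Ωhat, IsEstimator S ρ Ωhat) ∧
      ∀ Ωhat, IsEstimator S ρ Ωhat → frobNorm (Ωhat - Ω₀) ≤ R := by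
  simp only [isEstimator_iff_isMinOn]
  simp only [← dist_eq_frobNorm] at hsphere ⊢
  exact existsUnique_isMinOn_of_lt_on_sphere
    ((strictConvexOn_matrixObjective S hρ).subset Set.inter_subset_left convex_posDefKroneckerSums)
    hΩ₀ hR hsphere (isCompact_posDefKroneckerSums_inter_closedBall hball)
    ((continuousOn_matrixObjective S ρ).mono fun _ hΩ => hΩ.1.1)

end Optimization

section Rate

variable {L : ℕ} {d : Fin L → ℕ}

lemma posDef_of_spectrumWithin {ι : Type*} [Fintype ι] [DecidableEq ι] {A : Matrix ι ι ℝ}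
    {lo hi : ℝ} (hlo : 0 < lo) (h : SpectrumWithin A lo hi) : A.PosDef :=
  h.1.posDef_iff_eigenvalues_pos.2 fun i =>
    hlo.trans_le (h.2 _ (h.1.eigenvalues_mem_spectrum_real i)).1

lemma matrixObjective_kroneckerSum_add (S : Matrix (Idx d) (Idx d) ℝ) (ρ : Fin L → ℝ)
    (Ψ A : ∀ k, Matrix (Fin (d k)) (Fin (d k)) ℝ) :
    matrixObjective S ρ (kroneckerSum Ψ + kroneckerSum A) =
      matrixObjective S ρ (kroneckerSum Ψ) +
      (-Real.log (kroneckerSum Ψ + kroneckerSum A).det + Real.log (kroneckerSum Ψ).det +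
        (Sᵀ * kroneckerSum A).trace) +
      ∑ k, (coDim d k : ℝ) * ρ k * (offNorm (Ψ k + A k) - offNorm (Ψ k)) := by
  rw [← kroneckerSum_add, ← objective_eq_matrixObjective, ← objective_eq_matrixObjective]
  simp only [objective, kroneckerSum_add, Matrix.mul_add, Matrix.trace_add, Pi.add_apply,
    mul_sub, Finset.sum_sub_distrib]
  ring

lemma opNorm_inv_mul_kroneckerSum_le (hL : 1 ≤ L) (hd : ∀ k, 0 < d k)
    {Ω₀ : Matrix (Idx d) (Idx d) ℝ} {R : ℝ}
    (hsmall : opNorm Ω₀⁻¹ * (√((L + 1) / minCoDim d) * R) ≤ 1 / 5)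
    {A : ∀ k, Matrix (Fin (d k)) (Fin (d k)) ℝ} (hA : frobNorm (kroneckerSum A) ≤ R) :
    opNorm Ω₀⁻¹ * opNorm (kroneckerSum A) ≤ 1 / 5 := by
  refine le_trans (mul_le_mul_of_nonneg_left ?_ (opNorm_nonneg _)) hsmall
  exact (opNorm_kroneckerSum_le hL hd A).trans (by gcongr)

lemma matrixObjective_lt_of_isNoiseBound {Ψ A : ∀ k, Matrix (Fin (d k)) (Fin (d k)) ℝ}
    (hΨ : (kroneckerSum Ψ).PosDef) (hA : (kroneckerSum A).IsHermitian)
    (hsmall : opNorm (kroneckerSum Ψ)⁻¹ * opNorm (kroneckerSum A) ≤ 1 / 5)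
    {S : Matrix (Idx d) (Idx d) ℝ} {δ ρ : Fin L → ℝ} {ρ' τ : ℝ}
    (hW : IsNoiseBound (S - (kroneckerSum Ψ)⁻¹) δ τ) (hτ : 0 ≤ τ)
    (hδρ : ∀ k, δ k ≤ ρ k) (hρ : ∀ k, 0 ≤ ρ k) (hρ' : ∀ k, ρ k ≤ ρ') (hρ'0 : 0 ≤ ρ')
    (hgrow : 4 * opNorm (kroneckerSum Ψ) ^ 2 * (2 * ρ' * √(sparsity Ψ) + τ) <
      frobNorm (kroneckerSum A)) :
    matrixObjective S ρ (kroneckerSum Ψ) <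
      matrixObjective S ρ (kroneckerSum Ψ + kroneckerSum A) := by
  obtain ⟨-, hcurv⟩ := posDef_add_and_frobNorm_sq_le_neg_log_det hΨ hA hsmall
  have hnoise := hW.trace_add_penalty_ge hτ hδρ hρ hρ' hρ'0 Ψ A
  have hsymm : (kroneckerSum Ψ)⁻¹ᵀ = (kroneckerSum Ψ)⁻¹ := by
    simpa [Matrix.IsHermitian] using hΨ.inv.isHermitian
  rw [Matrix.transpose_sub, Matrix.sub_mul, Matrix.trace_sub, hsymm] at hnoise
  rw [matrixObjective_kroneckerSum_add]
  set r := frobNorm (kroneckerSum A)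
  set lam := 2 * ρ' * √(sparsity Ψ) + τ
  set bregman := -Real.log (kroneckerSum Ψ + kroneckerSum A).det +
    Real.log (kroneckerSum Ψ).det + ((kroneckerSum Ψ)⁻¹ * kroneckerSum A).trace
  have hr : 0 < r := lt_of_le_of_lt (by positivity) hgrow
  have hbregman : lam * r < bregman := by
    by_contra! hle
    have := mul_le_mul_of_nonneg_left hle (by positivity : 0 ≤ 4 * opNorm (kroneckerSum Ψ) ^ 2)
    nlinarith
  linarith

lemma existsUnique_isEstimator_of_isNoiseBound (hL : 1 ≤ L) (hd : ∀ k, 0 < d k)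
    {Ψ : ∀ k, Matrix (Fin (d k)) (Fin (d k)) ℝ} (hΨ : (kroneckerSum Ψ).PosDef)
    {S : Matrix (Idx d) (Idx d) ℝ} {δ ρ : Fin L → ℝ} {ρ' τ R : ℝ}
    (hW : IsNoiseBound (S - (kroneckerSum Ψ)⁻¹) δ τ) (hτ : 0 ≤ τ)
    (hδρ : ∀ k, δ k ≤ ρ k) (hρ : ∀ k, 0 ≤ ρ k) (hρ' : ∀ k, ρ k ≤ ρ') (hρ'0 : 0 ≤ ρ')
    (hsmall : opNorm (kroneckerSum Ψ)⁻¹ * (√((L + 1) / minCoDim d) * R) ≤ 1 / 5)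
    (hgrow : 4 * opNorm (kroneckerSum Ψ) ^ 2 * (2 * ρ' * √(sparsity Ψ) + τ) < R) :
    (∃! Ωhat, IsEstimator S ρ Ωhat) ∧
      ∀ Ωhat, IsEstimator S ρ Ωhat → frobNorm (Ωhat - kroneckerSum Ψ) ≤ R := by
  have hR : 0 < R := lt_of_le_of_lt (by positivity) hgrow
  refine existsUnique_isEstimator_of_lt_on_sphere S hρ (kroneckerSum_mem_posDefKroneckerSums hΨ)
    hR ?_ ?_
  · rintro _ ⟨Φ, rfl⟩ hherm hle
    have hsub : kroneckerSum (Φ - Ψ) = kroneckerSum Φ - kroneckerSum Ψ := kroneckerSum_sub Φ Ψ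
    have hpd := (posDef_add_and_frobNorm_sq_le_neg_log_det hΨ (hherm.sub hΨ.isHermitian)
      (hsub ▸ opNorm_inv_mul_kroneckerSum_le hL hd hsmall (hsub ▸ hle))).1
    rwa [add_sub_cancel] at hpd
  · rintro _ ⟨hpd, Φ, rfl⟩ heq
    rw [← kroneckerSum_sub] at heq
    have hlt := matrixObjective_lt_of_isNoiseBound (A := Φ - Ψ) hΨ
      (kroneckerSum_sub Φ Ψ ▸ hpd.isHermitian.sub hΨ.isHermitian)
      (opNorm_inv_mul_kroneckerSum_le hL hd hsmall heq.le) hW hτ hδρ hρ hρ' hρ'0 (heq ▸ hgrow)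
    rwa [kroneckerSum_sub, add_sub_cancel] at hlt

end Rate

section ScalarMgf

/-- The exponential function with values in `[0, ∞]`. Exponential moments are Lebesgue integrals of
`lexp`, so that Tonelli and independence apply without integrability side conditions. -/
noncomputable def lexp (x : ℝ) : ENNReal := ENNReal.ofReal (Real.exp x)

lemma lexp_add (x y : ℝ) : lexp (x + y) = lexp x * lexp y := by
  rw [lexp, Real.exp_add, ENNReal.ofReal_mul (Real.exp_pos _).le]; rfl

lemma lexp_zero : lexp 0 = 1 := by simp [lexp]

lemma lexp_sum {ι : Type*} (s : Finset ι) (f : ι → ℝ) :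
    lexp (∑ i ∈ s, f i) = ∏ i ∈ s, lexp (f i) := by
  rw [lexp, Real.exp_sum, ENNReal.ofReal_prod_of_nonneg fun _ _ => (Real.exp_pos _).le]; rfl

lemma lexp_mono : Monotone lexp := fun _ _ h => ENNReal.ofReal_le_ofReal (Real.exp_le_exp.2 h)

lemma measurable_lexp : Measurable lexp := ENNReal.measurable_ofReal.comp Real.measurable_exp

@[fun_prop]
lemma measurable_lexp_comp {α : Type*} [MeasurableSpace α] {f : α → ℝ} (hf : Measurable f) :
    Measurable fun x => lexp (f x) := measurable_lexp.comp hf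

lemma exp_le_self_add_exp_sq (x : ℝ) : Real.exp x ≤ x + Real.exp (x ^ 2) := by
  have h0 := Real.add_one_le_exp (x ^ 2)
  rcases le_or_gt |x| 1 with h | h
  · linarith [(abs_le.1 (Real.abs_exp_sub_one_sub_id_le h)).2]
  · rcases lt_abs.1 h with h | h
    · linarith [Real.exp_le_exp.2 (show x ≤ x ^ 2 by nlinarith)]
    · nlinarith [Real.exp_le_one_iff.2 (show x ≤ 0 by linarith)]

lemma exp_le_one_add_add_sq_mul_exp_abs (x : ℝ) :
    Real.exp x ≤ 1 + x + x ^ 2 * Real.exp |x| := by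
  have h1 : 1 ≤ Real.exp |x| := Real.one_le_exp (abs_nonneg _)
  rcases le_or_gt |x| 1 with h | h
  · nlinarith [sq_nonneg x, (abs_le.1 (Real.abs_exp_sub_one_sub_id_le h)).2]
  · rcases lt_abs.1 h with h | h
    · rw [abs_of_pos (by linarith)] at h1 ⊢
      nlinarith [show 1 ≤ x ^ 2 by nlinarith]
    · nlinarith [sq_nonneg x, Real.exp_le_one_iff.2 (show x ≤ 0 by linarith)]

lemma exp_mul_le_of_mem_unitInterval {α : ℝ} (h0 : 0 ≤ α) (h1 : α ≤ 1) (y : ℝ) :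
    Real.exp (α * y) ≤ 1 - α + α * Real.exp y := by
  simpa using convexOn_exp.2 (Set.mem_univ 0) (Set.mem_univ y) (sub_nonneg.2 h1) h0
    (sub_add_cancel 1 α)

lemma sq_le_mul_exp {c : ℝ} (hc : 0 < c) {y : ℝ} (hy : 0 ≤ y) :
    y ^ 2 ≤ 2 * c ^ 2 * Real.exp (y / c) := by
  have hquad := Real.quadratic_le_exp_of_nonneg (div_nonneg hy hc.le)
  have hscale : y ^ 2 = 2 * c ^ 2 * ((y / c) ^ 2 / 2) := by field_simp
  rw [hscale]
  gcongr
  linarith [div_nonneg hy hc.le]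

lemma exists_exp_mul_le_add_mul_exp_sq {k : ℝ} (hk : 0 < k) (t : ℝ) :
    ∃ u p q : ℝ, 0 ≤ q ∧ p + 2 * q ≤ Real.exp (k ^ 2 * t ^ 2) ∧
      ∀ z, Real.exp (t * z) ≤ u * z + (p + q * Real.exp (z ^ 2 / k ^ 2)) := by
  set α := k ^ 2 * t ^ 2 with hα
  have hα0 : 0 ≤ α := by positivity
  rcases le_or_gt α 1 with hα1 | hα1
  · refine ⟨t, 1 - α, α, hα0, by linarith [Real.add_one_le_exp α], fun z => ?_⟩
    have hsq : (t * z) ^ 2 = α * (z ^ 2 / k ^ 2) := by rw [hα]; field_simp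
    have hconv := exp_mul_le_of_mem_unitInterval hα0 hα1 (z ^ 2 / k ^ 2)
    rw [← hsq] at hconv
    linarith [exp_le_self_add_exp_sq (t * z)]
  · refine ⟨0, Real.exp (α / 2) / 2, Real.exp (α / 2) / 2, by positivity, ?_, fun z => ?_⟩
    · have hhalf : Real.exp α = Real.exp (α / 2) * Real.exp (α / 2) := by
        rw [← Real.exp_add, add_halves]
      nlinarith [Real.add_one_le_exp (α / 2)]
    · have hyoung : t * z ≤ α / 2 + 1 / 2 * (z ^ 2 / k ^ 2) := by
        have : (k * t - z / k) ^ 2 = α - 2 * (t * z) + z ^ 2 / k ^ 2 := by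
          rw [hα]; field_simp; ring
        linarith [sq_nonneg (k * t - z / k)]
      calc Real.exp (t * z) ≤ Real.exp (α / 2) * Real.exp (1 / 2 * (z ^ 2 / k ^ 2)) := by
            rw [← Real.exp_add]; exact Real.exp_le_exp.2 hyoung
        _ ≤ Real.exp (α / 2) * (1 - 1 / 2 + 1 / 2 * Real.exp (z ^ 2 / k ^ 2)) := by
            gcongr
            exact exp_mul_le_of_mem_unitInterval (by norm_num) (by norm_num) _
        _ = _ := by ring

lemma exp_mul_sq_sub_one_le {k : ℝ} (hk : 0 < k) {θ : ℝ} (hθ : 2 * k ^ 2 * |θ| ≤ 1) (z : ℝ) :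
    Real.exp (θ * (z ^ 2 - 1)) ≤ 1 + θ * (z ^ 2 - 1) +
      8 * k ^ 4 * Real.exp (1 / k ^ 2) * θ ^ 2 * Real.exp (z ^ 2 / k ^ 2) := by
  set y := z ^ 2 - 1
  have hy_le : |y| ≤ z ^ 2 + 1 := by
    rw [abs_le]; constructor <;> nlinarith [sq_nonneg z]
  have hθy : |θ * y| ≤ |y| / (2 * k ^ 2) := by
    rw [abs_mul, le_div_iff₀ (by positivity)]
    nlinarith [abs_nonneg y]
  have hy_sq : y ^ 2 ≤ 8 * k ^ 4 * Real.exp (|y| / (2 * k ^ 2)) := by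
    have := sq_le_mul_exp (show 0 < 2 * k ^ 2 by positivity) (abs_nonneg y)
    rw [sq_abs] at this
    linarith
  refine (exp_le_one_add_add_sq_mul_exp_abs _).trans ?_
  gcongr 1 + θ * y + ?_
  calc (θ * y) ^ 2 * Real.exp |θ * y|
      ≤ θ ^ 2 * (8 * k ^ 4 * Real.exp (|y| / (2 * k ^ 2))) * Real.exp (|y| / (2 * k ^ 2)) := by
        rw [mul_pow]; gcongr
    _ = 8 * k ^ 4 * θ ^ 2 * Real.exp (|y| / k ^ 2) := by
        rw [show |y| / k ^ 2 = |y| / (2 * k ^ 2) + |y| / (2 * k ^ 2) by field_simp; norm_num,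
          Real.exp_add]
        ring
    _ ≤ 8 * k ^ 4 * θ ^ 2 * Real.exp (z ^ 2 / k ^ 2 + 1 / k ^ 2) := by
        rw [← add_div]
        gcongr
    _ = _ := by rw [Real.exp_add]; ring

variable {S : Type*} [MeasurableSpace S] {μ : Measure S}

lemma lintegral_lexp_le_of_psiTwoNorm_le {Z : S → ℝ} {K : ℝ} (hK : 0 < K)
    (h : psiTwoNorm μ Z ≤ ENNReal.ofReal K) :
    ∫⁻ ω, lexp (Z ω ^ 2 / (2 * K) ^ 2) ∂μ ≤ 2 := by
  have h2 : psiTwoNorm μ Z < ENNReal.ofReal (2 * K) :=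
    h.trans_lt ((ENNReal.ofReal_lt_ofReal_iff (by linarith)).2 (by linarith))
  simp only [psiTwoNorm, iInf_lt_iff] at h2
  obtain ⟨t, ht, hle, htK⟩ := h2
  have htK' : t < 2 * K := (ENNReal.ofReal_lt_ofReal_iff (by linarith)).1 htK
  refine le_trans (lintegral_mono fun ω => lexp_mono ?_) hle
  gcongr

lemma lintegral_lexp_le_of_exp_le {f g : S → ℝ} (hg : Integrable g μ)
    (hfg : ∀ ω, Real.exp (f ω) ≤ g ω) {c : ℝ} (hc : ∫ ω, g ω ∂μ ≤ Real.exp c) :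
    ∫⁻ ω, lexp (f ω) ∂μ ≤ lexp c := by
  have hg0 (ω : S) : 0 ≤ g ω := (Real.exp_pos _).le.trans (hfg ω)
  calc ∫⁻ ω, lexp (f ω) ∂μ ≤ ∫⁻ ω, ENNReal.ofReal (g ω) ∂μ :=
        lintegral_mono fun ω => ENNReal.ofReal_le_ofReal (hfg ω)
    _ = ENNReal.ofReal (∫ ω, g ω ∂μ) :=
        (ofReal_integral_eq_lintegral_ofReal hg (Filter.Eventually.of_forall hg0)).symm
    _ ≤ lexp c := ENNReal.ofReal_le_ofReal hc

variable {Z : S → ℝ} {k : ℝ}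

lemma integrable_exp_sq_div (hZ : Measurable Z)
    (h : ∫⁻ ω, lexp (Z ω ^ 2 / k ^ 2) ∂μ ≤ 2) :
    Integrable (fun ω => Real.exp (Z ω ^ 2 / k ^ 2)) μ := by
  refine ⟨by fun_prop, ?_⟩
  rw [hasFiniteIntegral_iff_ofReal (Filter.Eventually.of_forall fun _ => (Real.exp_pos _).le)]
  exact h.trans_lt (by simp)

lemma integral_exp_sq_div_le (hZ : Measurable Z) (h : ∫⁻ ω, lexp (Z ω ^ 2 / k ^ 2) ∂μ ≤ 2) :
    ∫ ω, Real.exp (Z ω ^ 2 / k ^ 2) ∂μ ≤ 2 := by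
  rw [integral_eq_lintegral_of_nonneg_ae
    (Filter.Eventually.of_forall fun _ => (Real.exp_pos _).le) (by fun_prop)]
  exact ENNReal.toReal_le_of_le_ofReal (by norm_num) (by rw [ENNReal.ofReal_ofNat]; exact h)

lemma integrable_sq_of_lintegral_lexp_le (hZ : Measurable Z) (hk : 0 < k)
    (h : ∫⁻ ω, lexp (Z ω ^ 2 / k ^ 2) ∂μ ≤ 2) : Integrable (fun ω => Z ω ^ 2) μ := by
  refine ((integrable_exp_sq_div hZ h).const_mul (k ^ 2)).mono' (by fun_prop)
    (Filter.Eventually.of_forall fun ω => ?_)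
  rw [Real.norm_of_nonneg (sq_nonneg _), ← div_le_iff₀' (by positivity)]
  linarith [Real.add_one_le_exp (Z ω ^ 2 / k ^ 2)]

variable [IsProbabilityMeasure μ]

lemma lintegral_lexp_mul_le (hZ : Measurable Z) (hk : 0 < k)
    (h : ∫⁻ ω, lexp (Z ω ^ 2 / k ^ 2) ∂μ ≤ 2) (h0 : ∫ ω, Z ω ∂μ = 0) (t : ℝ) :
    ∫⁻ ω, lexp (t * Z ω) ∂μ ≤ lexp (k ^ 2 * t ^ 2) := by
  obtain ⟨u, p, q, hq, hpq, hle⟩ := exists_exp_mul_le_add_mul_exp_sq hk t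
  have hint_exp := integrable_exp_sq_div hZ h
  have hint_Z : Integrable Z μ := ((memLp_two_iff_integrable_sq hZ.aestronglyMeasurable).2
    (integrable_sq_of_lintegral_lexp_le hZ hk h)).integrable one_le_two
  have hint_rest : Integrable (fun ω => p + q * Real.exp (Z ω ^ 2 / k ^ 2)) μ :=
    (integrable_const p).add (hint_exp.const_mul q)
  refine lintegral_lexp_le_of_exp_le ((hint_Z.const_mul u).add hint_rest) (fun ω => hle (Z ω)) ?_
  calc ∫ ω, (u * Z ω + (p + q * Real.exp (Z ω ^ 2 / k ^ 2))) ∂μ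
      = p + q * ∫ ω, Real.exp (Z ω ^ 2 / k ^ 2) ∂μ := by
        rw [integral_add (hint_Z.const_mul u) hint_rest,
          integral_add (integrable_const p) (hint_exp.const_mul q), integral_const_mul,
          integral_const_mul, h0, integral_const, probReal_univ, one_smul, mul_zero, zero_add]
    _ ≤ p + q * 2 := by gcongr; exact integral_exp_sq_div_le hZ h
    _ ≤ Real.exp (k ^ 2 * t ^ 2) := by linarith

lemma lintegral_lexp_mul_sq_sub_one_le (hZ : Measurable Z) (hk : 0 < k)
    (h : ∫⁻ ω, lexp (Z ω ^ 2 / k ^ 2) ∂μ ≤ 2) (h1 : ∫ ω, Z ω ^ 2 ∂μ = 1) {θ : ℝ}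
    (hθ : 2 * k ^ 2 * |θ| ≤ 1) :
    ∫⁻ ω, lexp (θ * (Z ω ^ 2 - 1)) ∂μ ≤ lexp (16 * k ^ 4 * Real.exp (1 / k ^ 2) * θ ^ 2) := by
  set c := 8 * k ^ 4 * Real.exp (1 / k ^ 2) * θ ^ 2 with hc
  have hint_exp := integrable_exp_sq_div hZ h
  have hint_sq := integrable_sq_of_lintegral_lexp_le hZ hk h
  have hint_sub : Integrable (fun ω => Z ω ^ 2 - 1) μ := hint_sq.sub (integrable_const 1)
  have hint_lin : Integrable (fun ω => 1 + θ * (Z ω ^ 2 - 1)) μ :=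
    (integrable_const 1).add (hint_sub.const_mul θ)
  refine lintegral_lexp_le_of_exp_le (hint_lin.add (hint_exp.const_mul c))
    (fun ω => exp_mul_sq_sub_one_le hk hθ (Z ω)) ?_
  calc ∫ ω, (1 + θ * (Z ω ^ 2 - 1) + c * Real.exp (Z ω ^ 2 / k ^ 2)) ∂μ
      = 1 + c * ∫ ω, Real.exp (Z ω ^ 2 / k ^ 2) ∂μ := by
        rw [integral_add hint_lin (hint_exp.const_mul c), integral_add (integrable_const 1)
          (hint_sub.const_mul θ), integral_const_mul, integral_const_mul,
          integral_sub hint_sq (integrable_const 1), h1, integral_const, probReal_univ, one_smul,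
          sub_self, mul_zero, add_zero]
    _ ≤ 1 + c * 2 := by gcongr; exact integral_exp_sq_div_le hZ h
    _ = 16 * k ^ 4 * Real.exp (1 / k ^ 2) * θ ^ 2 + 1 := by rw [hc]; ring
    _ ≤ _ := Real.add_one_le_exp _

lemma lintegral_lexp_mul_gaussianReal (t : ℝ) :
    ∫⁻ x, lexp (t * x) ∂(gaussianReal 0 1) = lexp (t ^ 2 / 2) := by
  have hmgf := congrFun (mgf_fun_id_gaussianReal (μ := 0) (v := 1)) t
  simp only [mgf, NNReal.coe_one] at hmgf
  unfold lexp
  rw [← ofReal_integral_eq_lintegral_ofReal (integrable_exp_mul_gaussianReal t)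
    (Filter.Eventually.of_forall fun _ => (Real.exp_pos _).le), hmgf]
  simp

lemma gaussianPDF_mul_lexp_mul_sq (θ x : ℝ) :
    gaussianPDF 0 1 x * lexp (θ * x ^ 2) =
      ENNReal.ofReal ((√(2 * Real.pi))⁻¹ * Real.exp (-(1 / 2 - θ) * x ^ 2)) := by
  simp only [gaussianPDF, gaussianPDFReal, lexp, NNReal.coe_one, mul_one, sub_zero]
  rw [← ENNReal.ofReal_mul (by positivity), mul_assoc, ← Real.exp_add]
  congr 3
  ring

lemma lintegral_lexp_mul_sq_gaussianReal {θ : ℝ} (hθ : θ < 1 / 2) :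
    ∫⁻ x, lexp (θ * x ^ 2) ∂(gaussianReal 0 1) = ENNReal.ofReal (√(1 - 2 * θ))⁻¹ := by
  have hint : Integrable fun x : ℝ => Real.exp (-(1 / 2 - θ) * x ^ 2) :=
    integrable_exp_neg_mul_sq (by linarith)
  rw [gaussianReal_of_var_ne_zero _ one_ne_zero,
    lintegral_withDensity_eq_lintegral_mul _ (measurable_gaussianPDF _ _) (by fun_prop)]
  simp only [Pi.mul_apply, gaussianPDF_mul_lexp_mul_sq]
  rw [← ofReal_integral_eq_lintegral_ofReal (hint.const_mul _)
    (Filter.Eventually.of_forall fun _ => by positivity), integral_const_mul, integral_gaussian,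
    show 2 * Real.pi = Real.pi / (1 / 2 - θ) * (1 - 2 * θ) by
      field_simp [show 1 - 2 * θ ≠ 0 by linarith, show 1 / 2 - θ ≠ 0 by linarith],
    Real.sqrt_mul (div_nonneg Real.pi_pos.le (by linarith)), mul_inv_rev, mul_assoc,
    inv_mul_cancel₀ (Real.sqrt_pos.2 (div_pos Real.pi_pos (by linarith))).ne', mul_one]

lemma lintegral_lexp_mul_sq_gaussianReal_le {θ : ℝ} (h0 : 0 ≤ θ) (h1 : θ ≤ 1 / 4) :
    ∫⁻ x, lexp (θ * x ^ 2) ∂(gaussianReal 0 1) ≤ lexp (2 * θ) := by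
  rw [lintegral_lexp_mul_sq_gaussianReal (by linarith)]
  refine ENNReal.ofReal_le_ofReal ?_
  have hpos : 0 < 1 - 2 * θ := by linarith
  have hexp_sq : Real.exp (2 * θ) ^ 2 = Real.exp (4 * θ) := by
    rw [← Real.exp_nat_mul]; congr 1; push_cast; ring
  have hone : 1 ≤ Real.exp (2 * θ) ^ 2 * (1 - 2 * θ) := by
    rw [hexp_sq]
    nlinarith [Real.add_one_le_exp (4 * θ)]
  rw [inv_le_iff_one_le_mul₀ (Real.sqrt_pos.2 hpos), ← Real.sqrt_sq (Real.exp_pos (2 * θ)).le,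
    ← Real.sqrt_mul (by positivity)]
  exact Real.one_le_sqrt.2 hone

end ScalarMgf

section ExponentialMoments

variable {S : Type*} [MeasurableSpace S] {μ : Measure S}

lemma lexp_mul (w x : ℝ) : lexp (w * x) = lexp x ^ w := by
  rw [lexp, lexp, ENNReal.ofReal_rpow_of_pos (Real.exp_pos x), ← Real.exp_mul, mul_comm]

lemma lintegral_lexp_sum_mul_le {κ : Type*} {s : Finset κ} {f : κ → S → ℝ}
    (hf : ∀ i ∈ s, Measurable (f i)) {w c : κ → ℝ} (hw0 : ∀ i ∈ s, 0 ≤ w i)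
    (hw1 : ∑ i ∈ s, w i = 1) (h : ∀ i ∈ s, ∫⁻ ω, lexp (f i ω) ∂μ ≤ lexp (c i)) :
    ∫⁻ ω, lexp (∑ i ∈ s, w i * f i ω) ∂μ ≤ lexp (∑ i ∈ s, w i * c i) := by
  simp only [lexp_sum, lexp_mul]
  calc ∫⁻ ω, ∏ i ∈ s, lexp (f i ω) ^ w i ∂μ ≤ ∏ i ∈ s, (∫⁻ ω, lexp (f i ω) ∂μ) ^ w i :=
        ENNReal.lintegral_prod_norm_pow_le s
          (fun i hi => (measurable_lexp_comp (hf i hi)).aemeasurable) hw1 hw0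
    _ ≤ ∏ i ∈ s, lexp (c i) ^ w i :=
        Finset.prod_le_prod' fun i hi => ENNReal.rpow_le_rpow (h i hi) (hw0 i hi)

lemma lintegral_lexp_add_div_two_le {f g : S → ℝ} (hf : Measurable f)
    (hg : Measurable g) {a b : ℝ} (hfa : ∫⁻ ω, lexp (f ω) ∂μ ≤ lexp a)
    (hgb : ∫⁻ ω, lexp (g ω) ∂μ ≤ lexp b) :
    ∫⁻ ω, lexp ((f ω + g ω) / 2) ∂μ ≤ lexp ((a + b) / 2) := by
  have h := lintegral_lexp_sum_mul_le (μ := μ) (s := Finset.univ) (f := ![f, g]) (c := ![a, b])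
    (w := fun _ => 1 / 2) (by simp [hf, hg]) (by simp) (by simp) (by simp [hfa, hgb])
  simpa [← mul_add, div_eq_inv_mul] using h

lemma lintegral_lexp_sum_eq_prod {κ : Type*} {β : κ → Type*} [∀ i, MeasurableSpace (β i)]
    (s : Finset κ) {Z : ∀ i, S → β i} (hind : iIndepFun Z μ) (hZ : ∀ i, Measurable (Z i))
    {f : ∀ i, β i → ℝ} (hf : ∀ i, Measurable (f i)) :
    ∫⁻ ω, lexp (∑ i ∈ s, f i (Z i ω)) ∂μ = ∏ i ∈ s, ∫⁻ ω, lexp (f i (Z i ω)) ∂μ := by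
  simp only [lexp_sum]
  exact lintegral_prod_eq_prod_lintegral_of_indepFun s (fun i ω => lexp (f i (Z i ω)))
    (hind.comp (fun i x => lexp (f i x)) fun i => measurable_lexp_comp (hf i))
    fun i => measurable_lexp_comp ((hf i).comp (hZ i))

lemma lintegral_lexp_sum_le {κ : Type*} {β : κ → Type*} [∀ i, MeasurableSpace (β i)]
    (s : Finset κ) {Z : ∀ i, S → β i} (hind : iIndepFun Z μ) (hZ : ∀ i, Measurable (Z i))
    {f : ∀ i, β i → ℝ} (hf : ∀ i, Measurable (f i)) {c : κ → ℝ}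
    (h : ∀ i, ∫⁻ ω, lexp (f i (Z i ω)) ∂μ ≤ lexp (c i)) :
    ∫⁻ ω, lexp (∑ i ∈ s, f i (Z i ω)) ∂μ ≤ lexp (∑ i ∈ s, c i) := by
  rw [lintegral_lexp_sum_eq_prod s hind hZ hf, lexp_sum]
  exact Finset.prod_le_prod' fun i _ => h i

lemma lintegral_lexp_sum_pi_gaussianReal {ι : Type*} [Fintype ι] {f : ι → ℝ → ℝ}
    (hf : ∀ i, Measurable (f i)) :
    ∫⁻ g, lexp (∑ i, f i (g i)) ∂(Measure.pi fun _ : ι => gaussianReal 0 1) =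
      ∏ i, ∫⁻ x, lexp (f i x) ∂(gaussianReal 0 1) := by
  rw [lintegral_lexp_sum_eq_prod Finset.univ (iIndepFun_pi (X := fun _ x => x) fun _ => by fun_prop)
    measurable_pi_apply hf]
  exact Finset.prod_congr rfl fun i _ =>
    (measurePreserving_eval (fun _ : ι => gaussianReal 0 1) i).lintegral_comp
      (measurable_lexp_comp (hf i))

lemma lintegral_comp_of_indepFun [IsFiniteMeasure μ] {α β : Type*} [MeasurableSpace α]
    [MeasurableSpace β] {f : S → α} {g : S → β} (hf : Measurable f) (hg : Measurable g)
    (hfg : IndepFun f g μ) {F : α → β → ENNReal} (hF : Measurable (Function.uncurry F)) :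
    ∫⁻ ω, F (f ω) (g ω) ∂μ = ∫⁻ ω', ∫⁻ ω, F (f ω) (g ω') ∂μ ∂μ :=
  calc ∫⁻ ω, F (f ω) (g ω) ∂μ
      = ∫⁻ z, Function.uncurry F z ∂(μ.map fun ω => (f ω, g ω)) :=
        (lintegral_map hF (hf.prodMk hg)).symm
    _ = ∫⁻ y, ∫⁻ x, F x y ∂(μ.map f) ∂(μ.map g) := by
        rw [hfg.map_prod_eq_prod_map_map hf.aemeasurable hg.aemeasurable,
          lintegral_prod_symm _ hF.aemeasurable]
        rfl
    _ = ∫⁻ ω', ∫⁻ x, F x (g ω') ∂(μ.map f) ∂μ :=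
        lintegral_map (Measurable.lintegral_prod_left' hF) hg
    _ = ∫⁻ ω', ∫⁻ ω, F (f ω) (g ω') ∂μ ∂μ :=
        lintegral_congr fun ω' => lintegral_map (hF.comp measurable_prodMk_right) hf

end ExponentialMoments

section QuadraticForms

variable {S : Type*} [MeasurableSpace S] {ι : Type*} [Fintype ι]

/-- An independent family of sub-gaussian variables with moment generating functions at most
`exp (v t²)`; for gaussian variables `v` is half the variance. -/
structure IsSubGaussianFamily (μ : Measure S) (v : ℝ) (Z : ι → S → ℝ) : Prop where
  nonneg : 0 ≤ v
  measurable : ∀ j, Measurable (Z j)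
  iIndepFun : iIndepFun Z μ
  lintegral_lexp_mul_le : ∀ j t, ∫⁻ ω, lexp (t * Z j ω) ∂μ ≤ lexp (v * t ^ 2)

namespace IsSubGaussianFamily

variable {μ : Measure S} {v : ℝ} {Z : ι → S → ℝ}

lemma lintegral_lexp_sum_mul_le (hZ : IsSubGaussianFamily μ v Z) (w : ι → ℝ) :
    ∫⁻ ω, lexp (∑ j, w j * Z j ω) ∂μ ≤ lexp (v * ∑ j, w j ^ 2) := by
  rw [Finset.mul_sum]
  exact lintegral_lexp_sum_le Finset.univ hZ.iIndepFun hZ.measurable (f := fun j x => w j * x)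
    (fun j => by fun_prop) fun j => hZ.lintegral_lexp_mul_le j (w j)

end IsSubGaussianFamily

lemma lexp_half_sum_sq_eq_lintegral_gaussianReal (x : ι → ℝ) :
    lexp (1 / 2 * ∑ i, x i ^ 2) =
      ∫⁻ g, lexp (∑ i, x i * g i) ∂(Measure.pi fun _ : ι => gaussianReal 0 1) := by
  rw [lintegral_lexp_sum_pi_gaussianReal (f := fun i y => x i * y) fun i => by fun_prop]
  simp only [lintegral_lexp_mul_gaussianReal]
  rw [← lexp_sum, Finset.mul_sum]
  simp only [one_div, inv_mul_eq_div]

lemma lexp_sum_mul_mulVec_sq_eq_lintegral_gaussianReal (U : Matrix ι ι ℝ) {σ : ι → ℝ}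
    (hσ : ∀ i, 0 ≤ σ i) (z : ι → ℝ) :
    lexp (∑ i, σ i * (U *ᵥ z) i ^ 2) =
      ∫⁻ g, lexp (∑ j, (Uᵀ *ᵥ fun i => √(2 * σ i) * g i) j * z j)
        ∂Measure.pi fun _ => gaussianReal 0 1 := by
  have hsq : ∑ i, σ i * (U *ᵥ z) i ^ 2 = 1 / 2 * ∑ i, (√(2 * σ i) * (U *ᵥ z) i) ^ 2 := by
    rw [Finset.mul_sum]
    refine Finset.sum_congr rfl fun i _ => ?_
    rw [mul_pow, Real.sq_sqrt (mul_nonneg zero_le_two (hσ i))]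
    ring
  have hadjoint (g : ι → ℝ) : ∑ i, √(2 * σ i) * (U *ᵥ z) i * g i =
      ∑ j, (Uᵀ *ᵥ fun i => √(2 * σ i) * g i) j * z j := by
    have := Matrix.dotProduct_mulVec (fun i => √(2 * σ i) * g i) U z
    rw [← Matrix.mulVec_transpose] at this
    simpa only [dotProduct, mul_right_comm] using this
  simp only [hsq, lexp_half_sum_sq_eq_lintegral_gaussianReal, hadjoint]

lemma measurable_quadForm (M : Matrix ι ι ℝ) : Measurable fun x : ι → ℝ => x ⬝ᵥ M *ᵥ x := by
  simp only [Matrix.mulVec, dotProduct]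
  fun_prop

lemma dotProduct_transpose_mul_mulVec (B : Matrix ι ι ℝ) (z : ι → ℝ) :
    z ⬝ᵥ (Bᵀ * B) *ᵥ z = ∑ i, (B *ᵥ z) i ^ 2 := by
  rw [← Matrix.mulVec_mulVec, Matrix.dotProduct_mulVec, Matrix.vecMul_transpose]
  simp only [dotProduct, sq]

variable [DecidableEq ι]

lemma sum_mulVec_sq_of_transpose_mul_self {U : Matrix ι ι ℝ} (hU : Uᵀ * U = 1) (x : ι → ℝ) :
    ∑ i, (U *ᵥ x) i ^ 2 = ∑ i, x i ^ 2 := by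
  rw [← dotProduct_transpose_mul_mulVec, hU, Matrix.one_mulVec]
  simp only [dotProduct, sq]

lemma opNorm_le_one_of_transpose_mul_self {U : Matrix ι ι ℝ} (hU : Uᵀ * U = 1) : opNorm U ≤ 1 :=
  opNorm_le_of_sum_mulVec_sq_le zero_le_one fun x => by
    rw [sum_mulVec_sq_of_transpose_mul_self hU, one_pow, one_mul]

/-- The entries of `A` with row in `I` and column outside `I`. -/
def decouple (I : Finset ι) (A : Matrix ι ι ℝ) : Matrix ι ι ℝ :=
  Matrix.diagonal (fun i => if i ∈ I then 1 else 0) * A *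
    Matrix.diagonal fun j => if j ∈ I then 0 else 1

lemma decouple_apply (I : Finset ι) (A : Matrix ι ι ℝ) (i j : ι) :
    decouple I A i j = if i ∈ I ∧ j ∉ I then A i j else 0 := by
  simp only [decouple, Matrix.mul_diagonal, Matrix.diagonal_mul]
  split_ifs <;> simp_all

lemma opNorm_diagonal_le_one {e : ι → ℝ} (he : ∀ i, ‖e i‖ ≤ 1) :
    opNorm (Matrix.diagonal e) ≤ 1 := by
  rw [opNorm_diagonal]
  exact (pi_norm_le_iff_of_nonneg zero_le_one).2 he

lemma opNorm_decouple_le (I : Finset ι) (A : Matrix ι ι ℝ) :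
    opNorm (decouple I A) ≤ opNorm A := by
  refine (opNorm_mul_le _ _).trans <| (mul_le_of_le_one_right (opNorm_nonneg _)
    (opNorm_diagonal_le_one fun j => ?_)).trans <| (opNorm_mul_le _ _).trans <|
    mul_le_of_le_one_left (opNorm_nonneg _) (opNorm_diagonal_le_one fun i => ?_)
  all_goals split_ifs <;> simp

lemma frobNorm_decouple_le (I : Finset ι) (A : Matrix ι ι ℝ) :
    frobNorm (decouple I A) ≤ frobNorm A := by
  refine (frobNorm_mul_le_mul_opNorm _ _).trans <| (mul_le_of_le_one_right (frobNorm_nonneg _)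
    (opNorm_diagonal_le_one fun j => ?_)).trans <| (frobNorm_mul_le_opNorm_mul _ _).trans <|
    mul_le_of_le_one_left (frobNorm_nonneg _) (opNorm_diagonal_le_one fun i => ?_)
  all_goals split_ifs <;> simp

lemma four_mul_card_filter_mem_and_notMem {i j : ι} (hij : i ≠ j) :
    4 * (Finset.univ.filter fun I : Finset ι => i ∈ I ∧ j ∉ I).card = 2 ^ Fintype.card ι := by
  have hIcc : (Finset.univ.filter fun I : Finset ι => i ∈ I ∧ j ∉ I) = Finset.Icc {i} {j}ᶜ := by
    ext I
    simp
  have hcard : 2 ≤ Fintype.card ι := Finset.card_pair hij ▸ Finset.card_le_univ {i, j}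
  rw [hIcc, Finset.card_Icc_finset (by simpa using hij.symm), Finset.card_compl,
    Finset.card_singleton, Finset.card_singleton, Nat.sub_sub,
    ← Nat.pow_add 2 2 (Fintype.card ι - 2), Nat.add_sub_cancel' hcard]

lemma sum_decouple (A : Matrix ι ι ℝ) :
    ∑ I : Finset ι, decouple I A = (2 ^ Fintype.card ι / 4 : ℝ) • offPart A := by
  ext i j
  rw [Matrix.sum_apply, Matrix.smul_apply, smul_eq_mul]
  simp only [decouple_apply]
  rcases eq_or_ne i j with rfl | hij
  · simp [offPart_apply_self]
  · rw [← Finset.sum_filter, Finset.sum_const, nsmul_eq_mul, offPart_apply_ne A hij]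
    have hcard : (4 * (Finset.univ.filter fun I : Finset ι => i ∈ I ∧ j ∉ I).card : ℝ) =
        2 ^ Fintype.card ι := by exact_mod_cast four_mul_card_filter_mem_and_notMem hij
    rw [← hcard]
    ring

lemma dotProduct_offPart_mulVec (A : Matrix ι ι ℝ) (z : ι → ℝ) :
    z ⬝ᵥ offPart A *ᵥ z = ∑ I : Finset ι, (2 ^ Fintype.card ι : ℝ)⁻¹ *
      (z ⬝ᵥ decouple I ((4 : ℝ) • A) *ᵥ z) := by
  rw [← Finset.mul_sum, ← dotProduct_sum, ← Matrix.sum_mulVec, sum_decouple, offPart, offPart]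
  simp only [Matrix.smul_mulVec, dotProduct_smul, smul_eq_mul, ← mul_assoc, Matrix.diag_smul,
    Matrix.diagonal_smul, ← smul_sub]
  field_simp

variable {μ : Measure S} {v : ℝ} {Z : ι → S → ℝ}

namespace IsSubGaussianFamily

/-- The squares are linearized by an auxiliary gaussian vector `g`; integrating first over `Z`
leaves a diagonal quadratic form in `g`. -/
lemma lintegral_lexp_sum_mul_sq_le [SFinite μ] (hZ : IsSubGaussianFamily μ v Z)
    {U : Matrix ι ι ℝ} (hU : U * Uᵀ = 1) {σ : ι → ℝ} (hσ0 : ∀ i, 0 ≤ σ i)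
    (hσ : ∀ i, 8 * v * σ i ≤ 1) :
    ∫⁻ ω, lexp (∑ i, σ i * (U *ᵥ fun j => Z j ω) i ^ 2) ∂μ ≤ lexp (4 * v * ∑ i, σ i) := by
  set γ : Measure (ι → ℝ) := Measure.pi fun _ => gaussianReal 0 1
  set a : ι → ℝ := fun i => √(2 * σ i)
  have ha (i : ι) : a i ^ 2 = 2 * σ i := Real.sq_sqrt (mul_nonneg zero_le_two (hσ0 i))
  have hmeas : Measurable (Function.uncurry fun (ω : S) (g : ι → ℝ) =>
      lexp (∑ j, (Uᵀ *ᵥ fun i => a i * g i) j * Z j ω)) := by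
    simp only [Function.uncurry_def, Matrix.mulVec, dotProduct]
    have hZ' := hZ.measurable
    fun_prop
  have hintegrate (g : ι → ℝ) : ∫⁻ ω, lexp (∑ j, (Uᵀ *ᵥ fun i => a i * g i) j * Z j ω) ∂μ ≤
      lexp (∑ i, 2 * v * σ i * g i ^ 2) := by
    refine (hZ.lintegral_lexp_sum_mul_le _).trans_eq ?_
    rw [sum_mulVec_sq_of_transpose_mul_self (by simpa using hU), Finset.mul_sum]
    congr 1
    exact Finset.sum_congr rfl fun i _ => by rw [mul_pow, ha]; ring
  calc ∫⁻ ω, lexp (∑ i, σ i * (U *ᵥ fun j => Z j ω) i ^ 2) ∂μ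
      = ∫⁻ g, ∫⁻ ω, lexp (∑ j, (Uᵀ *ᵥ fun i => a i * g i) j * Z j ω) ∂μ ∂γ := by
        simp only [lexp_sum_mul_mulVec_sq_eq_lintegral_gaussianReal U hσ0]
        exact lintegral_lintegral_swap hmeas.aemeasurable
    _ ≤ ∫⁻ g, lexp (∑ i, 2 * v * σ i * g i ^ 2) ∂γ := lintegral_mono hintegrate
    _ = ∏ i, ∫⁻ x, lexp (2 * v * σ i * x ^ 2) ∂(gaussianReal 0 1) :=
        lintegral_lexp_sum_pi_gaussianReal (f := fun i x => 2 * v * σ i * x ^ 2)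
          fun i => by fun_prop
    _ ≤ ∏ i, lexp (2 * (2 * v * σ i)) := Finset.prod_le_prod' fun i _ =>
        lintegral_lexp_mul_sq_gaussianReal_le
          (mul_nonneg (mul_nonneg zero_le_two hZ.nonneg) (hσ0 i)) (by linarith [hσ i])
    _ = lexp (4 * v * ∑ i, σ i) := by
        rw [← lexp_sum, Finset.mul_sum]
        congr 1
        exact Finset.sum_congr rfl fun i _ => by ring

lemma lintegral_lexp_posSemidef_le [SFinite μ] (hZ : IsSubGaussianFamily μ v Z)
    {M : Matrix ι ι ℝ} (hM : M.PosSemidef) (hsmall : 8 * v * opNorm M ≤ 1) :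
    ∫⁻ ω, lexp ((fun j => Z j ω) ⬝ᵥ M *ᵥ fun j => Z j ω) ∂μ ≤ lexp (4 * v * M.trace) := by
  obtain ⟨U, σ, hU, hMU⟩ := isHermitian_exists_diagonalization hM.isHermitian
  have hU' : U * Uᵀ = 1 := mul_eq_one_comm.1 hU
  have hdiag : Matrix.diagonal σ = Uᵀᵀ * M * Uᵀ := by
    rw [hMU, Matrix.transpose_transpose]
    calc Matrix.diagonal σ = (U * Uᵀ) * Matrix.diagonal σ * (U * Uᵀ) := by simp [hU']
      _ = _ := by simp only [Matrix.mul_assoc]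
  have hσ0 (i : ι) : 0 ≤ σ i :=
    Matrix.posSemidef_diagonal_iff.1
      (hdiag ▸ (by simpa using hM.conjTranspose_mul_mul_same Uᵀ)) i
  have hσ (i : ι) : σ i ≤ opNorm M :=
    calc σ i ≤ ‖σ‖ := (le_abs_self _).trans (norm_le_pi_norm σ i)
      _ = opNorm (Uᵀᵀ * M * Uᵀ) := by rw [← hdiag, opNorm_diagonal]
      _ ≤ opNorm Uᵀ ^ 2 * opNorm M := opNorm_transpose_mul_mul_le _ _
      _ ≤ opNorm M := mul_le_of_le_one_left (opNorm_nonneg _) <| pow_le_one₀ (opNorm_nonneg _) <|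
          opNorm_le_one_of_transpose_mul_self (by simpa using hU')
  have htrace : M.trace = ∑ i, σ i := by
    rw [hMU, Matrix.trace_mul_comm, ← Matrix.mul_assoc, hU', Matrix.one_mul,
      Matrix.trace_diagonal]
  have hquad (z : ι → ℝ) : z ⬝ᵥ M *ᵥ z = ∑ i, σ i * (U *ᵥ z) i ^ 2 := by
    rw [hMU, ← Matrix.mulVec_mulVec, ← Matrix.mulVec_mulVec, Matrix.dotProduct_mulVec,
      Matrix.vecMul_transpose]
    simp only [dotProduct, Matrix.mulVec_diagonal]
    exact Finset.sum_congr rfl fun i _ => by ring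
  simp only [hquad]
  rw [htrace]
  exact hZ.lintegral_lexp_sum_mul_sq_le hU' hσ0 fun i =>
    (mul_le_mul_of_nonneg_left (hσ i) (mul_nonneg (by norm_num) hZ.nonneg)).trans hsmall

variable [IsProbabilityMeasure μ]

lemma lintegral_lexp_decouple_eq (hZ : IsSubGaussianFamily μ v Z) (I : Finset ι)
    (A : Matrix ι ι ℝ) :
    ∫⁻ ω, lexp ((fun j => Z j ω) ⬝ᵥ decouple I A *ᵥ fun j => Z j ω) ∂μ =
      ∫⁻ ω', ∫⁻ ω, lexp ((fun j => Z j ω) ⬝ᵥ decouple I A *ᵥ fun j => Z j ω') ∂μ ∂μ := by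
  have hsplit (x y : ι → ℝ) : x ⬝ᵥ decouple I A *ᵥ y =
      ∑ i : I, ∑ j : (Iᶜ : Finset ι), A i j * x i.1 * y j.1 := by
    have hinner (i : ι) : ∑ j : (Iᶜ : Finset ι), A i j * x i * y j.1 =
        ∑ j, if j ∉ I then A i j * x i * y j else 0 := by
      rw [Finset.sum_coe_sort Iᶜ fun j => A i j * x i * y j, ← Finset.sum_filter]
      congr 1
      ext j
      simp
    simp only [hinner]
    rw [Finset.sum_coe_sort I fun i => ∑ j, if j ∉ I then A i j * x i * y j else 0,
      ← Finset.univ_inter I, ← Finset.sum_ite_mem]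
    simp only [dotProduct, Matrix.mulVec, decouple_apply, Finset.mul_sum, Finset.univ_inter]
    refine Finset.sum_congr rfl fun i _ => ?_
    by_cases hi : i ∈ I
    · simp only [hi, true_and, if_true]
      refine Finset.sum_congr rfl fun j _ => ?_
      split_ifs <;> ring
    · simp only [hi, false_and, if_false, zero_mul, mul_zero, Finset.sum_const_zero]
  simp only [hsplit]
  refine lintegral_comp_of_indepFun (f := fun ω (i : I) => Z i ω)
    (g := fun ω (j : (Iᶜ : Finset ι)) => Z j ω)
    (F := fun (x : I → ℝ) (y : (Iᶜ : Finset ι) → ℝ) => lexp (∑ i, ∑ j, A i.1 j.1 * x i * y j))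
    (measurable_pi_lambda _ fun i => hZ.measurable i)
    (measurable_pi_lambda _ fun j => hZ.measurable j)
    (hZ.iIndepFun.indepFun_finset I Iᶜ disjoint_compl_right hZ.measurable) ?_
  simp only [Function.uncurry_def]
  fun_prop

/-- Conditionally on the coordinates outside `I` the form is linear in those inside `I`. -/
lemma lintegral_lexp_decouple_le (hZ : IsSubGaussianFamily μ v Z) (I : Finset ι)
    {A : Matrix ι ι ℝ} (hsmall : 8 * v ^ 2 * opNorm A ^ 2 ≤ 1) :
    ∫⁻ ω, lexp ((fun j => Z j ω) ⬝ᵥ decouple I A *ᵥ fun j => Z j ω) ∂μ ≤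
      lexp (4 * v ^ 2 * frobNorm A ^ 2) := by
  set B := decouple I A
  have hgram : (v • (Bᵀ * B)).PosSemidef := by
    simpa using (Matrix.posSemidef_conjTranspose_mul_self B).smul hZ.nonneg
  have hgram_small : 8 * v * opNorm (v • (Bᵀ * B)) ≤ 1 := by
    rw [opNorm_smul, abs_of_nonneg hZ.nonneg, opNorm_transpose_mul_self]
    calc 8 * v * (v * opNorm B ^ 2) = 8 * v ^ 2 * opNorm B ^ 2 := by ring
      _ ≤ 8 * v ^ 2 * opNorm A ^ 2 := by
          gcongr
          exacts [opNorm_nonneg _, opNorm_decouple_le I A]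
      _ ≤ 1 := hsmall
  calc ∫⁻ ω, lexp ((fun j => Z j ω) ⬝ᵥ B *ᵥ fun j => Z j ω) ∂μ
      = ∫⁻ ω', ∫⁻ ω, lexp ((fun j => Z j ω) ⬝ᵥ B *ᵥ fun j => Z j ω') ∂μ ∂μ :=
        hZ.lintegral_lexp_decouple_eq I A
    _ ≤ ∫⁻ ω', lexp ((fun j => Z j ω') ⬝ᵥ (v • (Bᵀ * B)) *ᵥ fun j => Z j ω') ∂μ := by
        refine lintegral_mono fun ω' => ?_
        rw [Matrix.smul_mulVec, dotProduct_smul, dotProduct_transpose_mul_mulVec, smul_eq_mul]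
        simpa only [dotProduct, mul_comm] using
          hZ.lintegral_lexp_sum_mul_le (B *ᵥ fun j => Z j ω')
    _ ≤ lexp (4 * v * (v • (Bᵀ * B)).trace) := hZ.lintegral_lexp_posSemidef_le hgram hgram_small
    _ ≤ lexp (4 * v ^ 2 * frobNorm A ^ 2) := by
        rw [Matrix.trace_smul, ← frobNorm_sq_eq_trace, smul_eq_mul,
          show 4 * v * (v * frobNorm B ^ 2) = 4 * v ^ 2 * frobNorm B ^ 2 by ring]
        refine lexp_mono ?_
        gcongr
        exacts [frobNorm_nonneg _, frobNorm_decouple_le I A]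

lemma lintegral_lexp_offPart_le (hZ : IsSubGaussianFamily μ v Z) {A : Matrix ι ι ℝ}
    (hsmall : 128 * v ^ 2 * opNorm A ^ 2 ≤ 1) :
    ∫⁻ ω, lexp ((fun j => Z j ω) ⬝ᵥ offPart A *ᵥ fun j => Z j ω) ∂μ ≤
      lexp (64 * v ^ 2 * frobNorm A ^ 2) := by
  have hweights : ∑ _I : Finset ι, (2 ^ Fintype.card ι : ℝ)⁻¹ = 1 := by simp
  have hdecouple (I : Finset ι) :
      ∫⁻ ω, lexp ((fun j => Z j ω) ⬝ᵥ decouple I ((4 : ℝ) • A) *ᵥ fun j => Z j ω) ∂μ ≤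
        lexp (64 * v ^ 2 * frobNorm A ^ 2) := by
    refine (hZ.lintegral_lexp_decouple_le I ?_).trans_eq ?_
    · rw [opNorm_smul, mul_pow, sq_abs]
      linarith
    · rw [frobNorm_smul, mul_pow, sq_abs]
      ring_nf
  simp only [dotProduct_offPart_mulVec]
  refine (TeraLasso.lintegral_lexp_sum_mul_le (fun I _ => ?_) (fun _ _ => by positivity) hweights
    fun I _ => hdecouple I).trans_eq ?_
  · exact (measurable_quadForm _).comp (measurable_pi_lambda _ hZ.measurable)
  · rw [← Finset.sum_mul, hweights, one_mul]

end IsSubGaussianFamily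

end QuadraticForms

section HansonWright

variable {S : Type*} [MeasurableSpace S] {ι : Type*}

/-- An independent family of centred variables with unit variance and `ψ₂`-norms at most `k`. -/
structure IsStandardSubGaussianFamily (μ : Measure S) (k : ℝ) (Z : ι → S → ℝ) : Prop where
  measurable : ∀ j, Measurable (Z j)
  iIndepFun : iIndepFun Z μ
  integral_eq_zero : ∀ j, ∫ ω, Z j ω ∂μ = 0
  integral_sq_eq_one : ∀ j, ∫ ω, Z j ω ^ 2 ∂μ = 1
  lintegral_lexp_sq_le : ∀ j, ∫⁻ ω, lexp (Z j ω ^ 2 / k ^ 2) ∂μ ≤ 2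

/-- The factor of `‖A‖_F²` in the exponential moment form of the Hanson–Wright inequality. -/
noncomputable def hansonWrightConst (k : ℝ) : ℝ :=
  32 * k ^ 4 * Real.exp (1 / k ^ 2) + 128 * k ^ 4

lemma hansonWrightConst_nonneg (k : ℝ) : 0 ≤ hansonWrightConst k := by
  unfold hansonWrightConst
  positivity

lemma dotProduct_mulVec_sub_trace [Fintype ι] [DecidableEq ι] (A : Matrix ι ι ℝ) (z : ι → ℝ) :
    z ⬝ᵥ A *ᵥ z - A.trace = ∑ j, A j j * (z j ^ 2 - 1) + z ⬝ᵥ offPart A *ᵥ z := by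
  rw [offPart, Matrix.sub_mulVec, dotProduct_sub]
  simp only [dotProduct, Matrix.mulVec_diagonal, Matrix.diag_apply, Matrix.trace, mul_sub, mul_one,
    Finset.sum_sub_distrib]
  rw [Finset.sum_congr rfl fun j _ => show z j * (A j j * z j) = A j j * z j ^ 2 by ring]
  ring

namespace IsStandardSubGaussianFamily

variable {μ : Measure S} [IsProbabilityMeasure μ] {k : ℝ} {Z : ι → S → ℝ}

lemma isSubGaussianFamily (hZ : IsStandardSubGaussianFamily μ k Z) (hk : 0 < k) :
    IsSubGaussianFamily μ (k ^ 2) Z where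
  nonneg := sq_nonneg k
  measurable := hZ.measurable
  iIndepFun := hZ.iIndepFun
  lintegral_lexp_mul_le j t := TeraLasso.lintegral_lexp_mul_le (hZ.measurable j) hk
    (hZ.lintegral_lexp_sq_le j) (hZ.integral_eq_zero j) t

variable [Fintype ι] [DecidableEq ι]

lemma lintegral_lexp_diag_le (hZ : IsStandardSubGaussianFamily μ k Z) (hk : 0 < k)
    {A : Matrix ι ι ℝ} (hsmall : 2 * k ^ 2 * opNorm A ≤ 1) :
    ∫⁻ ω, lexp (∑ j, A j j * (Z j ω ^ 2 - 1)) ∂μ ≤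
      lexp (16 * k ^ 4 * Real.exp (1 / k ^ 2) * frobNorm A ^ 2) := by
  have hentry (j : ι) : ∫⁻ ω, lexp (A j j * (Z j ω ^ 2 - 1)) ∂μ ≤
      lexp (16 * k ^ 4 * Real.exp (1 / k ^ 2) * A j j ^ 2) :=
    lintegral_lexp_mul_sq_sub_one_le (hZ.measurable j) hk (hZ.lintegral_lexp_sq_le j)
      (hZ.integral_sq_eq_one j)
      ((mul_le_mul_of_nonneg_left (abs_entry_le_opNorm A j j) (by positivity)).trans hsmall)
  have hdiag : ∑ j, A j j ^ 2 ≤ frobNorm A ^ 2 := by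
    rw [frobNorm_sq]
    exact Finset.sum_le_sum fun j _ => Finset.single_le_sum (f := fun i => A j i ^ 2)
      (fun _ _ => sq_nonneg _) (Finset.mem_univ j)
  refine (lintegral_lexp_sum_le Finset.univ hZ.iIndepFun hZ.measurable
    (f := fun j x => A j j * (x ^ 2 - 1)) (fun j => by fun_prop) hentry).trans (lexp_mono ?_)
  rw [← Finset.mul_sum]
  gcongr

/-- The diagonal and off-diagonal parts of the form are dependent; by convexity it suffices to
bound the exponential moment of twice each of them. -/
theorem lintegral_lexp_quadForm_sub_trace_le (hZ : IsStandardSubGaussianFamily μ k Z) (hk : 0 < k)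
    {A : Matrix ι ι ℝ} (hsmall : 32 * k ^ 2 * opNorm A ≤ 1) :
    ∫⁻ ω, lexp ((fun j => Z j ω) ⬝ᵥ A *ᵥ (fun j => Z j ω) - A.trace) ∂μ ≤
      lexp (hansonWrightConst k * frobNorm A ^ 2) := by
  set B := (2 : ℝ) • A
  have hop : opNorm B = 2 * opNorm A := by rw [opNorm_smul, abs_two]
  have hfrob : frobNorm B = 2 * frobNorm A := by rw [frobNorm_smul, abs_two]
  have hop0 : 0 ≤ k ^ 2 * opNorm A := mul_nonneg (sq_nonneg k) (opNorm_nonneg A)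
  have hdiag := hZ.lintegral_lexp_diag_le hk (A := B)
    (by rw [hop]; linarith)
  have hoff := (hZ.isSubGaussianFamily hk).lintegral_lexp_offPart_le (A := B)
    (by rw [hop]; nlinarith)
  have hsplit (z : ι → ℝ) : z ⬝ᵥ A *ᵥ z - A.trace =
      (∑ j, B j j * (z j ^ 2 - 1) + z ⬝ᵥ offPart B *ᵥ z) / 2 := by
    rw [← dotProduct_mulVec_sub_trace, Matrix.smul_mulVec, dotProduct_smul, Matrix.trace_smul,
      ← smul_sub, smul_eq_mul, mul_div_cancel_left₀ _ two_ne_zero]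
  simp only [hsplit]
  refine (lintegral_lexp_add_div_two_le ?_ ?_ hdiag hoff).trans_eq ?_
  · have hmeas := hZ.measurable
    fun_prop
  · exact (measurable_quadForm _).comp (measurable_pi_lambda _ hZ.measurable)
  · rw [hfrob, hansonWrightConst]
    ring_nf

end IsStandardSubGaussianFamily

end HansonWright

section Deviation

variable {S : Type*} [MeasurableSpace S] {μ : Measure S} {ι : Type*} [Fintype ι]

lemma trace_transpose_vecMulVec_mul (x : ι → ℝ) (M : Matrix ι ι ℝ) :
    ((Matrix.vecMulVec x x)ᵀ * M).trace = x ⬝ᵥ M *ᵥ x := by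
  rw [Matrix.transpose_vecMulVec, Matrix.trace_mul_comm, Matrix.mul_vecMulVec,
    Matrix.trace_vecMulVec, dotProduct_comm]

variable {n : ℕ}

/-- The deviation `⟨Ŝ - Σ, M⟩` of the sample covariance `Ŝ` from `Sig`, as a linear functional
of the test matrix `M`. -/
noncomputable def deviation (x : Fin n → ι → ℝ) (Sig : Matrix ι ι ℝ) : Matrix ι ι ℝ →ₗ[ℝ] ℝ :=
  Matrix.traceLinearMap ι ℝ ℝ ∘ₗ LinearMap.mulLeft ℝ (sampleCov x - Sig)ᵀ

lemma deviation_apply (x : Fin n → ι → ℝ) (Sig M : Matrix ι ι ℝ) :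
    deviation x Sig M = ((sampleCov x - Sig)ᵀ * M).trace := rfl

lemma natCast_mul_deviation (hn : 0 < n) (x : Fin n → ι → ℝ) (Sig M : Matrix ι ι ℝ) :
    n * deviation x Sig M = ∑ i, (x i ⬝ᵥ M *ᵥ x i - (Sigᵀ * M).trace) := by
  have hn' : (n : ℝ) ≠ 0 := by exact_mod_cast hn.ne'
  rw [deviation_apply, sampleCov, Matrix.transpose_sub, Matrix.sub_mul, Matrix.trace_sub,
    Matrix.transpose_smul, Matrix.smul_mul, Matrix.trace_smul, Matrix.transpose_sum,
    Matrix.sum_mul, Matrix.trace_sum, smul_eq_mul, mul_sub, mul_inv_cancel_left₀ hn']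
  simp only [trace_transpose_vecMulVec_mul, Finset.sum_sub_distrib, Finset.sum_const,
    Finset.card_univ, Fintype.card_fin, nsmul_eq_mul]

lemma measurable_deviation {X : Fin n → S → ι → ℝ} (hX : ∀ i, Measurable (X i))
    (Sig M : Matrix ι ι ℝ) : Measurable fun ω => deviation (fun i => X i ω) Sig M := by
  simp only [deviation_apply, sampleCov, Matrix.trace, Matrix.diag_apply, Matrix.mul_apply,
    Matrix.transpose_apply, Matrix.sub_apply, Matrix.smul_apply, Matrix.sum_apply,
    Matrix.vecMulVec_apply]
  fun_prop

lemma measure_lt_abs_le_of_lintegral_lexp_le {Y : S → ℝ} (hY : Measurable Y) {l c : ℝ} (hl : 0 ≤ l)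
    (hpos : ∫⁻ ω, lexp (l * Y ω) ∂μ ≤ lexp c) (hneg : ∫⁻ ω, lexp (-l * Y ω) ∂μ ≤ lexp c) (t : ℝ) :
    μ {ω | t < |Y ω|} ≤ 2 * lexp (c - l * t) := by
  have htail {l' : ℝ} (h : ∫⁻ ω, lexp (l' * Y ω) ∂μ ≤ lexp c) :
      μ {ω | lexp (l * t) ≤ lexp (l' * Y ω)} ≤ lexp (c - l * t) := by
    have hmarkov := (mul_meas_ge_le_lintegral (μ := μ)
      (measurable_lexp_comp (hY.const_mul l')) (lexp (l * t))).trans h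
    calc μ {ω | lexp (l * t) ≤ lexp (l' * Y ω)}
        = lexp (-(l * t)) * (lexp (l * t) * μ {ω | lexp (l * t) ≤ lexp (l' * Y ω)}) := by
          rw [← mul_assoc, ← lexp_add, neg_add_cancel, lexp_zero, one_mul]
      _ ≤ lexp (-(l * t)) * lexp c := by gcongr
      _ = lexp (c - l * t) := by rw [← lexp_add, neg_add_eq_sub]
  have hcover : {ω | t < |Y ω|} ⊆
      {ω | lexp (l * t) ≤ lexp (l * Y ω)} ∪ {ω | lexp (l * t) ≤ lexp (-l * Y ω)} := by
    intro ω hω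
    rw [Set.mem_ofPred_eq, lt_abs] at hω
    refine hω.imp (fun h => lexp_mono ?_) fun h => lexp_mono ?_
    · exact mul_le_mul_of_nonneg_left h.le hl
    · rw [neg_mul_comm]
      exact mul_le_mul_of_nonneg_left h.le hl
  calc μ {ω | t < |Y ω|} ≤ lexp (c - l * t) + lexp (c - l * t) :=
        (measure_mono hcover).trans <| (measure_union_le _ _).trans <|
          add_le_add (htail hpos) (htail hneg)
    _ = 2 * lexp (c - l * t) := (two_mul _).symm

namespace IsSubGaussianTensor

variable {K : ℝ} {cov : Matrix ι ι ℝ} {X : S → ι → ℝ}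

lemma exists_isStandardSubGaussianFamily (hX : IsSubGaussianTensor μ K cov X) (hK : 0 < K) :
    ∃ (R : Matrix ι ι ℝ) (Z : ι → S → ℝ), R * Rᵀ = cov ∧
      IsStandardSubGaussianFamily μ (2 * K) Z ∧ ∀ ω, X ω = R *ᵥ fun j => Z j ω := by
  obtain ⟨R, Z, hR, hRR, hZ, hind, h0, h1, hpsi, hXZ⟩ := hX
  have hR' : Rᵀ = R := by simpa using hR.isHermitian.eq
  exact ⟨R, Z, hR'.symm ▸ hRR,
    ⟨hZ, hind, h0, h1, fun j => lintegral_lexp_le_of_psiTwoNorm_le hK (hpsi j)⟩, hXZ⟩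

protected lemma measurable (hX : IsSubGaussianTensor μ K cov X) : Measurable X := by
  obtain ⟨R, Z, -, -, hZ, -, -, -, -, hXZ⟩ := hX
  rw [funext hXZ]
  refine measurable_pi_lambda _ fun i => ?_
  simp only [Matrix.mulVec, dotProduct]
  fun_prop

variable [DecidableEq ι]

lemma lintegral_lexp_quadForm_sub_trace_le [IsProbabilityMeasure μ]
    (hX : IsSubGaussianTensor μ K cov X) (hK : 0 < K) {M : Matrix ι ι ℝ}
    (hsmall : 128 * K ^ 2 * (opNorm cov * opNorm M) ≤ 1) :
    ∫⁻ ω, lexp (X ω ⬝ᵥ M *ᵥ X ω - (covᵀ * M).trace) ∂μ ≤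
      lexp (hansonWrightConst (2 * K) * (opNorm cov * frobNorm M) ^ 2) := by
  obtain ⟨R, Z, rfl, hZ, hXZ⟩ := hX.exists_isStandardSubGaussianFamily hK
  have hop : opNorm (R * Rᵀ) = opNorm R ^ 2 := by
    rw [← opNorm_transpose R, ← opNorm_transpose_mul_self, Matrix.transpose_transpose]
  have htrace : ((R * Rᵀ)ᵀ * M).trace = (Rᵀ * M * R).trace := by
    rw [Matrix.transpose_mul, Matrix.transpose_transpose, Matrix.mul_assoc, Matrix.trace_mul_comm]
  have hquad (z : ι → ℝ) : (R *ᵥ z) ⬝ᵥ M *ᵥ (R *ᵥ z) = z ⬝ᵥ (Rᵀ * M * R) *ᵥ z := by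
    rw [Matrix.mul_assoc, ← Matrix.mulVec_mulVec, ← Matrix.mulVec_mulVec,
      Matrix.dotProduct_mulVec z, Matrix.vecMul_transpose]
  simp only [hXZ, hquad, htrace]
  refine (hZ.lintegral_lexp_quadForm_sub_trace_le (by positivity) ?_).trans (lexp_mono ?_)
  · calc 32 * (2 * K) ^ 2 * opNorm (Rᵀ * M * R)
        ≤ 32 * (2 * K) ^ 2 * (opNorm R ^ 2 * opNorm M) := by
          gcongr
          exact opNorm_transpose_mul_mul_le R M
      _ ≤ 1 := by rw [← hop]; linarith
  · have := hansonWrightConst_nonneg (2 * K)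
    rw [hop]
    gcongr
    exacts [frobNorm_nonneg _, frobNorm_transpose_mul_mul_le R M]

end IsSubGaussianTensor

variable {K : ℝ} {Sig : Matrix ι ι ℝ} {X : Fin n → S → ι → ℝ} [DecidableEq ι]
  [IsProbabilityMeasure μ]

lemma lintegral_lexp_natCast_mul_deviation_le (hK : 0 < K) (hn : 0 < n)
    (hX : ∀ i, IsSubGaussianTensor μ K Sig (X i)) (hind : iIndepFun X μ) {M : Matrix ι ι ℝ}
    (hsmall : 128 * K ^ 2 * (opNorm Sig * opNorm M) ≤ 1) :
    ∫⁻ ω, lexp (n * deviation (fun i => X i ω) Sig M) ∂μ ≤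
      lexp (n * (hansonWrightConst (2 * K) * (opNorm Sig * frobNorm M) ^ 2)) := by
  simp only [natCast_mul_deviation hn]
  refine (lintegral_lexp_sum_le Finset.univ hind (fun i => (hX i).measurable)
    (f := fun _ x => x ⬝ᵥ M *ᵥ x - (Sigᵀ * M).trace)
    (fun _ => (measurable_quadForm M).sub_const _)
    fun i => (hX i).lintegral_lexp_quadForm_sub_trace_le hK hsmall).trans_eq ?_
  rw [Finset.sum_const, Finset.card_univ, Fintype.card_fin, nsmul_eq_mul]

theorem measure_lt_abs_deviation_le (hK : 0 < K) (hn : 0 < n)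
    (hX : ∀ i, IsSubGaussianTensor μ K Sig (X i)) (hind : iIndepFun X μ) {M : Matrix ι ι ℝ}
    {l : ℝ} (hl : 0 ≤ l) (hsmall : 128 * K ^ 2 * (l * (opNorm Sig * opNorm M)) ≤ 1) (t : ℝ) :
    μ {ω | t < |deviation (fun i => X i ω) Sig M|} ≤
      2 * lexp (n * (hansonWrightConst (2 * K) * (l * (opNorm Sig * frobNorm M)) ^ 2 - l * t)) := by
  have hmgf {l' : ℝ} (hl' : |l'| = l) :
      ∫⁻ ω, lexp (l' * (n * deviation (fun i => X i ω) Sig M)) ∂μ ≤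
        lexp (n * (hansonWrightConst (2 * K) * (l * (opNorm Sig * frobNorm M)) ^ 2)) := by
    have h := lintegral_lexp_natCast_mul_deviation_le hK hn hX hind (M := l' • M)
      (by rwa [opNorm_smul, hl', mul_left_comm (opNorm Sig)])
    simpa only [map_smul, smul_eq_mul, frobNorm_smul, hl', mul_left_comm] using h
  have htail := measure_lt_abs_le_of_lintegral_lexp_le
    ((measurable_deviation (fun i => (hX i).measurable) Sig M).const_mul (n : ℝ)) hl
    (hmgf (abs_of_nonneg hl)) (hmgf (by rw [abs_neg, abs_of_nonneg hl])) (n * t)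
  simpa only [abs_mul, Nat.abs_cast, mul_lt_mul_iff_right₀ (Nat.cast_pos (α := ℝ).2 hn), mul_sub,
    mul_left_comm l] using htail

end Deviation

section Net

open Metric Module

variable {E : Type*} [NormedAddCommGroup E] [NormedSpace ℝ E]

lemma packingNumber_one_closedBall_two_le [FiniteDimensional ℝ E] :
    packingNumber 1 (closedBall (0 : E) 2) ≤ 5 ^ finrank ℝ E := by
  refine iSup₂_le fun C hC => iSup_le fun hsep => ?_
  by_contra! hlt
  obtain ⟨s, hsC, hs⟩ := Set.exists_subset_encard_eq (Order.add_one_le_of_lt hlt)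
  have hfin : s.Finite := Set.finite_of_encard_eq_coe (k := 5 ^ finrank ℝ E + 1) (mod_cast hs)
  lift s to Finset E using hfin
  rw [Set.encard_coe_eq_coe_finsetCard] at hs
  have hcard : s.card = 5 ^ finrank ℝ E + 1 := mod_cast hs
  refine absurd hcard (Nat.lt_succ_of_le (Besicovitch.card_le_of_separated s
    (fun c hc => by simpa using hC (hsC hc)) fun c hc e he hce => ?_)).ne
  have hdist : (1 : ENNReal) < edist c e := hsep (hsC hc) (hsC he) hce
  rw [edist_dist, ← ENNReal.ofReal_one, ENNReal.ofReal_lt_ofReal_iff_of_nonneg zero_le_one,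
    dist_eq_norm] at hdist
  exact hdist.le

lemma exists_finset_isCover_closedBall_two (E : Type*) [NormedAddCommGroup E] [NormedSpace ℝ E]
    [FiniteDimensional ℝ E] :
    ∃ N : Finset E, N.card ≤ 5 ^ finrank ℝ E ∧ (N : Set E) ⊆ closedBall 0 2 ∧
      IsCover 1 (closedBall 0 2) (N : Set E) := by
  have hle : coveringNumber 1 (closedBall (0 : E) 2) ≤ 5 ^ finrank ℝ E :=
    (coveringNumber_le_packingNumber _ _).trans packingNumber_one_closedBall_two_le
  obtain ⟨N, hN, hfin, hcover, hcard⟩ := exists_set_encard_eq_coveringNumber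
    (hle.trans_lt (ENat.natCast_lt_top (5 ^ finrank ℝ E))).ne
  lift N to Finset E using hfin
  rw [← hcard, Set.encard_coe_eq_coe_finsetCard] at hle
  exact ⟨N, mod_cast hle, hN, hcover⟩

lemma abs_le_of_isCover_closedBall_two [FiniteDimensional ℝ E] {N : Set E}
    (hN : IsCover 1 (closedBall 0 2) N) (ℓ : E →ₗ[ℝ] ℝ) {t : ℝ} (ht : 0 ≤ t)
    (h : ∀ u ∈ N, |ℓ u| ≤ t) (v : E) : |ℓ v| ≤ t * ‖v‖ := by
  let f : E →L[ℝ] ℝ := ℓ.toContinuousLinearMap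
  suffices hf : ‖f‖ ≤ t from f.le_of_opNorm_le hf v
  have hself : ‖f‖ ≤ (t + ‖f‖) / 2 := by
    refine f.opNorm_le_of_unit_norm (by positivity) fun x hx => ?_
    have hmem : (2 : ℝ) • x ∈ closedBall 0 2 := by simp [norm_smul, hx]
    obtain ⟨u, hu, hxu : edist _ _ ≤ 1⟩ := hN hmem
    rw [edist_dist, ENNReal.ofReal_le_one, dist_eq_norm] at hxu
    have htwo : 2 * ‖f x‖ ≤ t + ‖f‖ :=
      calc 2 * ‖f x‖ = ‖f u + f ((2 : ℝ) • x - u)‖ := by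
            rw [← map_add, add_sub_cancel, map_smul, norm_smul, Real.norm_ofNat]
        _ ≤ t + ‖f‖ := (norm_add_le _ _).trans
            (add_le_add (h u hu) (f.le_of_opNorm_le_of_le le_rfl hxu |>.trans_eq (mul_one _)))
    linarith
  linarith

lemma exists_finset_abs_le_of_abs_le {F : Type*} [AddCommGroup F] [Module ℝ F]
    [FiniteDimensional ℝ F] (T : F →ₗ[ℝ] E) :
    ∃ N : Finset F, N.card ≤ 5 ^ finrank ℝ F ∧ (∀ u ∈ N, ‖T u‖ ≤ 2) ∧
      ∀ (ℓ : E →ₗ[ℝ] ℝ) (t : ℝ), 0 ≤ t → (∀ u ∈ N, |ℓ (T u)| ≤ t) →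
        ∀ v, |ℓ (T v)| ≤ t * ‖T v‖ := by
  classical
  obtain ⟨N, hcard, hball, hcover⟩ := exists_finset_isCover_closedBall_two (LinearMap.range T)
  obtain ⟨g, hg⟩ := T.rangeRestrict.exists_rightInverse_of_surjective T.range_rangeRestrict
  have hTg (y : LinearMap.range T) : T (g y) = y :=
    congrArg Subtype.val (LinearMap.congr_fun hg y)
  refine ⟨N.image g, Finset.card_image_le.trans (hcard.trans ?_), ?_, fun ℓ t ht h v => ?_⟩
  · exact Nat.pow_le_pow_right (by norm_num) T.finrank_range_le
  · rw [Finset.forall_mem_image]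
    intro y hy
    simpa [hTg] using hball hy
  · exact abs_le_of_isCover_closedBall_two hcover (ℓ ∘ₗ (LinearMap.range T).subtype) ht
      (fun y hy => by simpa [hTg] using h (g y) (Finset.mem_image_of_mem g hy)) (T.rangeRestrict v)

end Net

section NoiseEvent

variable {L : ℕ} {d : Fin L → ℕ}

/-- The Kronecker sum of the diagonal matrices with the given diagonals. -/
noncomputable def kroneckerSumDiagonal (d : Fin L → ℕ) :
    (∀ k, Fin (d k) → ℝ) →ₗ[ℝ] Matrix (Idx d) (Idx d) ℝ :=
  kroneckerSumLinear d ∘ₗ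
    LinearMap.pi fun k => Matrix.diagonalLinearMap (Fin (d k)) ℝ ℝ ∘ₗ LinearMap.proj k

open scoped Matrix.Norms.Frobenius in
/-- The bound on the diagonal Kronecker sums, a space of dimension at most `∑ k, d k`, need only
be checked on a net. -/
lemma exists_finset_isNoiseBound (d : Fin L → ℕ) :
    ∃ N : Finset (∀ k, Fin (d k) → ℝ), N.card ≤ 5 ^ ∑ k, d k ∧
      (∀ f ∈ N, frobNorm (kroneckerSumDiagonal d f) ≤ 2) ∧
      ∀ (W : Matrix (Idx d) (Idx d) ℝ) (δ : Fin L → ℝ) (τ : ℝ), 0 ≤ τ →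
        (∀ k a b, |(Wᵀ * modeEmbed d k (Matrix.single a b 1)).trace| ≤ coDim d k * δ k) →
        (∀ f ∈ N, |(Wᵀ * kroneckerSumDiagonal d f).trace| ≤ τ) → IsNoiseBound W δ τ := by
  obtain ⟨N, hcard, hnorm, hbound⟩ := exists_finset_abs_le_of_abs_le (kroneckerSumDiagonal d)
  refine ⟨N, by simpa [Module.finrank_pi_fintype] using hcard, ?_, ?_⟩
  · simpa only [frobNorm_eq_norm] using hnorm
  · refine fun W δ τ hτ hoff hdiag => ⟨hoff, fun f => ?_⟩
    rw [frobNorm_eq_norm]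
    exact hbound (Matrix.traceLinearMap _ ℝ ℝ ∘ₗ LinearMap.mulLeft ℝ Wᵀ) τ hτ hdiag f

lemma frobNorm_single {q : ℕ} (a b : Fin q) :
    frobNorm (Matrix.single a b (1 : ℝ)) = 1 := by
  rw [frobNorm, Real.sqrt_eq_one, Finset.sum_eq_single a, Finset.sum_eq_single b] <;>
    simp +contextual [Matrix.single_apply, eq_comm]

lemma natCast_five_pow_le_lexp (m : ℕ) : ((5 ^ m : ℕ) : ENNReal) ≤ lexp (2 * m) := by
  have hfive : (5 : ℝ) ≤ Real.exp 2 := by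
    have hone := Real.exp_one_gt_d9
    rw [← one_add_one_eq_two, Real.exp_add]
    nlinarith
  rw [← ENNReal.ofReal_natCast]
  refine ENNReal.ofReal_le_ofReal ?_
  rw [mul_comm, Real.exp_nat_mul]
  push_cast
  gcongr

lemma log_totalDim_le_sum (hd : ∀ k, 0 < d k) : Real.log (totalDim d) ≤ ∑ k, (d k : ℝ) := by
  rw [totalDim, Nat.cast_prod, Real.log_prod fun k _ => mod_cast (hd k).ne']
  exact Finset.sum_le_sum fun k _ => Real.log_le_self (Nat.cast_nonneg _)

lemma sum_dim_le_div (hL : 1 ≤ L) (hd : ∀ k, 0 < d k) :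
    ∑ k, (d k : ℝ) ≤ L * totalDim d / minCoDim d := by
  rw [le_div_iff₀ (mod_cast minCoDim_pos hL hd)]
  exact_mod_cast sum_dim_mul_minCoDim_le (d := d)

lemma sum_sq_dim_mul_exp_le (hL : 1 ≤ L) (hd : ∀ k, 0 < d k) (hp : 2 ≤ totalDim d) :
    (∑ k, (d k : ℝ) * d k + 1) * (2 * Real.exp (-(5 * Real.log (totalDim d)))) ≤
      L * Real.exp (-Real.log (totalDim d)) := by
  have hp' : (2 : ℝ) ≤ totalDim d := mod_cast hp
  have hL' : (1 : ℝ) ≤ L := mod_cast hL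
  have hexp : Real.exp (-(5 * Real.log (totalDim d))) = ((totalDim d : ℝ) ^ 5)⁻¹ := by
    rw [Real.exp_neg, ← Nat.cast_ofNat, Real.exp_nat_mul, Real.exp_log (by linarith)]
  have hdim (k : Fin L) : (d k : ℝ) * d k ≤ totalDim d ^ 2 := by
    have hdk : (d k : ℝ) ≤ totalDim d := by
      rw [totalDim_eq_mul_coDim k]
      exact_mod_cast Nat.le_mul_of_pos_right _ (coDim_pos hd k)
    rw [sq]
    gcongr
  have hsum : ∑ k, (d k : ℝ) * d k + 1 ≤ 2 * (L * totalDim d ^ 2) := by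
    have hconst := Finset.sum_le_sum fun k (_ : k ∈ Finset.univ) => hdim k
    rw [Finset.sum_const, Finset.card_univ, Fintype.card_fin, nsmul_eq_mul] at hconst
    nlinarith
  have hfour : (4 : ℝ) ≤ totalDim d ^ 2 := by nlinarith
  rw [hexp, Real.exp_neg, Real.exp_log (by linarith)]
  calc (∑ k, (d k : ℝ) * d k + 1) * (2 * ((totalDim d : ℝ) ^ 5)⁻¹)
      ≤ 2 * (L * totalDim d ^ 2) * (2 * ((totalDim d : ℝ) ^ 5)⁻¹) := by gcongr
    _ = L * (totalDim d : ℝ)⁻¹ * (4 / totalDim d ^ 2) := by field_simp; norm_num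
    _ ≤ L * (totalDim d : ℝ)⁻¹ :=
        mul_le_of_le_one_right (by positivity) (div_le_one_of_le₀ hfour (by positivity))

variable {S : Type*} [MeasurableSpace S] {μ : Measure S} [IsProbabilityMeasure μ] {n : ℕ}
  {K c : ℝ} {Sig : Matrix (Idx d) (Idx d) ℝ} {X : Fin n → S → Idx d → ℝ}

lemma measure_lt_abs_deviation_le_of_opNorm_mul_le (hK : 0 < K) (hn : 0 < n) (hσ : 0 < opNorm Sig)
    (hX : ∀ i, IsSubGaussianTensor μ K Sig (X i)) (hind : iIndepFun X μ)
    {M : Matrix (Idx d) (Idx d) ℝ} {l : ℝ} (hl : 0 ≤ l)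
    (hsmall : 128 * K ^ 2 * (l * opNorm M) ≤ 1) {s t : ℝ} (hst : opNorm Sig * t ≤ s) :
    μ {ω | s < |deviation (fun i => X i ω) Sig M|} ≤
      2 * lexp (n * (hansonWrightConst (2 * K) * (l * frobNorm M) ^ 2 - l * t)) := by
  have hcancel (x : ℝ) : l / opNorm Sig * (opNorm Sig * x) = l * x := by field_simp
  have h := measure_lt_abs_deviation_le hK hn hX hind (M := M) (l := l / opNorm Sig)
    (by positivity) (by rwa [hcancel]) (opNorm Sig * t)
  rw [hcancel, hcancel] at h
  exact (measure_mono fun ω (hω : s < _) => hst.trans_lt hω).trans h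

lemma measure_lt_abs_deviation_single_le (hd : ∀ k, 0 < d k) (hK : 0 < K) (hc : 0 < c)
    (hKc : 128 * K ^ 2 * c ≤ 1) (hn : 0 < n) (hσ : 0 < opNorm Sig)
    (hX : ∀ i, IsSubGaussianTensor μ K Sig (X i)) (hind : iIndepFun X μ) {k : Fin L}
    (hlog : Real.log (totalDim d) ≤ coDim d k) {δ : ℝ}
    (hδ : (5 + hansonWrightConst (2 * K) * c ^ 2) / c *
      (opNorm Sig * √(Real.log (totalDim d) / (n * coDim d k))) ≤ δ) (a b : Fin (d k)) :
    μ {ω | coDim d k * δ <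
        |deviation (fun i => X i ω) Sig (modeEmbed d k (Matrix.single a b 1))|} ≤
      2 * lexp (-(5 * Real.log (totalDim d))) := by
  set q := √(Real.log (totalDim d) / (n * coDim d k)) with hq
  set H := hansonWrightConst (2 * K)
  have hm : (0 : ℝ) < coDim d k := mod_cast coDim_pos hd k
  have hn' : (1 : ℝ) ≤ n := mod_cast hn
  have : 0 ≤ Real.log (totalDim d) := Real.log_natCast_nonneg _
  have hq2 : n * coDim d k * q ^ 2 = Real.log (totalDim d) := by
    rw [hq, Real.sq_sqrt (by positivity)]
    field_simp
  have hq1 : q ≤ 1 := by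
    rw [hq, Real.sqrt_le_one, div_le_one (by positivity)]
    nlinarith
  have hop : opNorm (modeEmbed d k (Matrix.single a b (1 : ℝ))) ≤ 1 :=
    (opNorm_modeEmbed_le k _).trans_eq (frobNorm_single a b)
  have hsmall : 128 * K ^ 2 * (c * q * opNorm (modeEmbed d k (Matrix.single a b (1 : ℝ)))) ≤ 1 := by
    refine le_trans ?_ hKc
    gcongr
    rw [mul_assoc]
    exact mul_le_of_le_one_right hc.le (mul_le_one₀ hq1 (opNorm_nonneg _) hop)
  have hthreshold : opNorm Sig * (coDim d k * ((5 + H * c ^ 2) / c * q)) ≤ coDim d k * δ := by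
    rw [mul_left_comm (opNorm Sig), mul_left_comm (opNorm Sig)]
    gcongr
  refine (measure_lt_abs_deviation_le_of_opNorm_mul_le hK hn hσ hX hind (by positivity) hsmall
    hthreshold).trans_eq ?_
  rw [mul_pow, frobNorm_modeEmbed_sq, frobNorm_single, ← hq2]
  congr 2
  field_simp
  ring

lemma measure_exists_lt_abs_deviation_single_le (hd : ∀ k, 0 < d k) (hK : 0 < K) (hc : 0 < c)
    (hKc : 128 * K ^ 2 * c ≤ 1) (hn : 0 < n) (hσ : 0 < opNorm Sig)
    (hX : ∀ i, IsSubGaussianTensor μ K Sig (X i)) (hind : iIndepFun X μ)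
    (hlog : ∀ k, Real.log (totalDim d) ≤ coDim d k) {δ : Fin L → ℝ}
    (hδ : ∀ k, (5 + hansonWrightConst (2 * K) * c ^ 2) / c *
      (opNorm Sig * √(Real.log (totalDim d) / (n * coDim d k))) ≤ δ k) :
    μ {ω | ∃ k a b, coDim d k * δ k <
        |deviation (fun i => X i ω) Sig (modeEmbed d k (Matrix.single a b 1))|} ≤
      (∑ k, d k * d k : ℕ) * (2 * lexp (-(5 * Real.log (totalDim d)))) := by
  let bad (x : Σ k, Fin (d k) × Fin (d k)) : Set S := {ω | coDim d x.1 * δ x.1 <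
    |deviation (fun i => X i ω) Sig (modeEmbed d x.1 (Matrix.single x.2.1 x.2.2 1))|}
  have hbad (x) : μ (bad x) ≤ 2 * lexp (-(5 * Real.log (totalDim d))) :=
    measure_lt_abs_deviation_single_le hd hK hc hKc hn hσ hX hind (hlog x.1) (hδ x.1) x.2.1 x.2.2
  have hsubset : {ω | ∃ k a b, coDim d k * δ k <
      |deviation (fun i => X i ω) Sig (modeEmbed d k (Matrix.single a b 1))|} ⊆ ⋃ x, bad x :=
    fun _ ⟨k, a, b, h⟩ => Set.mem_iUnion.2 ⟨⟨k, a, b⟩, h⟩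
  calc _ ≤ ∑ x, μ (bad x) := (measure_mono hsubset).trans (measure_iUnion_fintype_le μ bad)
    _ ≤ ∑ _x : Σ k, Fin (d k) × Fin (d k), 2 * lexp (-(5 * Real.log (totalDim d))) :=
        Finset.sum_le_sum fun x _ => hbad x
    _ = _ := by
        rw [Finset.sum_const, nsmul_eq_mul, Finset.card_univ, Fintype.card_sigma]
        simp only [Fintype.card_prod, Fintype.card_fin]

lemma measure_lt_abs_deviation_diagonal_le (hL : 1 ≤ L) (hd : ∀ k, 0 < d k) (hK : 0 < K)
    (hc : 0 < c) (hKc : 128 * K ^ 2 * c ≤ 1) (hn : 0 < n) (hσ : 0 < opNorm Sig)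
    (hX : ∀ i, IsSubGaussianTensor μ K Sig (X i)) (hind : iIndepFun X μ)
    (hbig : L * (L + 1) * totalDim d ≤ c ^ 2 * (n * (minCoDim d : ℝ) ^ 2))
    {f : ∀ k, Fin (d k) → ℝ} (hf : frobNorm (kroneckerSumDiagonal d f) ≤ 2) :
    μ {ω | 2 * (hansonWrightConst (2 * K) + 7) *
          (opNorm Sig * √(L * totalDim d / (n * minCoDim d))) <
        |deviation (fun i => X i ω) Sig (kroneckerSumDiagonal d f)|} ≤
      2 * lexp (-(7 * (L * totalDim d / minCoDim d))) := by
  set q := √(L * totalDim d / (n * minCoDim d)) with hq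
  set H := hansonWrightConst (2 * K)
  have hH : 0 ≤ H := hansonWrightConst_nonneg _
  have hm : (0 : ℝ) < minCoDim d := mod_cast minCoDim_pos hL hd
  have : (0 : ℝ) < n := mod_cast hn
  have hq2 : n * q ^ 2 = L * totalDim d / minCoDim d := by
    rw [hq, Real.sq_sqrt (by positivity)]
    field_simp
  have hqc : q * √((L + 1) / minCoDim d) ≤ c := by
    rw [hq, ← Real.sqrt_mul (by positivity), Real.sqrt_le_left hc.le, div_mul_div_comm,
      div_le_iff₀ (by positivity)]
    linarith
  have hsmall : 128 * K ^ 2 * (q / 2 * opNorm (kroneckerSumDiagonal d f)) ≤ 1 := by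
    refine le_trans ?_ hKc
    gcongr
    calc q / 2 * opNorm (kroneckerSumDiagonal d f)
        ≤ q / 2 * (√((L + 1) / minCoDim d) * 2) := by
          gcongr
          exact (opNorm_kroneckerSum_le hL hd _).trans
            (mul_le_mul_of_nonneg_left hf (Real.sqrt_nonneg _))
      _ = q * √((L + 1) / minCoDim d) := by ring
      _ ≤ c := hqc
  refine (measure_lt_abs_deviation_le_of_opNorm_mul_le hK hn hσ hX hind (by positivity) hsmall
    (mul_left_comm _ _ _).le).trans ?_
  gcongr
  refine lexp_mono ?_
  calc (n : ℝ) * (H * (q / 2 * frobNorm (kroneckerSumDiagonal d f)) ^ 2 - q / 2 * (2 * (H + 7) * q))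
      ≤ n * (H * (q / 2 * 2) ^ 2 - q / 2 * (2 * (H + 7) * q)) := by
        gcongr
        exact mul_nonneg (by positivity) (frobNorm_nonneg _)
    _ = -(7 * (L * totalDim d / minCoDim d : ℝ)) := by rw [← hq2]; ring

lemma measure_exists_lt_abs_deviation_diagonal_le (hL : 1 ≤ L) (hd : ∀ k, 0 < d k) (hK : 0 < K)
    (hc : 0 < c) (hKc : 128 * K ^ 2 * c ≤ 1) (hn : 0 < n) (hσ : 0 < opNorm Sig)
    (hX : ∀ i, IsSubGaussianTensor μ K Sig (X i)) (hind : iIndepFun X μ)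
    (hbig : L * (L + 1) * totalDim d ≤ c ^ 2 * (n * (minCoDim d : ℝ) ^ 2))
    {N : Finset (∀ k, Fin (d k) → ℝ)} (hcard : N.card ≤ 5 ^ ∑ k, d k)
    (hN : ∀ f ∈ N, frobNorm (kroneckerSumDiagonal d f) ≤ 2) :
    μ {ω | ∃ f ∈ N, 2 * (hansonWrightConst (2 * K) + 7) *
          (opNorm Sig * √(L * totalDim d / (n * minCoDim d))) <
        |deviation (fun i => X i ω) Sig (kroneckerSumDiagonal d f)|} ≤
      2 * lexp (-(5 * Real.log (totalDim d))) := by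
  set r : ℝ := L * totalDim d / minCoDim d
  have hsum : ((∑ k, d k : ℕ) : ℝ) ≤ r := by
    push_cast
    exact sum_dim_le_div hL hd
  have hlog : Real.log (totalDim d) ≤ r :=
    (log_totalDim_le_sum hd).trans (sum_dim_le_div hL hd)
  have hcard' : (N.card : ENNReal) ≤ lexp (2 * r) :=
    calc (N.card : ENNReal) ≤ (5 ^ ∑ k, d k : ℕ) := mod_cast hcard
      _ ≤ lexp (2 * (∑ k, d k : ℕ)) := natCast_five_pow_le_lexp _
      _ ≤ lexp (2 * r) := lexp_mono (by linarith)
  simp only [← exists_prop, Set.ofPred_exists]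
  calc _ ≤ ∑ f ∈ N, _ := measure_biUnion_finset_le N _
    _ ≤ ∑ _f ∈ N, 2 * lexp (-(7 * r)) := Finset.sum_le_sum fun f hf =>
        measure_lt_abs_deviation_diagonal_le hL hd hK hc hKc hn hσ hX hind hbig (hN f hf)
    _ = N.card * (2 * lexp (-(7 * r))) := by rw [Finset.sum_const, nsmul_eq_mul]
    _ ≤ lexp (2 * r) * (2 * lexp (-(7 * r))) := by gcongr
    _ = 2 * lexp (-(5 * r)) := by rw [mul_left_comm, ← lexp_add]; congr 2; ring
    _ ≤ 2 * lexp (-(5 * Real.log (totalDim d))) := by gcongr; exact lexp_mono (by linarith)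

theorem measure_not_isNoiseBound_le (hL : 1 ≤ L) (hd : ∀ k, 0 < d k) (hp : 2 ≤ totalDim d)
    (hK : 0 < K) (hc : 0 < c) (hKc : 128 * K ^ 2 * c ≤ 1) (hn : 0 < n) (hσ : 0 < opNorm Sig)
    (hX : ∀ i, IsSubGaussianTensor μ K Sig (X i)) (hind : iIndepFun X μ)
    (hlog : ∀ k, Real.log (totalDim d) ≤ coDim d k) {δ : Fin L → ℝ}
    (hδ : ∀ k, (5 + hansonWrightConst (2 * K) * c ^ 2) / c *
      (opNorm Sig * √(Real.log (totalDim d) / (n * coDim d k))) ≤ δ k)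
    (hbig : L * (L + 1) * totalDim d ≤ c ^ 2 * (n * (minCoDim d : ℝ) ^ 2)) :
    μ {ω | ¬ IsNoiseBound (sampleCov (fun i => X i ω) - Sig) δ
        (2 * (hansonWrightConst (2 * K) + 7) *
          (opNorm Sig * √(L * totalDim d / (n * minCoDim d))))} ≤
      ENNReal.ofReal (L * Real.exp (-Real.log (totalDim d))) := by
  obtain ⟨N, hcard, hN, hnet⟩ := exists_finset_isNoiseBound d
  have := hansonWrightConst_nonneg (2 * K)
  set τ := 2 * (hansonWrightConst (2 * K) + 7) *
    (opNorm Sig * √(L * totalDim d / (n * minCoDim d)))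
  have hsubset : {ω | ¬ IsNoiseBound (sampleCov (fun i => X i ω) - Sig) δ τ} ⊆
      {ω | ∃ k a b, coDim d k * δ k <
        |deviation (fun i => X i ω) Sig (modeEmbed d k (Matrix.single a b 1))|} ∪
      {ω | ∃ f ∈ N, τ < |deviation (fun i => X i ω) Sig (kroneckerSumDiagonal d f)|} := by
    intro ω hω
    by_contra hgood
    simp only [Set.mem_union, Set.mem_ofPred_eq, not_or, not_exists, not_and, not_lt] at hgood
    exact hω (hnet _ _ _ (by positivity) hgood.1 hgood.2)
  calc _ ≤ _ := (measure_mono hsubset).trans (measure_union_le _ _)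
    _ ≤ ((∑ k, d k * d k : ℕ) + 1) * (2 * lexp (-(5 * Real.log (totalDim d)))) := by
        rw [add_mul, one_mul]
        exact add_le_add
          (measure_exists_lt_abs_deviation_single_le hd hK hc hKc hn hσ hX hind hlog hδ)
          (measure_exists_lt_abs_deviation_diagonal_le hL hd hK hc hKc hn hσ hX hind hbig hcard hN)
    _ = ENNReal.ofReal ((∑ k, (d k : ℝ) * d k + 1) *
          (2 * Real.exp (-(5 * Real.log (totalDim d))))) := by
        rw [lexp, ENNReal.ofReal_mul (by positivity), ENNReal.ofReal_mul zero_le_two,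
          ENNReal.ofReal_add (by positivity) zero_le_one, ENNReal.ofReal_one, ENNReal.ofReal_ofNat]
        norm_cast
    _ ≤ ENNReal.ofReal (L * Real.exp (-Real.log (totalDim d))) :=
        ENNReal.ofReal_le_ofReal (sum_sq_dim_mul_exp_le hL hd hp)

end NoiseEvent

section Conditioning

variable {ι : Type*} [Fintype ι] [DecidableEq ι] {A : Matrix ι ι ℝ}

lemma condNumber_inv (hA : IsUnit A.det) : condNumber A⁻¹ = opNorm A⁻¹ * opNorm A := by
  rw [condNumber, Matrix.nonsing_inv_nonsing_inv _ hA]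

variable [Nonempty ι]

lemma one_le_condNumber (hA : IsUnit A.det) : 1 ≤ condNumber A := by
  rw [condNumber, ← opNorm_one (ι := ι), ← Matrix.mul_nonsing_inv A hA]
  exact opNorm_mul_le A A⁻¹

lemma opNorm_pos_of_isUnit_det (hA : IsUnit A.det) : 0 < opNorm A :=
  pos_of_mul_pos_left (one_pos.trans_le (one_le_condNumber hA)) (opNorm_nonneg A⁻¹)

end Conditioning

section Accuracy

variable {L : ℕ} {d : Fin L → ℕ}

lemma nonempty_idx (hd : ∀ k, 0 < d k) : Nonempty (Idx d) := ⟨fun k => ⟨0, hd k⟩⟩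

lemma sparsity_mul_log_le_complexity (Ψ : ∀ k, Matrix (Fin (d k)) (Fin (d k)) ℝ) :
    sparsity Ψ * Real.log (totalDim d) ≤ complexity Ψ :=
  le_add_of_nonneg_right (by positivity)

lemma mul_totalDim_le_complexity (Ψ : ∀ k, Matrix (Fin (d k)) (Fin (d k)) ℝ) :
    (L : ℝ) * totalDim d ≤ complexity Ψ :=
  le_add_of_nonneg_left (mul_nonneg (Nat.cast_nonneg _) (Real.log_natCast_nonneg _))

lemma complexity_pos (hL : 1 ≤ L) (hd : ∀ k, 0 < d k)
    (Ψ : ∀ k, Matrix (Fin (d k)) (Fin (d k)) ℝ) : 0 < complexity Ψ := by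
  have := totalDim_pos hd
  exact lt_of_lt_of_le (by positivity) (mul_totalDim_le_complexity Ψ)

lemma div_le_mul_sqrt_minCoDim {b ε₀ σ δ ε : ℝ} {n : ℕ} (hd : ∀ k, 0 < d k) (hb : 0 ≤ b)
    (hσ : 0 ≤ σ) (hε₀ : 0 < ε₀) (hε : ε₀ ≤ ε) (k : Fin L)
    (hδ : δ ≤ b * (σ * √(Real.log (totalDim d) / (n * coDim d k)))) :
    δ / ε ≤ b / ε₀ * (σ * √(Real.log (totalDim d) / (n * minCoDim d))) := by
  have hm : 0 < minCoDim d := minCoDim_pos (Nat.one_le_of_lt k.pos) hd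
  have : 0 ≤ Real.log (totalDim d) := Real.log_natCast_nonneg _
  have hle : √(Real.log (totalDim d) / (n * coDim d k)) ≤
      √(Real.log (totalDim d) / (n * minCoDim d)) := by
    rcases Nat.eq_zero_or_pos n with rfl | hn
    · simp
    · have := minCoDim_le (d := d) k
      gcongr
  calc δ / ε ≤ b * (σ * √(Real.log (totalDim d) / (n * minCoDim d))) / ε := by
        gcongr
        · exact hε₀.le.trans hε
        · exact hδ.trans (by gcongr)
    _ ≤ b * (σ * √(Real.log (totalDim d) / (n * minCoDim d))) / ε₀ := by gcongr
    _ = b / ε₀ * (σ * √(Real.log (totalDim d) / (n * minCoDim d))) := by ring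

lemma penalty_add_noise_le {β T σ x : ℝ} (hβ : 0 ≤ β) (hT : 0 ≤ T) (hσ : 0 ≤ σ) (hx : 0 ≤ x)
    (Ψ : ∀ k, Matrix (Fin (d k)) (Fin (d k)) ℝ) :
    2 * (β * (σ * √(Real.log (totalDim d) / x))) * √(sparsity Ψ) +
      T * (σ * √(L * totalDim d / x)) ≤ (2 * β + T) * (σ * √(complexity Ψ / x)) := by
  have : 0 ≤ Real.log (totalDim d) := Real.log_natCast_nonneg _
  have hpenalty : √(Real.log (totalDim d) / x) * √(sparsity Ψ) ≤ √(complexity Ψ / x) := by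
    rw [← Real.sqrt_mul (by positivity), div_mul_eq_mul_div, mul_comm (Real.log _)]
    gcongr
    exact sparsity_mul_log_le_complexity Ψ
  have hnoise : √(L * totalDim d / x) ≤ √(complexity Ψ / x) := by
    gcongr
    exact mul_totalDim_le_complexity Ψ
  calc _ = 2 * β * (σ * (√(Real.log (totalDim d) / x) * √(sparsity Ψ))) +
        T * (σ * √(L * totalDim d / x)) := by ring
    _ ≤ 2 * β * (σ * √(complexity Ψ / x)) + T * (σ * √(complexity Ψ / x)) := by gcongr
    _ = (2 * β + T) * (σ * √(complexity Ψ / x)) := by ring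

lemma sqrt_div_mul_sqrt_div {l : ℝ} (hl : 0 ≤ l) {m : ℝ} (hm : 0 ≤ m) (n x : ℝ) :
    √(l / m) * √(x / (n * m)) = √l * √(x / (n * m ^ 2)) := by
  rw [← Real.sqrt_mul (by positivity), ← Real.sqrt_mul hl]
  ring_nf

lemma mul_sqrt_mul_sqrt_le_one {C κ l x n m : ℝ} (hl : 0 ≤ l) (hx : 0 ≤ x) (hn : 0 ≤ n)
    (h : C ^ 2 * l * κ ^ 4 * x ≤ n * m ^ 2) :
    C * κ ^ 2 * (√l * √(x / (n * m ^ 2))) ≤ 1 := by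
  refine (le_abs_self _).trans ((sq_le_one_iff_abs_le_one _).1 ?_)
  rw [← Real.sqrt_mul hl, mul_pow, Real.sq_sqrt (by positivity)]
  calc (C * κ ^ 2) ^ 2 * (l * (x / (n * m ^ 2))) = C ^ 2 * l * κ ^ 4 * x / (n * m ^ 2) := by ring
    _ ≤ 1 := div_le_one_of_le₀ h (by positivity)

lemma pos_and_mul_totalDim_le_of_sampleSize {c C κ : ℝ} {n : ℕ} (hL : 1 ≤ L)
    (hd : ∀ k, 0 < d k) (hc : 0 < c) (hCc : 1 / c ≤ C) (hκ : 1 ≤ κ)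
    {Ψ : ∀ k, Matrix (Fin (d k)) (Fin (d k)) ℝ}
    (h : C ^ 2 * (L + 1) * κ ^ 4 * complexity Ψ ≤ n * (minCoDim d : ℝ) ^ 2) :
    0 < n ∧ L * (L + 1) * totalDim d ≤ c ^ 2 * (n * (minCoDim d : ℝ) ^ 2) := by
  have hx := complexity_pos hL hd Ψ
  have hC : 0 < C := lt_of_lt_of_le (by positivity) hCc
  refine ⟨Nat.pos_of_ne_zero ?_, ?_⟩
  · rintro rfl
    have hpos : 0 < C ^ 2 * (L + 1) * κ ^ 4 * complexity Ψ := by positivity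
    simp only [Nat.cast_zero, zero_mul] at h
    exact h.not_gt hpos
  · have hcC : 1 ≤ (c * C) ^ 2 := one_le_pow₀ ((div_le_iff₀' hc).1 hCc)
    calc (L : ℝ) * (L + 1) * totalDim d = 1 * ((L + 1) * 1 * (L * totalDim d)) := by ring
      _ ≤ (c * C) ^ 2 * ((L + 1) * κ ^ 4 * complexity Ψ) := by
          gcongr
          · exact one_le_pow₀ hκ
          · exact mul_totalDim_le_complexity Ψ
      _ = c ^ 2 * (C ^ 2 * (L + 1) * κ ^ 4 * complexity Ψ) := by ring
      _ ≤ c ^ 2 * (n * (minCoDim d : ℝ) ^ 2) := by gcongr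

lemma relative_errors_le (hL : 1 ≤ L) (hd : ∀ k, 0 < d k) {C κ x n : ℝ} (hC : 0 ≤ C) (hκ : 0 ≤ κ)
    {Φ Ψ : ∀ k, Matrix (Fin (d k)) (Fin (d k)) ℝ}
    (h : frobNorm (kroneckerSum Φ - kroneckerSum Ψ) ≤
      C * κ * √(x / (n * minCoDim d)) * opNorm (kroneckerSum Ψ)) :
    frobNorm (kroneckerSum Φ - kroneckerSum Ψ) / opNorm (kroneckerSum Ψ) ≤
      C * κ * √(x / (n * minCoDim d)) ∧
    opNorm (kroneckerSum Φ - kroneckerSum Ψ) / opNorm (kroneckerSum Ψ) ≤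
      C * √(L + 1) * κ * √(x / (n * (minCoDim d : ℝ) ^ 2)) ∧
    frobNorm (kroneckerSum Φ - kroneckerSum Ψ) / frobNorm (kroneckerSum Ψ) ≤
      C * √(L + 1) * κ * √(x / (n * (minCoDim d : ℝ) ^ 2)) := by
  have hop := kroneckerSum_sub Φ Ψ ▸ opNorm_kroneckerSum_le hL hd (Φ - Ψ)
  have hrate : √((L + 1) / minCoDim d) * (C * κ * √(x / (n * minCoDim d))) =
      C * √(L + 1) * κ * √(x / (n * (minCoDim d : ℝ) ^ 2)) := by
    linear_combination
      C * κ * sqrt_div_mul_sqrt_div (by positivity : (0 : ℝ) ≤ L + 1) (minCoDim d).cast_nonneg n x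
  rw [← hrate]
  set q := √((L + 1 : ℝ) / minCoDim d)
  set D := C * κ * √(x / (n * minCoDim d))
  refine ⟨div_le_of_le_mul₀ (opNorm_nonneg _) (by positivity) h,
    div_le_of_le_mul₀ (opNorm_nonneg _) (by positivity) ?_,
    div_le_of_le_mul₀ (frobNorm_nonneg _) (by positivity) ?_⟩
  · rw [mul_assoc]
    exact hop.trans (by gcongr)
  · calc frobNorm (kroneckerSum Φ - kroneckerSum Ψ) ≤ D * opNorm (kroneckerSum Ψ) := h
      _ ≤ D * (q * frobNorm (kroneckerSum Ψ)) := by gcongr; exact opNorm_kroneckerSum_le hL hd Ψ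
      _ = q * D * frobNorm (kroneckerSum Ψ) := by ring

theorem existsUnique_isEstimator_and_frobNorm_sub_le (hL : 1 ≤ L) (hd : ∀ k, 0 < d k)
    {n : ℕ} (hn : 0 < n) {Ψ : ∀ k, Matrix (Fin (d k)) (Fin (d k)) ℝ}
    (hΨ : (kroneckerSum Ψ).PosDef) {S : Matrix (Idx d) (Idx d) ℝ} {δ ρ : Fin L → ℝ} {β T C : ℝ}
    (hβ : 0 ≤ β) (hT : 0 ≤ T) (hC : 20 * (2 * β + T) < C)
    (hW : IsNoiseBound (S - (kroneckerSum Ψ)⁻¹) δ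
      (T * (opNorm (kroneckerSum Ψ)⁻¹ * √(L * totalDim d / (n * minCoDim d)))))
    (hδρ : ∀ k, δ k ≤ ρ k) (hρ : ∀ k, 0 ≤ ρ k)
    (hρβ : ∀ k, ρ k ≤
      β * (opNorm (kroneckerSum Ψ)⁻¹ * √(Real.log (totalDim d) / (n * minCoDim d))))
    (hsample : C ^ 2 * (L + 1) * condNumber (kroneckerSum Ψ)⁻¹ ^ 4 * complexity Ψ ≤
      n * (minCoDim d : ℝ) ^ 2) :
    (∃! Ωhat, IsEstimator S ρ Ωhat) ∧
      ∀ Ωhat, IsEstimator S ρ Ωhat → frobNorm (Ωhat - kroneckerSum Ψ) ≤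
        C * condNumber (kroneckerSum Ψ)⁻¹ * √(complexity Ψ / (n * minCoDim d)) *
          opNorm (kroneckerSum Ψ) := by
  have := nonempty_idx hd
  have hdet : IsUnit (kroneckerSum Ψ).det := hΨ.det_pos.ne'.isUnit
  have hM := opNorm_pos_of_isUnit_det hdet
  have hσ := opNorm_pos_of_isUnit_det (Matrix.isUnit_nonsing_inv_det _ hdet)
  have hm : (0 : ℝ) < minCoDim d := mod_cast minCoDim_pos hL hd
  have hx := complexity_pos hL hd Ψ
  have hsmall := mul_sqrt_mul_sqrt_le_one (by positivity) hx.le n.cast_nonneg hsample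
  rw [← sqrt_div_mul_sqrt_div (by positivity) hm.le] at hsmall
  have hrate := penalty_add_noise_le hβ hT hσ.le (by positivity : 0 ≤ (n * minCoDim d : ℝ)) Ψ
  rw [condNumber_inv hdet] at hsmall ⊢
  set M := opNorm (kroneckerSum Ψ)
  set σ := opNorm (kroneckerSum Ψ)⁻¹
  set r := √(complexity Ψ / (n * minCoDim d))
  set q := √((L + 1 : ℝ) / minCoDim d)
  have : 0 < r := Real.sqrt_pos.2 (by positivity)
  have : 0 < C := hC.trans_le' (by positivity)
  obtain ⟨hunique, hfrob⟩ := existsUnique_isEstimator_of_isNoiseBound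
    (R := C / 5 * (σ * M) * r * M) hL hd hΨ hW (by positivity) hδρ hρ hρβ (by positivity)
    (calc σ * (q * (C / 5 * (σ * M) * r * M)) = 1 / 5 * (C * (σ * M) ^ 2 * (q * r)) := by ring
      _ ≤ 1 / 5 := by linarith)
    (calc 4 * M ^ 2 * _ ≤ 4 * M ^ 2 * ((2 * β + T) * (σ * r)) := by gcongr
      _ = 20 * (2 * β + T) / 5 * (σ * M) * r * M := by ring
      _ < C / 5 * (σ * M) * r * M := by gcongr)
  refine ⟨hunique, fun Ωhat hΩhat => (hfrob Ωhat hΩhat).trans ?_⟩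
  gcongr
  linarith

end Accuracy

section Probability

variable {S : Type*} [MeasurableSpace S] {μ : Measure S} [IsProbabilityMeasure μ]

lemma exists_measurableSet_forall_mem_of_measure_not_le {P : S → Prop} {x : ℝ} (hx : 0 ≤ x)
    (h : μ {ω | ¬ P ω} ≤ ENNReal.ofReal x) :
    ∃ E, MeasurableSet E ∧ 1 - x ≤ μ.real E ∧ ∀ ω ∈ E, P ω := by
  have hmeas := measurableSet_toMeasurable μ {ω | ¬ P ω}
  refine ⟨(toMeasurable μ {ω | ¬ P ω})ᶜ, hmeas.compl, ?_, fun ω hω => ?_⟩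
  · rw [probReal_compl_eq_one_sub hmeas, measureReal_def, measure_toMeasurable]
    exact sub_le_sub_left (ENNReal.toReal_le_of_le_ofReal hx h) 1
  · by_contra hP
    exact hω (subset_toMeasurable μ _ hP)

lemma exists_measurableSet_isNoiseBound {L : ℕ} {d : Fin L → ℕ} {n : ℕ} {K c : ℝ}
    {X : Fin n → S → Idx d → ℝ} {Sig : Matrix (Idx d) (Idx d) ℝ} (hL : 1 ≤ L)
    (hd : ∀ k, 0 < d k) (hK : 0 < K) (hc : 0 < c) (hKc : 128 * K ^ 2 * c ≤ 1) (hn : 0 < n)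
    (hσ : 0 < opNorm Sig) (hX : ∀ i, IsSubGaussianTensor μ K Sig (X i)) (hind : iIndepFun X μ)
    (hlog : ∀ k, Real.log (totalDim d) ≤ coDim d k) {δ : Fin L → ℝ}
    (hδ : ∀ k, (5 + hansonWrightConst (2 * K) * c ^ 2) / c *
      (opNorm Sig * √(Real.log (totalDim d) / (n * coDim d k))) ≤ δ k)
    (hbig : L * (L + 1) * totalDim d ≤ c ^ 2 * (n * (minCoDim d : ℝ) ^ 2)) :
    ∃ E, MeasurableSet E ∧ 1 - L * Real.exp (-Real.log (totalDim d)) ≤ μ.real E ∧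
      ∀ ω ∈ E, IsNoiseBound (sampleCov (fun i => X i ω) - Sig) δ
        (2 * (hansonWrightConst (2 * K) + 7) *
          (opNorm Sig * √(L * totalDim d / (n * minCoDim d)))) := by
  rcases Nat.lt_or_ge (totalDim d) 2 with hp | hp
  · have hone : totalDim d = 1 := by have := totalDim_pos hd; lia
    have hL' : (1 : ℝ) ≤ L := mod_cast hL
    exact ⟨∅, .empty, by simpa [hone] using hL', by simp⟩
  · exact exists_measurableSet_forall_mem_of_measure_not_le (by positivity)
      (measure_not_isNoiseBound_le hL hd hp hK hc hKc hn hσ hX hind hlog hδ hbig)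

end Probability

end TeraLasso

theorem mainTheorem1_general :
    ∀ K : ℝ, 0 < K → ∃ a : ℝ, 0 < a ∧ ∃ c : ℝ, 0 < c ∧
    ∀ b : ℝ, a ≤ b → ∀ ε₀ : ℝ, 0 < ε₀ → ∃ C : ℝ, 0 < C ∧
    ∀ (L : ℕ) (_ : 1 ≤ L) (d : Fin L → ℕ) (_ : ∀ k, 0 < d k) (n : ℕ)
      (Ψ : ∀ k, Matrix (Fin (d k)) (Fin (d k)) ℝ)
      (Ω₀ Sig₀ : Matrix (Idx d) (Idx d) ℝ) (_ : Ω₀ = kroneckerSum Ψ) (_ : Sig₀ = Ω₀⁻¹)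
      (S : Type*) (_ : MeasurableSpace S) (μ : Measure S) (_ : IsProbabilityMeasure μ)
      (X : Fin n → S → Idx d → ℝ)
      (_ : ∀ i, IsSubGaussianTensor μ K Sig₀ (X i)) (_ : iIndepFun X μ)
      (δ ε ρ : Fin L → ℝ)
      (_ : ∀ k, Real.log (totalDim d) ≤ coDim d k)
      (_ : ∀ k, a * (opNorm Sig₀ * √(Real.log (totalDim d) / (n * coDim d k))) ≤ δ k)
      (_ : ∀ k, δ k ≤ b * (opNorm Sig₀ * √(Real.log (totalDim d) / (n * coDim d k))))
      (_ : ∀ k, ε₀ ≤ ε k ∧ ε k < 1) (_ : ∀ k, ρ k = δ k / ε k)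
      (_ : Ω₀.PosDef)
      (_ : C ^ 2 * (L + 1) * condNumber Sig₀ ^ 4 * complexity Ψ ≤ n * (minCoDim d : ℝ) ^ 2),
      ∃ E : Set S, MeasurableSet E ∧
        1 - L * Real.exp (-c * Real.log (totalDim d)) ≤ μ.real E ∧
        ∀ ω ∈ E,
          (∃! Ωhat, IsEstimator (sampleCov fun i => X i ω) ρ Ωhat) ∧
          ∀ Ωhat, IsEstimator (sampleCov fun i => X i ω) ρ Ωhat →
            frobNorm (Ωhat - Ω₀) / opNorm Ω₀ ≤
              C * condNumber Sig₀ * √(complexity Ψ / (n * minCoDim d)) ∧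
            opNorm (Ωhat - Ω₀) / opNorm Ω₀ ≤
              C * √(L + 1) * condNumber Sig₀ *
                √(complexity Ψ / (n * (minCoDim d : ℝ) ^ 2)) ∧
            frobNorm (Ωhat - Ω₀) / frobNorm Ω₀ ≤
              C * √(L + 1) * condNumber Sig₀ *
                √(complexity Ψ / (n * (minCoDim d : ℝ) ^ 2)) := by
  intro K hK
  obtain ⟨c, hc, hKc⟩ : ∃ c : ℝ, 0 < c ∧ 128 * K ^ 2 * c ≤ 1 :=
    ⟨(128 * K ^ 2)⁻¹, by positivity, (mul_inv_cancel₀ (by positivity)).le⟩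
  have hH := hansonWrightConst_nonneg (2 * K)
  have hT : 0 ≤ 2 * (hansonWrightConst (2 * K) + 7) := by positivity
  refine ⟨(5 + hansonWrightConst (2 * K) * c ^ 2) / c, by positivity, 1, one_pos, ?_⟩
  intro b hab ε₀ hε₀
  have hb : 0 ≤ b := hab.trans' (by positivity)
  refine ⟨20 * (2 * (b / ε₀) + 2 * (hansonWrightConst (2 * K) + 7)) + 1 / c, by positivity, ?_⟩
  rintro L hL d hd n Ψ _ _ rfl rfl S _ μ _ X hX hind δ ε ρ hlog hδa hδb hε hρ hΨ hsample
  obtain rfl : ρ = fun k => δ k / ε k := funext hρ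
  have := nonempty_idx hd
  have hdet := Matrix.isUnit_nonsing_inv_det _ hΨ.det_pos.ne'.isUnit
  have hσ := opNorm_pos_of_isUnit_det hdet
  have hκ := one_le_condNumber hdet
  obtain ⟨hn, hbig⟩ := pos_and_mul_totalDim_le_of_sampleSize hL hd hc
    (le_add_of_nonneg_left (by positivity)) hκ hsample
  obtain ⟨E, hE, hμE, hnoise⟩ :=
    exists_measurableSet_isNoiseBound hL hd hK hc hKc hn hσ hX hind hlog hδa hbig
  refine ⟨E, hE, by simpa using hμE, fun ω hω => ?_⟩
  have hδ : ∀ k, 0 ≤ δ k := fun k => (hδa k).trans' (by positivity)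
  have hε' : ∀ k, 0 < ε k := fun k => hε₀.trans_le (hε k).1
  obtain ⟨hunique, hfrob⟩ := existsUnique_isEstimator_and_frobNorm_sub_le hL hd hn hΨ
    (by positivity) hT (lt_add_of_pos_right _ (by positivity)) (hnoise ω hω)
    (fun k => le_div_self (hδ k) (hε' k) (hε k).2.le) (fun k => div_nonneg (hδ k) (hε' k).le)
    (fun k => div_le_mul_sqrt_minCoDim hd hb hσ.le hε₀ (hε k).1 k (hδb k)) hsample
  refine ⟨hunique, fun Ωhat hΩhat => ?_⟩
  obtain ⟨-, Φ, rfl, -⟩ := id hΩhat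
  exact relative_errors_le hL hd (by positivity) (by positivity) (hfrob _ hΩhat)

theorem mainTheorem1 :
    -- `K` bounds the sub-gaussian norms; `a` and `c` depend on `K` only
    ∀ K : ℝ, 0 < K → ∃ a : ℝ, 0 < a ∧ ∃ c : ℝ, 0 < c ∧
    -- `b` is the upper constant in the order of the penalty levels, `ε₀` a lower bound of the `ε k`
    ∀ b : ℝ, a ≤ b → ∀ ε₀ : ℝ, 0 < ε₀ → ∃ C : ℝ, 0 < C ∧
    ∀ (L : ℕ) (_ : 1 ≤ L) (d : Fin L → ℕ) (_ : ∀ k, 0 < d k) (n : ℕ)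
      (Ψ : ∀ k, Matrix (Fin (d k)) (Fin (d k)) ℝ)
      (Ω₀ Sig₀ : Matrix (Idx d) (Idx d) ℝ) (_ : Ω₀ = kroneckerSum Ψ) (_ : Sig₀ = Ω₀⁻¹)
      (S : Type*) (_ : MeasurableSpace S) (μ : Measure S) (_ : IsProbabilityMeasure μ)
      (X : Fin n → S → Idx d → ℝ)
      (_ : ∀ i, IsSubGaussianTensor μ K Sig₀ (X i))
      (_ : iIndepFun X μ) (_ : ∀ i j, IdentDistrib (X i) (X j) μ μ)
      (δ ε ρ : Fin L → ℝ)
      -- (A1)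
      (_ : ∀ k, Real.log (totalDim d) ≤ coDim d k)
      (_ : ∀ k, a * (opNorm Sig₀ * Real.sqrt (Real.log (totalDim d) / (n * coDim d k))) ≤ δ k)
      (_ : ∀ k, δ k ≤ b * (opNorm Sig₀ * Real.sqrt (Real.log (totalDim d) / (n * coDim d k))))
      (_ : ∀ k, ε₀ ≤ ε k ∧ ε k < 1) (_ : ∀ k, ρ k = δ k / ε k)
      -- (A2)
      (kLow kUp : ℝ) (_ : 0 < kLow) (_ : SpectrumWithin Ω₀ kLow kUp)
      -- (A3)
      (_ : C ^ 2 * (L + 1) * condNumber Sig₀ ^ 4 * complexity Ψ ≤ n * (minCoDim d : ℝ) ^ 2),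
      ∃ E : Set S, MeasurableSet E ∧
        1 - L * Real.exp (-c * Real.log (totalDim d)) ≤ μ.real E ∧
        ∀ ω ∈ E,
          (∃! Ωhat, IsEstimator (sampleCov fun i => X i ω) ρ Ωhat) ∧
          ∀ Ωhat, IsEstimator (sampleCov fun i => X i ω) ρ Ωhat →
            frobNorm (Ωhat - Ω₀) / opNorm Ω₀ ≤
              C * condNumber Sig₀ * Real.sqrt (complexity Ψ / (n * minCoDim d)) ∧
            opNorm (Ωhat - Ω₀) / opNorm Ω₀ ≤
              C * Real.sqrt (L + 1) * condNumber Sig₀ *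
                Real.sqrt (complexity Ψ / (n * (minCoDim d : ℝ) ^ 2)) ∧
            frobNorm (Ωhat - Ω₀) / frobNorm Ω₀ ≤
              C * Real.sqrt (L + 1) * condNumber Sig₀ *
                Real.sqrt (complexity Ψ / (n * (minCoDim d : ℝ) ^ 2)) := by
  intro K hK
  obtain ⟨a, ha, c, hc, hgeneral⟩ := mainTheorem1_general K hK
  refine ⟨a, ha, c, hc, fun b hab ε₀ hε₀ => ?_⟩
  obtain ⟨C, hC, hbound⟩ := hgeneral b hab ε₀ hε₀
  exact ⟨C, hC, fun L hL d hd n Ψ Ω₀ Sig₀ hΩ₀ hSig₀ S _ μ hμ X hX hind _ δ ε ρ hlog hδa hδb hε hρ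
    _ _ hlo hspec => hbound L hL d hd n Ψ Ω₀ Sig₀ hΩ₀ hSig₀ S _ μ hμ X hX hind δ ε ρ hlog hδa hδb
      hε hρ (posDef_of_spectrumWithin hlo hspec)⟩
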